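/- **Conventions.** A *prop* is a strict symmetric monoidal category with objects the natural numbers and addition as tensor; $s;t$ is composition in diagrammatic order. Angles are taken modulo $2\pi$. **ZX-calculus.** $\mathbf{ZX}$ is the prop generated by Z-spiders $Z^{n}_{m}(\alpha):n\to m$, X-spiders $X^{n}_{m}(\alpha):n\to m$ and the Hadamard gate $H:1\to1$, subject to the following (scalar-free) equations, for all arities and phases: only connectivity matters (spiders are invariant under permuting their inputs and outputs, and $Z^0_2(0);(H\otimes \mathrm{id})=Z^0_2(0);(\mathrm{id}\otimes H)$; a bent wire is a phase-free spider with two legs); fusion of two Z-spiders connected by at least one wire, adding the phases; $Z^1_1(0)=\mathrm{id}$; $H;H=\mathrm{id}$; colour change $H^{\otimes n};Z^n_m(\alpha);H^{\otimes m}=X^n_m(\alpha)$; $X^1_1(\pi);Z^1_n(\alpha)=Z^1_n(-\alpha);X^1_1(\pi)^{\otimes n}$; copying $X^0_1(a\pi);Z^1_n(\alpha)=X^0_1(a\pi)^{\otimes n}$ for $a\in\{0,1\}$; the bialgebra law $X^2_1(0);Z^1_2(0)=(Z^1_2(0)\otimes Z^1_2(0));(\mathrm{id}\otimes\mathrm{swap}\otimes\mathrm{id});(X^2_1(0)\otimes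 X^2_1(0))$; and the Euler decomposition $H=Z^1_1(\tfrac\pi2);X^1_1(\tfrac\pi2);Z^1_1(\tfrac\pi2)$. **Graphs.** Fix a countable set $\mathcal V$ of vertex names. Let $\mathrm{LC}$ be the free monoid on $\{\frac r2,r,-\frac r2,\frac g2,g,-\frac g2\}$. An *MBQC+LC-graph* is a tuple $G=(V,E,I,O,\lambda,\ell^i,\ell^o)$, where $V\subseteq\mathcal V$ is finite, $(V,E)$ is an undirected irreflexive graph, $I$ and $O$ (inputs and outputs) are repetition-free lists of elements of $V$, $\lambda:V\setminus O\to\{XY,XZ,YZ\}\times[0,2\pi)$, $\ell^i:I\to\mathrm{LC}$ and $\ell^o:O\to\mathrm{LC}$. The layer $\mathbf{MBQC{+}LC}$ is the free prop whose generators $n\to m$ are the MBQC+LC-graphs with $|I|=n$, $|O|=m$. **2-cells.** The generating 2-cells are $G\to G\star u$, $G\to G\wedge uv$, $G\to G\setminus u$ and $G\to G[W/U]$, defined whenever $G$ is in the domain of the operation: - *Local complementation* $G\star u$, for $u\in V$. If $u\notin I$: the edges become $E\,\Delta\,\{(a,b): a,b\in N(u),a\ne b\}$; the label of $u$ changes by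 $\ell^o(u)\mapsto\frac r2\cdot\ell^o(u)$ if $u\in O$ and otherwise $(XY,\alpha)\mapsto(XZ,\frac\pi2-\alpha)$, $(XZ,\alpha)\mapsto(XY,\alpha-\frac\pi2)$, $(YZ,\alpha)\mapsto(YZ,\alpha+\frac\pi2)$; for each $v\in N(u)$, $\ell^o(v)\mapsto-\frac g2\cdot\ell^o(v)$ if $v\in O$ and otherwise $(XY,\alpha)\mapsto(XY,\alpha-\frac\pi2)$, $(XZ,\alpha)\mapsto(YZ,\alpha)$, $(YZ,\alpha)\mapsto(XZ,-\alpha)$; everything else is unchanged. If $u\in I$: choose any name $u'\in\mathcal V\setminus V$, add the vertex $u'$ with the edge $(u,u')$ and the label $\lambda(u')=(XY,0)$, replace $u$ by $u'$ in $I$ with input label $\ell^i(u)\cdot\frac g2\cdot\frac r2\cdot\frac g2$, and then apply the first case. - *Pivot* $G\wedge uv=((G\star u)\star v)\star u$, for $(u,v)\in E$. - *Vertex removal* $G\setminus u$, for $u\in V\setminus(I\cup O)$ with $\lambda(u)=(P,a\pi)$, $P\in\{XZ,YZ\}$, $a\in\{0,1\}$: delete $u$ and its edges; for each $v\in N(u)$,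 $\ell^o(v)\mapsto g^a\cdot\ell^o(v)$ if $v\in O$, and otherwise $(XY,\alpha)\mapsto(XY,\alpha+a\pi)$ and $(Q,\alpha)\mapsto(Q,(-1)^a\alpha)$ for $Q\in\{XZ,YZ\}$. - *Renaming* $G[W/U]$, for repetition-free lists $U$ in $V$ and $W$ in $\mathcal V\setminus V$ of the same length: replace the vertices in $U$ by the names in $W$, in order. The 2-cells between terms are generated by these under identities (between terms equal by the prop axioms), vertical composition, horizontal composition and tensor. **Translation.** $D:\mathbf{MBQC{+}LC}\to\mathbf{ZX}$ is the identity-on-objects prop functor that sends a generator $G$ to the following diagram: draw a phase-free Z-spider for each vertex and a Hadamard gate between the spiders of $u$ and $v$ for each edge $(u,v)$; connect the inputs $I$ and outputs $O$ to the $n$ input and $m$ output wires in the given order; attach to each $u\notin O$ the effect $Z^1_0(\alpha)$, $\;Z^1_1(\frac\pi2);X^1_0(\alpha)$, or $X^1_0(\alpha)$, if $\lambda(u)$ is $(XY,\alpha)$, $(XZ,\alpha)$ or $(YZ,\alpha)$, respectively; precompose each input $v$ with $\ell^i(v)$ and postcompose each output $w$ with $\ell^o(w)$, where a word is the composite, from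 left to right, of its letters, $\pm\frac r2,r$ standing for $X^1_1(\pm\frac\pi2),X^1_1(\pi)$ and $\pm\frac g2,g$ for $Z^1_1(\pm\frac\pi2),Z^1_1(\pi)$. **Theorem (Soundness).** Let $G,G':n\to m$ be two terms in $\mathbf{MBQC{+}LC}$ such that there is a 2-cell $\eta:G\to G'$. Then $D(G)=D(G')$ in $\mathbf{ZX}$. -/

import Mathlib

open Real

universe u v

/-! ## Props presented by generators and equations -/

/-- Terms of the free prop on a signature `Sig` (`Sig n m` is the set of generators `n → m`).
Besides generators, sequential composition (in diagrammatic order) and parallel composition, a prop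
has a morphism for every permutation of wires: `perm σ` sends the `i`-th input wire to the `σ i`-th
output wire. Identities, symmetries and rebracketings are special cases of `perm`. -/
inductive PropTerm (Sig : ℕ → ℕ → Type u) : ℕ → ℕ → Type u
  | gen {n m : ℕ} (g : Sig n m) : PropTerm Sig n m
  | perm {n m : ℕ} (σ : Fin n ≃ Fin m) : PropTerm Sig n m
  | comp {n m k : ℕ} (s : PropTerm Sig n m) (t : PropTerm Sig m k) : PropTerm Sig n k
  | tensor {n m n' m' : ℕ} (s : PropTerm Sig n m) (t : PropTerm Sig n' m') :
      PropTerm Sig (n + n') (m + m')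

namespace PropTerm

infixl:60 " ⨟ " => PropTerm.comp
infixl:70 " ⊠ " => PropTerm.tensor

variable {Sig : ℕ → ℕ → Type u}

/-- The identity on `n` wires. -/
def idt (n : ℕ) : PropTerm Sig n n := perm (Equiv.refl (Fin n))

/-- The identity between two equal numbers of wires. -/
def recast {n m : ℕ} (h : n = m) : PropTerm Sig n m := perm (finCongr h)

/-- Juxtaposition of two permutations of wires. -/
def permSum {n m n' m' : ℕ} (σ : Fin n ≃ Fin m) (τ : Fin n' ≃ Fin m') :
    Fin (n + n') ≃ Fin (m + m') :=
  (finSumFinEquiv.symm.trans (Equiv.sumCongr σ τ)).trans finSumFinEquiv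

/-- `n` parallel copies of a term on a single wire. -/
def power (t : PropTerm Sig 1 1) : (n : ℕ) → PropTerm Sig n n
  | 0 => idt 0
  | n + 1 => power t n ⊠ t

/-- `n` parallel copies of a state on a single wire. -/
def copies (t : PropTerm Sig 0 1) : (n : ℕ) → PropTerm Sig 0 n
  | 0 => idt 0
  | n + 1 => copies t n ⊠ t

/-- The parallel composition of a finite family of terms. The `j`-th leg of the `i`-th term is
the wire `finSigmaFinEquiv ⟨i, j⟩` of the result. -/
def tensorFin : (N : ℕ) → {a b : Fin N → ℕ} → (∀ i, PropTerm Sig (a i) (b i)) →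
    PropTerm Sig (∑ i, a i) (∑ i, b i)
  | 0, _, _, _ => recast (by simp)
  | N + 1, a, b, t =>
      recast (Fin.sum_univ_succ a) ⨟ (t 0 ⊠ tensorFin N (fun i => t i.succ)) ⨟
        recast (Fin.sum_univ_succ b).symm

/-- Interpret every generator of a signature by a term over another signature; this extends to
all terms by preserving permutations, composition and tensor. -/
def lift {Sig' : ℕ → ℕ → Type v} (φ : ∀ {n m : ℕ}, Sig n m → PropTerm Sig' n m) :
    {n m : ℕ} → PropTerm Sig n m → PropTerm Sig' n m
  | _, _, gen g => φ g
  | _, _, perm σ => perm σ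
  | _, _, comp s t => comp (lift φ s) (lift φ t)
  | _, _, tensor s t => tensor (lift φ s) (lift φ t)

end PropTerm

open PropTerm in
/-- Equality of terms in the prop presented by the signature `Sig` and the equations `R`: the least
congruence containing `R` and the axioms of a prop (a strict symmetric monoidal category whose
objects are the natural numbers, with addition as tensor). -/
inductive PropEq {Sig : ℕ → ℕ → Type u}
    (R : ∀ ⦃n m : ℕ⦄, PropTerm Sig n m → PropTerm Sig n m → Prop) :
    ∀ {n m : ℕ}, PropTerm Sig n m → PropTerm Sig n m → Prop
  | rule {n m : ℕ} {s t : PropTerm Sig n m} (h : R s t) : PropEq R s t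
  | refl {n m : ℕ} (t : PropTerm Sig n m) : PropEq R t t
  | symm {n m : ℕ} {s t : PropTerm Sig n m} (h : PropEq R s t) : PropEq R t s
  | trans {n m : ℕ} {s t r : PropTerm Sig n m} (h : PropEq R s t) (h' : PropEq R t r) :
      PropEq R s r
  | comp_congr {n m k : ℕ} {s s' : PropTerm Sig n m} {t t' : PropTerm Sig m k}
      (h : PropEq R s s') (h' : PropEq R t t') : PropEq R (s ⨟ t) (s' ⨟ t')
  | tensor_congr {n m n' m' : ℕ} {s s' : PropTerm Sig n m} {t t' : PropTerm Sig n' m'}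
      (h : PropEq R s s') (h' : PropEq R t t') : PropEq R (s ⊠ t) (s' ⊠ t')
  | comp_assoc {n m k l : ℕ} (s : PropTerm Sig n m) (t : PropTerm Sig m k)
      (r : PropTerm Sig k l) : PropEq R (s ⨟ t ⨟ r) (s ⨟ (t ⨟ r))
  | id_comp {n m : ℕ} (t : PropTerm Sig n m) : PropEq R (idt n ⨟ t) t
  | comp_id {n m : ℕ} (t : PropTerm Sig n m) : PropEq R (t ⨟ idt m) t
  | interchange {n m k n' m' k' : ℕ} (s : PropTerm Sig n m) (t : PropTerm Sig m k)
      (s' : PropTerm Sig n' m') (t' : PropTerm Sig m' k') :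
      PropEq R ((s ⨟ t) ⊠ (s' ⨟ t')) ((s ⊠ s') ⨟ (t ⊠ t'))
  | perm_comp {n m k : ℕ} (σ : Fin n ≃ Fin m) (τ : Fin m ≃ Fin k) :
      PropEq R (perm σ ⨟ perm τ) (perm (σ.trans τ))
  | perm_tensor {n m n' m' : ℕ} (σ : Fin n ≃ Fin m) (τ : Fin n' ≃ Fin m') :
      PropEq R (perm σ ⊠ perm τ) (perm (permSum σ τ))
  | tensor_assoc {a a' b b' c c' : ℕ} (s : PropTerm Sig a a') (t : PropTerm Sig b b')
      (r : PropTerm Sig c c') :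
      PropEq R ((s ⊠ t ⊠ r) ⨟ recast (Nat.add_assoc a' b' c'))
        (recast (Nat.add_assoc a b c) ⨟ (s ⊠ (t ⊠ r)))
  | unit_tensor {n m : ℕ} (t : PropTerm Sig n m) :
      PropEq R ((idt 0 ⊠ t) ⨟ recast (Nat.zero_add m)) (recast (Nat.zero_add n) ⨟ t)
  | tensor_unit {n m : ℕ} (t : PropTerm Sig n m) :
      PropEq R ((t ⊠ idt 0) ⨟ recast (Nat.add_zero m)) (recast (Nat.add_zero n) ⨟ t)
  | swap_natural {n m n' m' : ℕ} (s : PropTerm Sig n m) (t : PropTerm Sig n' m') :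
      PropEq R ((s ⊠ t) ⨟ perm finAddFlip) (perm finAddFlip ⨟ (t ⊠ s))

/-! ## The ZX-calculus -/

/-- The generators of the ZX-calculus; phases are angles modulo `2π`. -/
inductive ZXGen : ℕ → ℕ → Type
  | Z (n m : ℕ) (α : Real.Angle) : ZXGen n m
  | X (n m : ℕ) (α : Real.Angle) : ZXGen n m
  | H : ZXGen 1 1

/-- Terms over the generators of the ZX-calculus. -/
abbrev ZXTerm : ℕ → ℕ → Type := PropTerm ZXGen

namespace ZXTerm

/-- The Z-spider with `n` inputs, `m` outputs and phase `α`. -/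
def Z (n m : ℕ) (α : Real.Angle) : ZXTerm n m := .gen (.Z n m α)

/-- The X-spider with `n` inputs, `m` outputs and phase `α`. -/
def X (n m : ℕ) (α : Real.Angle) : ZXTerm n m := .gen (.X n m α)

/-- The Hadamard gate. -/
def H : ZXTerm 1 1 := .gen .H

end ZXTerm

/-- The angle `π / 2` modulo `2π`. -/
noncomputable def halfPi : Real.Angle := ((π / 2 : ℝ) : Real.Angle)

open PropTerm ZXTerm in
/-- The equations of the (scalar-free) ZX-calculus. The first two rules say that only the
connectivity of a diagram matters: the legs of a spider can be permuted, and the Hadamard gate can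
be slid along a bent wire (bent wires are phase-free spiders with two legs, and bending the legs of
a spider is an instance of fusion). The versions of the other rules with the two colours
interchanged follow by `colourChange` and `hadamardTwice`. -/
inductive ZXRule : ∀ ⦃n m : ℕ⦄, ZXTerm n m → ZXTerm n m → Prop
  | legs (n m : ℕ) (α : Real.Angle) (σ : Fin n ≃ Fin n) (τ : Fin m ≃ Fin m) :
      ZXRule (perm σ ⨟ Z n m α ⨟ perm τ) (Z n m α)
  | hadamardSlide : ZXRule (Z 0 2 0 ⨟ (H ⊠ idt 1)) (Z 0 2 0 ⨟ (idt 1 ⊠ H))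
  /-- Spider fusion along `k + 1 ≥ 1` wires. -/
  | fusion (a b c d k : ℕ) (α β : Real.Angle) :
      ZXRule
        ((Z a (b + (k + 1)) α ⊠ idt c) ⨟ recast (Nat.add_assoc b (k + 1) c) ⨟
          (idt b ⊠ Z (k + 1 + c) d β))
        (Z (a + c) (b + d) (α + β))
  | identity : ZXRule (Z 1 1 0) (idt 1)
  | hadamardTwice : ZXRule (H ⨟ H) (idt 1)
  | colourChange (n m : ℕ) (α : Real.Angle) :
      ZXRule (power H n ⨟ Z n m α ⨟ power H m) (X n m α)
  | piCommute (n : ℕ) (α : Real.Angle) :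
      ZXRule (X 1 1 (π : Real.Angle) ⨟ Z 1 n α) (Z 1 n (-α) ⨟ power (X 1 1 (π : Real.Angle)) n)
  | copy (n : ℕ) (a : Fin 2) (α : Real.Angle) :
      ZXRule (X 0 1 ((a : ℕ) • (π : Real.Angle)) ⨟ Z 1 n α)
        (copies (X 0 1 ((a : ℕ) • (π : Real.Angle))) n)
  | bialgebra :
      ZXRule (X 2 1 0 ⨟ Z 1 2 0)
        ((Z 1 2 0 ⊠ Z 1 2 0) ⨟ perm (Equiv.swap (1 : Fin 4) 2) ⨟ (X 2 1 0 ⊠ X 2 1 0))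
  /-- The Euler decomposition of the Hadamard gate. -/
  | euler : ZXRule H (Z 1 1 halfPi ⨟ X 1 1 halfPi ⨟ Z 1 1 halfPi)

/-- The congruence generated by the axioms of a prop and the equations of the ZX-calculus. -/
instance ZXTerm.setoid (n m : ℕ) : Setoid (ZXTerm n m) where
  r := PropEq ZXRule
  iseqv := ⟨PropEq.refl, PropEq.symm, PropEq.trans⟩

/-- The morphisms `n → m` of the prop `ZX`: diagrams modulo the equations of the ZX-calculus. -/
def ZX (n m : ℕ) : Type := Quotient (ZXTerm.setoid n m)

/-! ## Local Clifford operators -/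

/-- The letters `r/2`, `r`, `-r/2`, `g/2`, `g`, `-g/2`. -/
inductive LCGen : Type
  | rHalf | r | rNegHalf | gHalf | g | gNegHalf

/-- The free monoid of (words of) local Clifford operators. -/
abbrev LC : Type := FreeMonoid LCGen

/-- The ZX-diagram of a letter. -/
noncomputable def LCGen.toZX : LCGen → ZXTerm 1 1
  | rHalf => ZXTerm.X 1 1 halfPi
  | r => ZXTerm.X 1 1 (π : Real.Angle)
  | rNegHalf => ZXTerm.X 1 1 (-halfPi)
  | gHalf => ZXTerm.Z 1 1 halfPi
  | g => ZXTerm.Z 1 1 (π : Real.Angle)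
  | gNegHalf => ZXTerm.Z 1 1 (-halfPi)

/-- The ZX-diagram of a word: the letters are composed from left to right. -/
noncomputable def LC.toZX (w : LC) : ZXTerm 1 1 :=
  (FreeMonoid.toList w).foldr (fun x t => x.toZX.comp t) (PropTerm.idt 1)

/-! ## MBQC-graphs and MBQC+LC-graphs -/

/-- The measurement planes. -/
inductive MeasPlane : Type
  | XY | XZ | YZ

/-- A measurement plane together with an angle (modulo `2π`). -/
abbrev MeasLabel : Type := MeasPlane × Real.Angle

/-- The ZX-diagram of a measurement label. -/
noncomputable def MeasLabel.toZX : MeasLabel → ZXTerm 1 0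
  | (.XY, α) => ZXTerm.Z 1 0 α
  | (.XZ, α) => (ZXTerm.Z 1 1 halfPi).comp (ZXTerm.X 1 0 α)
  | (.YZ, α) => ZXTerm.X 1 0 α

/-- An MBQC-graph with vertex names in `VS`. -/
structure MBQCGraph (VS : Type u) where
  /-- the vertices -/
  V : Finset VS
  /-- the edges: an irreflexive symmetric relation, relating only vertices in `V` -/
  E : SimpleGraph VS
  mem_of_adj : ∀ x y, E.Adj x y → x ∈ V
  /-- the inputs, in order -/
  I : List VS
  I_nodup : I.Nodup
  I_sub : ∀ x ∈ I, x ∈ V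
  /-- the outputs, in order -/
  O : List VS
  O_nodup : O.Nodup
  O_sub : ∀ x ∈ O, x ∈ V
  /-- the measurement labels of the non-output vertices -/
  meas : {x : VS // x ∈ V ∧ x ∉ O} → MeasLabel

/-- An MBQC+LC-graph with vertex names in `VS`. -/
structure MBQCLCGraph (VS : Type u) extends MBQCGraph VS where
  /-- the input labels -/
  li : {x : VS // x ∈ I} → LC
  /-- the output labels -/
  lo : {x : VS // x ∈ O} → LC

/-- The complete graph on the neighbours of `u`. -/
def SimpleGraph.nbrClique {VS : Type u} (G : SimpleGraph VS) (u : VS) : SimpleGraph VS where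
  Adj a b := (G.Adj u a ∧ G.Adj u b) ∧ a ≠ b
  symm := ⟨fun _ _ h => ⟨⟨h.1.2, h.1.1⟩, h.2.symm⟩⟩
  loopless := ⟨fun _ h => h.2 rfl⟩

/-- Local complementation of a simple graph about `u`. -/
noncomputable def SimpleGraph.localComp {VS : Type u} (G : SimpleGraph VS) (u : VS) :
    SimpleGraph VS := symmDiff G (G.nbrClique u)

/-- The change of the measurement label of `u` under local complementation about `u`. -/
noncomputable def MeasLabel.lcSelf : MeasLabel → MeasLabel
  | (.XY, α) => (.XZ, halfPi - α)
  | (.XZ, α) => (.XY, α - halfPi)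
  | (.YZ, α) => (.YZ, α + halfPi)

/-- The change of the measurement label of a neighbour of `u` under local complementation
about `u`. -/
noncomputable def MeasLabel.lcNbr : MeasLabel → MeasLabel
  | (.XY, α) => (.XY, α - halfPi)
  | (.XZ, α) => (.YZ, α)
  | (.YZ, α) => (.XZ, -α)

/-- The change of the measurement label of a neighbour of a removed vertex with measurement
angle `aπ`. -/
noncomputable def MeasLabel.removeNbr (a : Fin 2) : MeasLabel → MeasLabel
  | (.XY, α) => (.XY, α + (a : ℕ) • (π : Real.Angle))
  | (.XZ, α) => (.XZ, ((-1 : ℤ) ^ (a : ℕ)) • α)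
  | (.YZ, α) => (.YZ, ((-1 : ℤ) ^ (a : ℕ)) • α)

namespace MBQCLCGraph

variable {VS : Type u}

open Classical in
/-- Local complementation about a vertex `u` which is not an input. -/
noncomputable def localCompNonInput (G : MBQCLCGraph VS) (u : VS) : MBQCLCGraph VS where
  V := G.V
  E := G.E.localComp u
  mem_of_adj x y h := by
    rcases h with h | h
    · exact G.mem_of_adj x y h.1
    · exact G.mem_of_adj x u h.1.1.1.symm
  I := G.I
  I_nodup := G.I_nodup
  I_sub := G.I_sub
  O := G.O
  O_nodup := G.O_nodup
  O_sub := G.O_sub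
  meas x :=
    if x.1 = u then (G.meas x).lcSelf
    else if G.E.Adj u x.1 then (G.meas x).lcNbr
    else G.meas x
  li := G.li
  lo x :=
    if x.1 = u then FreeMonoid.of LCGen.rHalf * G.lo x
    else if G.E.Adj u x.1 then FreeMonoid.of LCGen.gNegHalf * G.lo x
    else G.lo x

/-- `u` replaced by `u'` in a list. -/
noncomputable def replaceName (l : List VS) (u u' : VS) : List VS :=
  open Classical in l.map (fun x => if x = u then u' else x)

lemma mem_replaceName {l : List VS} {u u' x : VS} (h : x ∈ replaceName l u u') :
    x = u' ∨ x ∈ l := by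
  classical
  simp only [replaceName, List.mem_map] at h
  obtain ⟨y, hy, rfl⟩ := h
  split_ifs with h
  · exact Or.inl rfl
  · exact Or.inr hy

lemma nodup_replaceName {l : List VS} {u u' : VS} (hl : l.Nodup) (hu' : u' ∉ l) :
    (replaceName l u u').Nodup := by
  classical
  refine List.Nodup.map_on ?_ hl
  intro x hx y hy hxy
  split_ifs at hxy with h1 h2 h2
  · exact h1.trans h2.symm
  · exact absurd (hxy ▸ hy) hu'
  · exact absurd (hxy ▸ hx) hu'
  · exact hxy

open Classical in
/-- Replace the input `u` by a new input vertex `u'`, joined to `u`, measured in the plane `XY` with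
angle `0` and with input label `ℓ(u) · g/2 · r/2 · g/2`. -/
noncomputable def expandInput (G : MBQCLCGraph VS) (u u' : VS) (hu : u ∈ G.I) (hu' : u' ∉ G.V) :
    MBQCLCGraph VS where
  V := insert u' G.V
  E := G.E ⊔ SimpleGraph.edge u u'
  mem_of_adj x y h := by
    rcases h with h | h
    · exact Finset.mem_insert_of_mem (G.mem_of_adj x y h)
    · rw [SimpleGraph.edge_adj] at h
      rcases h.1 with ⟨h, -⟩ | ⟨h, -⟩
      · subst h
        exact Finset.mem_insert_of_mem (G.I_sub _ hu)
      · subst h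
        exact Finset.mem_insert_self _ _
  I := replaceName G.I u u'
  I_nodup := nodup_replaceName G.I_nodup (fun h => hu' (G.I_sub _ h))
  I_sub x hx := by
    rcases mem_replaceName hx with rfl | h
    · exact Finset.mem_insert_self _ _
    · exact Finset.mem_insert_of_mem (G.I_sub _ h)
  O := G.O
  O_nodup := G.O_nodup
  O_sub x hx := Finset.mem_insert_of_mem (G.O_sub _ hx)
  meas x :=
    if h : x.1 = u' then (.XY, 0)
    else G.meas ⟨x.1, (Finset.mem_insert.1 x.2.1).resolve_left h, x.2.2⟩
  li x :=
    if h : x.1 = u' then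
      G.li ⟨u, hu⟩ * FreeMonoid.of LCGen.gHalf * FreeMonoid.of LCGen.rHalf *
        FreeMonoid.of LCGen.gHalf
    else G.li ⟨x.1, (mem_replaceName x.2).resolve_left h⟩
  lo := G.lo

/-- `G.IsLocalComp u G'`: the graph `G` is in the domain of local complementation about `u`, and
`G'` is the result (for some choice of a fresh name in case `u` is an input). -/
inductive IsLocalComp (u : VS) : MBQCLCGraph VS → MBQCLCGraph VS → Prop
  | nonInput (G : MBQCLCGraph VS) (hV : u ∈ G.V) (hI : u ∉ G.I) :
      IsLocalComp u G (G.localCompNonInput u)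
  | input (G : MBQCLCGraph VS) (hI : u ∈ G.I) (u' : VS) (hu' : u' ∉ G.V) :
      IsLocalComp u G ((G.expandInput u u' hI hu').localCompNonInput u)

/-- The result of a pivot about the edge `(u, v)`. -/
def IsPivot (u v : VS) (G G' : MBQCLCGraph VS) : Prop :=
  G.E.Adj u v ∧ ∃ G₁ G₂, IsLocalComp u G G₁ ∧ IsLocalComp v G₁ G₂ ∧ IsLocalComp u G₂ G'

open Classical in
/-- Removal of the vertex `u`, which is neither an input nor an output, where `aπ` is its
measurement angle. -/
noncomputable def removeVertex (G : MBQCLCGraph VS) (u : VS) (hI : u ∉ G.I) (hO : u ∉ G.O)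
    (a : Fin 2) : MBQCLCGraph VS where
  V := G.V.erase u
  E := G.E.deleteIncidenceSet u
  mem_of_adj x y h := by
    rw [SimpleGraph.deleteIncidenceSet_adj] at h
    exact Finset.mem_erase.2 ⟨h.2.1, G.mem_of_adj x y h.1⟩
  I := G.I
  I_nodup := G.I_nodup
  I_sub x hx := Finset.mem_erase.2 ⟨fun h => hI (h ▸ hx), G.I_sub x hx⟩
  O := G.O
  O_nodup := G.O_nodup
  O_sub x hx := Finset.mem_erase.2 ⟨fun h => hO (h ▸ hx), G.O_sub x hx⟩
  meas x :=
    if G.E.Adj u x.1 then (G.meas ⟨x.1, Finset.mem_of_mem_erase x.2.1, x.2.2⟩).removeNbr a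
    else G.meas ⟨x.1, Finset.mem_of_mem_erase x.2.1, x.2.2⟩
  li := G.li
  lo x := if G.E.Adj u x.1 then FreeMonoid.of LCGen.g ^ (a : ℕ) * G.lo x else G.lo x

/-- `G` is in the domain of vertex removal at `u`, and `G'` is the result. -/
def IsVertexRemoval (u : VS) (G G' : MBQCLCGraph VS) : Prop :=
  ∃ (hV : u ∈ G.V) (hI : u ∉ G.I) (hO : u ∉ G.O) (a : Fin 2),
    (G.meas ⟨u, hV, hO⟩ = (.YZ, (a : ℕ) • (π : Real.Angle)) ∨
      G.meas ⟨u, hV, hO⟩ = (.XZ, (a : ℕ) • (π : Real.Angle))) ∧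
    G' = G.removeVertex u hI hO a

/-- Transport of a graph along a permutation of the vertex names. -/
def relabel (G : MBQCLCGraph VS) (ρ : Equiv.Perm VS) : MBQCLCGraph VS where
  V := G.V.map ρ.toEmbedding
  E := G.E.comap ρ.symm
  mem_of_adj x y h := Finset.mem_map_equiv.2 (G.mem_of_adj _ _ h)
  I := G.I.map ρ
  I_nodup := G.I_nodup.map ρ.injective
  I_sub x hx := by
    obtain ⟨y, hy, rfl⟩ := List.mem_map.1 hx
    exact Finset.mem_map_of_mem _ (G.I_sub y hy)
  O := G.O.map ρ
  O_nodup := G.O_nodup.map ρ.injective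
  O_sub x hx := by
    obtain ⟨y, hy, rfl⟩ := List.mem_map.1 hx
    exact Finset.mem_map_of_mem _ (G.O_sub y hy)
  meas x := G.meas ⟨ρ.symm x.1, Finset.mem_map_equiv.1 x.2.1, fun h => x.2.2 (by
    simpa using List.mem_map_of_mem (f := ρ) h)⟩
  li x := G.li ⟨ρ.symm x.1, by
    obtain ⟨y, hy, h⟩ := List.mem_map.1 x.2
    rw [← h]
    simpa using hy⟩
  lo x := G.lo ⟨ρ.symm x.1, by
    obtain ⟨y, hy, h⟩ := List.mem_map.1 x.2
    rw [← h]
    simpa using hy⟩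

open Classical in
/-- `G' = G[W/U]`: the vertices in the list `U` are replaced, in order, by the names in the list
`W`, none of which is a vertex of `G`. (The product of the transpositions of `U_i` and `W_i` sends
each `U_i` to `W_i` and fixes all vertices of `G` outside `U`.) -/
def IsRenaming (U W : List VS) (G G' : MBQCLCGraph VS) : Prop :=
  U.Nodup ∧ W.Nodup ∧ U.length = W.length ∧ (∀ x ∈ U, x ∈ G.V) ∧ (∀ x ∈ W, x ∉ G.V) ∧
    G' = G.relabel (List.zipWith Equiv.swap U W).prod

/-! ## The translation into the ZX-calculus -/

/-- If every element of `A` is attached to one of `N` places, arrange the elements of `A` place by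
place. -/
noncomputable def fibreEquiv {A : Type} [Finite A] {N : ℕ} (f : A → Fin N) :
    A ≃ Fin (∑ i, Nat.card {x // f x = i}) :=
  ((Equiv.sigmaFiberEquiv f).symm.trans
    (Equiv.sigmaCongrRight (fun i => Finite.equivFin {x // f x = i}))).trans finSigmaFinEquiv

/-- An enumeration of the vertices. -/
noncomputable def vtx (G : MBQCLCGraph VS) : Fin G.V.card ≃ {x // x ∈ G.V} := G.V.equivFin.symm

/-- The vertex to which an input wire is attached. -/
noncomputable def inputVertex (G : MBQCLCGraph VS) (k : Fin G.I.length) : Fin G.V.card :=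
  G.vtx.symm ⟨G.I.get k, G.I_sub _ (List.get_mem _ _)⟩

/-- The vertex to which an output wire is attached. -/
noncomputable def outputVertex (G : MBQCLCGraph VS) (k : Fin G.O.length) : Fin G.V.card :=
  G.vtx.symm ⟨G.O.get k, G.O_sub _ (List.get_mem _ _)⟩

/-- The measured (that is, non-output) vertices. -/
abbrev Measured (G : MBQCLCGraph VS) : Type := {i : Fin G.V.card // (G.vtx i).1 ∉ G.O}

/-- The edges, each listed once. -/
abbrev Edges (G : MBQCLCGraph VS) : Type :=
  {p : Fin G.V.card × Fin G.V.card // p.1 < p.2 ∧ G.E.Adj (G.vtx p.1).1 (G.vtx p.2).1}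

/-- The non-input legs of the spiders: one for every output wire, one for every measured vertex,
and two (the two ends) for every edge. -/
abbrev Legs (G : MBQCLCGraph VS) : Type := Fin G.O.length ⊕ (G.Measured ⊕ (G.Edges × Fin 2))

/-- The vertex to which a leg is attached. -/
noncomputable def legVertex (G : MBQCLCGraph VS) : G.Legs → Fin G.V.card
  | .inl k => G.outputVertex k
  | .inr (.inl i) => i.1
  | .inr (.inr (e, j)) => if j = 0 then e.1.1 else e.1.2

/-- The standard arrangement of the legs: output wires, then measurements, then edges. -/
noncomputable def legArrangement (G : MBQCLCGraph VS) :
    G.Legs ≃ Fin (∑ _i : Fin G.O.length, 1 +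
      (∑ _i : Fin (Nat.card G.Measured), 1 + ∑ _i : Fin (Nat.card G.Edges), 2)) :=
  (Equiv.sumCongr (finCongr (by simp))
    ((Equiv.sumCongr ((Finite.equivFin G.Measured).trans (finCongr (by simp)))
      ((((Finite.equivFin G.Edges).prodCongr (Equiv.refl (Fin 2))).trans
        (Equiv.sigmaEquivProd (Fin (Nat.card G.Edges)) (Fin 2)).symm).trans
          finSigmaFinEquiv)).trans finSumFinEquiv)).trans finSumFinEquiv

open PropTerm ZXTerm in
/-- The ZX-diagram of an MBQC+LC-graph: the input wires carry the input labels and are attached to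
the input vertices; every vertex is a phase-free Z-spider; the legs of the spiders are attached to
the output labels followed by the output wires, to the measurements, and in pairs to Hadamard gates
for the edges. -/
noncomputable def toZX (G : MBQCLCGraph VS) : ZXTerm G.I.length G.O.length :=
  recast (by simp) ⨟
  tensorFin G.I.length (a := fun _ => 1) (b := fun _ => 1)
    (fun k => (G.li ⟨G.I.get k, List.get_mem _ _⟩).toZX) ⨟
  perm ((finCongr (by simp)).trans (fibreEquiv G.inputVertex)) ⨟
  tensorFin G.V.card (fun i => Z (Nat.card {k // G.inputVertex k = i})
    (Nat.card {x // G.legVertex x = i}) 0) ⨟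
  perm ((fibreEquiv G.legVertex).symm.trans G.legArrangement) ⨟
  (tensorFin G.O.length (a := fun _ => 1) (b := fun _ => 1)
      (fun k => (G.lo ⟨G.O.get k, List.get_mem _ _⟩).toZX) ⊠
    (tensorFin (Nat.card G.Measured) (a := fun _ => 1) (b := fun _ => 0)
        (fun i => (G.meas ⟨(G.vtx ((Finite.equivFin G.Measured).symm i).1).1,
          (G.vtx ((Finite.equivFin G.Measured).symm i).1).2,
          ((Finite.equivFin G.Measured).symm i).2⟩).toZX) ⊠
      tensorFin (Nat.card G.Edges) (a := fun _ => 2) (b := fun _ => 0)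
        (fun _ => (H ⊠ idt 1) ⨟ Z 2 0 0))) ⨟
  recast (by simp)

end MBQCLCGraph

/-! ## The layer of MBQC+LC-graphs -/

/-- The generators `n → m` of the layer: MBQC+LC-graphs with `n` inputs and `m` outputs. -/
abbrev MBQCLCGen (VS : Type u) (n m : ℕ) : Type u :=
  {G : MBQCLCGraph VS // G.I.length = n ∧ G.O.length = m}

/-- The terms `n → m` of the layer. -/
abbrev MBQCLCTerm (VS : Type u) : ℕ → ℕ → Type u := PropTerm (MBQCLCGen VS)

/-- The 2-cells of the layer: they are generated by local complementation, pivot, vertex removal and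
renaming, under vertical, horizontal and parallel composition, with an identity 2-cell between any
two terms that are equal by the axioms of a prop. -/
inductive MBQCLCTwoCell {VS : Type u} :
    ∀ {n m : ℕ}, MBQCLCTerm VS n m → MBQCLCTerm VS n m → Type u
  | localComp {n m : ℕ} (u : VS) (G G' : MBQCLCGen VS n m)
      (h : MBQCLCGraph.IsLocalComp u G.1 G'.1) : MBQCLCTwoCell (.gen G) (.gen G')
  | pivot {n m : ℕ} (u v : VS) (G G' : MBQCLCGen VS n m)
      (h : MBQCLCGraph.IsPivot u v G.1 G'.1) : MBQCLCTwoCell (.gen G) (.gen G')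
  | vertexRemoval {n m : ℕ} (u : VS) (G G' : MBQCLCGen VS n m)
      (h : MBQCLCGraph.IsVertexRemoval u G.1 G'.1) : MBQCLCTwoCell (.gen G) (.gen G')
  | renaming {n m : ℕ} (U W : List VS) (G G' : MBQCLCGen VS n m)
      (h : MBQCLCGraph.IsRenaming U W G.1 G'.1) : MBQCLCTwoCell (.gen G) (.gen G')
  | id {n m : ℕ} {s t : MBQCLCTerm VS n m} (h : PropEq (fun _ _ _ _ => False) s t) :
      MBQCLCTwoCell s t
  | vcomp {n m : ℕ} {s t r : MBQCLCTerm VS n m} (η : MBQCLCTwoCell s t)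
      (θ : MBQCLCTwoCell t r) : MBQCLCTwoCell s r
  | hcomp {n m k : ℕ} {s s' : MBQCLCTerm VS n m} {t t' : MBQCLCTerm VS m k}
      (η : MBQCLCTwoCell s s') (θ : MBQCLCTwoCell t t') : MBQCLCTwoCell (s ⨟ t) (s' ⨟ t')
  | tensor {n m n' m' : ℕ} {s s' : MBQCLCTerm VS n m} {t t' : MBQCLCTerm VS n' m'}
      (η : MBQCLCTwoCell s s') (θ : MBQCLCTwoCell t t') : MBQCLCTwoCell (s ⊠ t) (s' ⊠ t')

/-- The ZX-diagram of a generator of the layer. -/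
noncomputable def MBQCLCGen.toZX {VS : Type u} {n m : ℕ} (G : MBQCLCGen VS n m) : ZXTerm n m :=
  .recast G.2.1.symm ⨟ G.1.toZX ⨟ .recast G.2.2

/-- The translation functor from the layer of MBQC+LC-graphs to the ZX-calculus. -/
noncomputable def translationD {VS : Type u} {n m : ℕ} (G : MBQCLCTerm VS n m) : ZX n m :=
  Quotient.mk _ (PropTerm.lift MBQCLCGen.toZX G)

/-! A 2-cell is built from generators by compositions that the congruence on diagrams respects, so
only the operations on single graphs matter. A pivot is three local complementations, and local
complementation at an input is an expansion of that input followed by the ordinary case. What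
remains is local complementation at a non-input, input expansion, vertex removal and renaming, for
graphs with arbitrarily many vertices.

To avoid moving wires around, diagrams are read as functions of Boolean variables, entirely inside
`ZX`. An effect `ZX N 0` plays the role of a function of `N` variables. Substitution is
precomposition with a wiring `dl ρ` made of phase-free spiders, multiplication copies the variables,
and summation over a variable plugs in `Z 0 1 0`. This calculus rests on `Rep.unique` (a wiring is
determined by the map that says which input each output copies), on the triviality of the scalar
`Z_zero_one_comp`, and on the snake equation. Bending outputs to inputs makes every morphism a
function `ev f a b`. Evaluation at distinct variables is faithful (`ev_injective`), and composition
becomes summation over intermediate variables (`ev_comp`).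

The basic functions, up to scalars, are `dlt x y` (equality), `zf α x` (the phase `exp(iαx)`), `hf x
y` (the sign `(-1)^(xy)`), `xf` at `aπ` (the indicator of `x = a`) and `xor a b c` (the indicator of
`c = a ⊕ b`). The ZX rules become identities among them. Copying gives evaluation at `a`; the
bialgebra law makes `hf` multiplicative on parities (`xor_mul_hf`), which yields the Hopf law
`hf_mul_self`; and the Euler rule gives the Gauss sum over one variable.

By `ev_toZX` the diagram of a graph is a sum over vertex variables of a product of factors from
inputs, outputs or measurements, and edges. Local complementation is then the Gauss sum `E_prod_hf`:
summing `(-i)^x (-1)^(x(y+∑w))` over `x` gives `i` raised to the parity of all the other variables.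
This expands into phases `i` on each of them and signs on each pair, that is, the complemented edges
(`E_localComp`, `sem_localComp`). Removal evaluates a variable at `a`; expansion inserts two
Hadamard factors that cancel; renaming reindexes the product. -/

theorem Fin.forall_addCases {a b : ℕ} {p : Fin (a + b) → Prop} :
    (∀ i, p i) ↔ (∀ i, p (Fin.castAdd b i)) ∧ ∀ j, p (Fin.natAdd a j) :=
  ⟨fun h => ⟨fun _ => h _, fun _ => h _⟩, fun h i => Fin.addCases h.1 h.2 i⟩

namespace PropTerm

@[simp] theorem permSum_castAdd {n m n' m' : ℕ} (σ : Fin n ≃ Fin m) (τ : Fin n' ≃ Fin m')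
    (i : Fin n) : permSum σ τ (Fin.castAdd n' i) = Fin.castAdd m' (σ i) := by
  simp [permSum]

@[simp] theorem permSum_natAdd {n m n' m' : ℕ} (σ : Fin n ≃ Fin m) (τ : Fin n' ≃ Fin m')
    (i : Fin n') : permSum σ τ (Fin.natAdd n i) = Fin.natAdd m (τ i) := by
  simp [permSum]

@[simp] theorem permSum_symm {n m n' m' : ℕ} (σ : Fin n ≃ Fin m) (τ : Fin n' ≃ Fin m') :
    (permSum σ τ).symm = permSum σ.symm τ.symm := rfl

end PropTerm

/-! ### The quotient prop and its wire permutations -/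

namespace ZX

open PropTerm

/-- The class of a term. -/
def mk {n m : ℕ} (t : ZXTerm n m) : ZX n m := Quotient.mk _ t

theorem mk_eq {n m : ℕ} {s t : ZXTerm n m} : mk s = mk t ↔ PropEq ZXRule s t := Quotient.eq

theorem mk_rule {n m : ℕ} {s t : ZXTerm n m} (h : ZXRule s t) : mk s = mk t :=
  mk_eq.2 (.rule h)

/-- Sequential composition. -/
def comp {n m k : ℕ} (s : ZX n m) (t : ZX m k) : ZX n k :=
  Quotient.map₂ PropTerm.comp (fun _ _ h _ _ h' => PropEq.comp_congr h h') s t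

/-- Parallel composition. -/
def tens {n m n' m' : ℕ} (s : ZX n m) (t : ZX n' m') : ZX (n + n') (m + m') :=
  Quotient.map₂ PropTerm.tensor (fun _ _ h _ _ h' => PropEq.tensor_congr h h') s t

/-- A permutation of wires. -/
def perm {n m : ℕ} (σ : Fin n ≃ Fin m) : ZX n m := mk (.perm σ)

/-- The identity. -/
def one (n : ℕ) : ZX n n := perm (Equiv.refl _)

end ZX

infixl:60 " ≫ₓ " => ZX.comp
infixl:70 " ⊗ₓ " => ZX.tens

namespace ZX

open PropTerm

theorem mk_comp {n m k : ℕ} (s : ZXTerm n m) (t : ZXTerm m k) : mk (s ⨟ t) = mk s ≫ₓ mk t := rfl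
theorem mk_tensor {n m n' m' : ℕ} (s : ZXTerm n m) (t : ZXTerm n' m') :
    mk (s ⊠ t) = mk s ⊗ₓ mk t := rfl
theorem mk_recast {n m : ℕ} (h : n = m) : mk (recast h) = perm (finCongr h) := rfl

theorem assoc {n m k l : ℕ} (s : ZX n m) (t : ZX m k) (r : ZX k l) :
    s ≫ₓ t ≫ₓ r = s ≫ₓ (t ≫ₓ r) := by
  induction s using Quotient.ind; induction t using Quotient.ind; induction r using Quotient.ind
  exact mk_eq.2 (.comp_assoc _ _ _)

@[simp] theorem one_comp {n m : ℕ} (t : ZX n m) : one n ≫ₓ t = t := by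
  induction t using Quotient.ind
  exact mk_eq.2 (.id_comp _)

@[simp] theorem comp_one {n m : ℕ} (t : ZX n m) : t ≫ₓ one m = t := by
  induction t using Quotient.ind
  exact mk_eq.2 (.comp_id _)

theorem interchange {n m k n' m' k' : ℕ} (s : ZX n m) (t : ZX m k) (s' : ZX n' m')
    (t' : ZX m' k') : (s ≫ₓ t) ⊗ₓ (s' ≫ₓ t') = (s ⊗ₓ s') ≫ₓ (t ⊗ₓ t') := by
  induction s using Quotient.ind; induction t using Quotient.ind
  induction s' using Quotient.ind; induction t' using Quotient.ind
  exact mk_eq.2 (.interchange _ _ _ _)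

theorem perm_comp {n m k : ℕ} (σ : Fin n ≃ Fin m) (τ : Fin m ≃ Fin k) :
    perm σ ≫ₓ perm τ = perm (σ.trans τ) := mk_eq.2 (.perm_comp _ _)

theorem perm_tens {n m n' m' : ℕ} (σ : Fin n ≃ Fin m) (τ : Fin n' ≃ Fin m') :
    perm σ ⊗ₓ perm τ = perm (permSum σ τ) := mk_eq.2 (.perm_tensor _ _)

theorem perm_congr {n m : ℕ} {σ τ : Fin n ≃ Fin m} (h : ∀ i, σ i = τ i) : perm σ = perm τ :=
  congrArg perm (Equiv.ext h)

theorem perm_comp_assoc {n m k l : ℕ} (σ : Fin n ≃ Fin m) (τ : Fin m ≃ Fin k) (t : ZX k l) :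
    perm σ ≫ₓ (perm τ ≫ₓ t) = perm (σ.trans τ) ≫ₓ t := by
  rw [← assoc, perm_comp]

theorem comp_perm_assoc {n m k l : ℕ} (t : ZX l n) (σ : Fin n ≃ Fin m) (τ : Fin m ≃ Fin k) :
    t ≫ₓ perm σ ≫ₓ perm τ = t ≫ₓ perm (σ.trans τ) := by
  rw [assoc, perm_comp]

theorem perm_eq_one {n : ℕ} {σ : Fin n ≃ Fin n} (h : ∀ i, σ i = i) : perm σ = one n :=
  perm_congr h

@[simp] theorem perm_refl {n : ℕ} : perm (Equiv.refl (Fin n)) = one n := rfl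

@[simp] theorem perm_finCongr {n : ℕ} (h : n = n) : perm (finCongr h) = one n :=
  perm_eq_one fun _ => rfl

theorem one_tens_one (n m : ℕ) : one n ⊗ₓ one m = one (n + m) := by
  rw [one, one, perm_tens]
  exact perm_eq_one (by simp [Fin.forall_addCases])

theorem tens_comp_one {n m k p : ℕ} (s : ZX n m) (t : ZX m k) :
    (s ≫ₓ t) ⊗ₓ one p = (s ⊗ₓ one p) ≫ₓ (t ⊗ₓ one p) := by
  rw [← interchange, one_comp]

theorem one_tens_comp {n m k p : ℕ} (s : ZX n m) (t : ZX m k) :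
    one p ⊗ₓ (s ≫ₓ t) = (one p ⊗ₓ s) ≫ₓ (one p ⊗ₓ t) := by
  rw [← interchange, one_comp]

theorem tens_eq_left {n m n' m' : ℕ} (s : ZX n m) (t : ZX n' m') :
    s ⊗ₓ t = (s ⊗ₓ one n') ≫ₓ (one m ⊗ₓ t) := by
  rw [← interchange, one_comp, comp_one]

theorem tens_eq_right {n m n' m' : ℕ} (s : ZX n m) (t : ZX n' m') :
    s ⊗ₓ t = (one n ⊗ₓ t) ≫ₓ (s ⊗ₓ one m') := by
  rw [← interchange, one_comp, comp_one]

/-- Rebracketing of three blocks of wires. -/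
def assocP (a b c : ℕ) : Fin (a + b + c) ≃ Fin (a + (b + c)) := finCongr (Nat.add_assoc a b c)

@[simp] theorem assocP_1 {a b c : ℕ} (i : Fin a) :
    assocP a b c (Fin.castAdd c (Fin.castAdd b i)) = Fin.castAdd (b + c) i := rfl
@[simp] theorem assocP_2 {a b c : ℕ} (i : Fin b) :
    assocP a b c (Fin.castAdd c (Fin.natAdd a i)) = Fin.natAdd a (Fin.castAdd c i) := rfl
@[simp] theorem assocP_3 {a b c : ℕ} (i : Fin c) :
    assocP a b c (Fin.natAdd (a + b) i) = Fin.natAdd a (Fin.natAdd b i) := by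
  ext; simp [assocP, Nat.add_assoc]
@[simp] theorem assocP_symm_1 {a b c : ℕ} (i : Fin a) :
    (assocP a b c).symm (Fin.castAdd (b + c) i) = Fin.castAdd c (Fin.castAdd b i) := rfl
@[simp] theorem assocP_symm_2 {a b c : ℕ} (i : Fin b) :
    (assocP a b c).symm (Fin.natAdd a (Fin.castAdd c i)) = Fin.castAdd c (Fin.natAdd a i) := rfl
@[simp] theorem assocP_symm_3 {a b c : ℕ} (i : Fin c) :
    (assocP a b c).symm (Fin.natAdd a (Fin.natAdd b i)) = Fin.natAdd (a + b) i := by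
  rw [Equiv.symm_apply_eq]; simp

theorem tens_assoc {a a' b b' c c' : ℕ} (s : ZX a a') (t : ZX b b') (r : ZX c c') :
    (s ⊗ₓ t ⊗ₓ r) ≫ₓ perm (assocP a' b' c') = perm (assocP a b c) ≫ₓ (s ⊗ₓ (t ⊗ₓ r)) := by
  induction s using Quotient.ind; induction t using Quotient.ind; induction r using Quotient.ind
  exact mk_eq.2 (.tensor_assoc _ _ _)

theorem tens_assoc' {a a' b b' c c' : ℕ} (s : ZX a a') (t : ZX b b') (r : ZX c c') :
    s ⊗ₓ t ⊗ₓ r = perm (assocP a b c) ≫ₓ (s ⊗ₓ (t ⊗ₓ r)) ≫ₓ perm (assocP a' b' c').symm := by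
  rw [← tens_assoc, comp_perm_assoc, Equiv.self_trans_symm, perm_refl, comp_one]

theorem tens_assoc_symm {a a' b b' c c' : ℕ} (s : ZX a a') (t : ZX b b') (r : ZX c c') :
    s ⊗ₓ (t ⊗ₓ r) = perm (assocP a b c).symm ≫ₓ (s ⊗ₓ t ⊗ₓ r) ≫ₓ perm (assocP a' b' c') := by
  rw [assoc, tens_assoc, perm_comp_assoc, Equiv.symm_trans_self, perm_refl, one_comp]

/-- No casts are needed here because `n + 0` reduces to `n`. On the other side `0 + n` does not
reduce, hence the explicit casts in `unit_tens`. -/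
theorem tens_unit {n m : ℕ} (t : ZX n m) : t ⊗ₓ one 0 = t := by
  have h : (t ⊗ₓ one 0) ≫ₓ perm (finCongr (Nat.add_zero m)) =
      perm (finCongr (Nat.add_zero n)) ≫ₓ t := by
    induction t using Quotient.ind
    exact mk_eq.2 (.tensor_unit _)
  simpa using h

theorem unit_tens {n m : ℕ} (t : ZX n m) :
    one 0 ⊗ₓ t = perm (finCongr (Nat.zero_add n)) ≫ₓ t ≫ₓ perm (finCongr (Nat.zero_add m)).symm := by
  have h : (one 0 ⊗ₓ t) ≫ₓ perm (finCongr (Nat.zero_add m)) =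
      perm (finCongr (Nat.zero_add n)) ≫ₓ t := by
    induction t using Quotient.ind
    exact mk_eq.2 (.unit_tensor _)
  rw [← h, comp_perm_assoc, Equiv.self_trans_symm, perm_refl, comp_one]

theorem swap_natural {n m n' m' : ℕ} (s : ZX n m) (t : ZX n' m') :
    (s ⊗ₓ t) ≫ₓ perm finAddFlip = perm finAddFlip ≫ₓ (t ⊗ₓ s) := by
  induction s using Quotient.ind; induction t using Quotient.ind
  exact mk_eq.2 (.swap_natural _ _)

theorem comp_perm_eq_iff {n m k : ℕ} {s : ZX n m} {σ : Fin m ≃ Fin k} {t : ZX n k} :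
    s ≫ₓ perm σ = t ↔ s = t ≫ₓ perm σ.symm := by
  constructor
  · rintro rfl; rw [comp_perm_assoc, Equiv.self_trans_symm, perm_refl, comp_one]
  · rintro rfl; rw [comp_perm_assoc, Equiv.symm_trans_self, perm_refl, comp_one]

theorem perm_comp_eq_iff {n m k : ℕ} {s : ZX n m} {σ : Fin k ≃ Fin n} {t : ZX k m} :
    perm σ ≫ₓ s = t ↔ s = perm σ.symm ≫ₓ t := by
  constructor
  · rintro rfl; rw [perm_comp_assoc, Equiv.symm_trans_self, perm_refl, one_comp]
  · rintro rfl; rw [perm_comp_assoc, Equiv.self_trans_symm, perm_refl, one_comp]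

/-- Exchange of the two middle blocks among four blocks of wires. -/
def mid (a b c d : ℕ) : Fin (a + b + (c + d)) ≃ Fin (a + c + (b + d)) :=
  (assocP a b (c + d)).trans
    ((permSum (Equiv.refl (Fin a)) (((assocP b c d).symm.trans
      (permSum finAddFlip (Equiv.refl (Fin d)))).trans (assocP c b d))).trans
        (assocP a c (b + d)).symm)

@[simp] theorem mid_1 {a b c d : ℕ} (i : Fin a) :
    mid a b c d (Fin.castAdd _ (Fin.castAdd _ i)) = Fin.castAdd _ (Fin.castAdd _ i) := by
  simp [mid]
@[simp] theorem mid_2 {a b c d : ℕ} (i : Fin b) :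
    mid a b c d (Fin.castAdd _ (Fin.natAdd _ i)) = Fin.natAdd _ (Fin.castAdd _ i) := by
  simp [mid]
@[simp] theorem mid_3 {a b c d : ℕ} (i : Fin c) :
    mid a b c d (Fin.natAdd _ (Fin.castAdd _ i)) = Fin.castAdd _ (Fin.natAdd _ i) := by
  simp [mid]
@[simp] theorem mid_4 {a b c d : ℕ} (i : Fin d) :
    mid a b c d (Fin.natAdd _ (Fin.natAdd _ i)) = Fin.natAdd _ (Fin.natAdd _ i) := by
  simp [mid]

theorem mid_symm (a b c d : ℕ) : (mid a b c d).symm = mid a c b d := by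
  ext i : 1
  rw [Equiv.symm_apply_eq]
  revert i
  simp [Fin.forall_addCases]

/-- Two morphisms agree up to permutations of their inputs and outputs. -/
def PermSq {n m n' m' : ℕ} (σ : Fin n ≃ Fin n') (f : ZX n m) (g : ZX n' m')
    (τ : Fin m ≃ Fin m') : Prop := f ≫ₓ perm τ = perm σ ≫ₓ g

theorem PermSq.refl {n m : ℕ} (f : ZX n m) : PermSq (Equiv.refl _) f f (Equiv.refl _) := by
  simp [PermSq]

theorem PermSq.trans {n m n' m' n'' m'' : ℕ} {σ : Fin n ≃ Fin n'} {f : ZX n m} {g : ZX n' m'}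
    {τ : Fin m ≃ Fin m'} {σ' : Fin n' ≃ Fin n''} {h : ZX n'' m''} {τ' : Fin m' ≃ Fin m''}
    (H : PermSq σ f g τ) (H' : PermSq σ' g h τ') :
    PermSq (σ.trans σ') f h (τ.trans τ') := by
  unfold PermSq at *
  rw [← perm_comp, ← assoc, H, assoc, H', perm_comp_assoc]

theorem PermSq.symm {n m n' m' : ℕ} {σ : Fin n ≃ Fin n'} {f : ZX n m} {g : ZX n' m'}
    {τ : Fin m ≃ Fin m'} (H : PermSq σ f g τ) : PermSq σ.symm g f τ.symm := by
  unfold PermSq at *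
  rw [← perm_comp_eq_iff, ← assoc, ← H, comp_perm_assoc, Equiv.self_trans_symm, perm_refl, comp_one]

theorem PermSq.tens {n m n' m' k l k' l' : ℕ} {σ : Fin n ≃ Fin n'} {f : ZX n m} {g : ZX n' m'}
    {τ : Fin m ≃ Fin m'} {σ' : Fin k ≃ Fin k'} {f' : ZX k l} {g' : ZX k' l'}
    {τ' : Fin l ≃ Fin l'} (H : PermSq σ f g τ) (H' : PermSq σ' f' g' τ') :
    PermSq (permSum σ σ') (f ⊗ₓ f') (g ⊗ₓ g') (permSum τ τ') := by
  unfold PermSq at *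
  rw [← perm_tens, ← interchange, H, H', interchange, perm_tens]

/-- `mid` is a composite of rebracketings and one flip. Each of these is natural, and the squares
`PermSq` can be pasted and tensored. -/
theorem mid_natural {a a' b b' c c' d d' : ℕ} (f : ZX a a') (g : ZX b b') (h : ZX c c')
    (k : ZX d d') : ((f ⊗ₓ g) ⊗ₓ (h ⊗ₓ k)) ≫ₓ perm (mid a' b' c' d') =
      perm (mid a b c d) ≫ₓ ((f ⊗ₓ h) ⊗ₓ (g ⊗ₓ k)) :=
  PermSq.trans (tens_assoc f g (h ⊗ₓ k)) <|
    .trans (.tens (.refl f) (.trans (.trans (.symm (tens_assoc g h k))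
      (.tens (swap_natural g h) (.refl k))) (tens_assoc h g k)))
      (.symm (tens_assoc f h (g ⊗ₓ k)))

end ZX

namespace ZX

open PropTerm

/-! ### Spiders -/

/-- The Z-spider. -/
def Z (n m : ℕ) (α : Real.Angle) : ZX n m := mk (ZXTerm.Z n m α)
/-- The X-spider. -/
def X (n m : ℕ) (α : Real.Angle) : ZX n m := mk (ZXTerm.X n m α)
/-- The Hadamard gate. -/
def H : ZX 1 1 := mk ZXTerm.H

/-- A bijection between `Fin n'` and `Fin n` forces `n' = n`, after which this is the rule on
permuting legs. The heterogeneous form lets spiders absorb casts as well. -/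
theorem perm_Z_perm {n m n' m' : ℕ} (α : Real.Angle) (σ : Fin n' ≃ Fin n) (τ : Fin m ≃ Fin m') :
    perm σ ≫ₓ Z n m α ≫ₓ perm τ = Z n' m' α := by
  obtain rfl : n' = n := Fin.equiv_iff_eq.1 ⟨σ⟩
  obtain rfl : m = m' := Fin.equiv_iff_eq.1 ⟨τ⟩
  exact mk_rule (.legs _ _ _ _ _)

theorem Z_perm {n m m' : ℕ} (α : Real.Angle) (τ : Fin m ≃ Fin m') :
    Z n m α ≫ₓ perm τ = Z n m' α := by
  simpa using perm_Z_perm (n := n) α (Equiv.refl _) τ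

theorem perm_Z {n m n' : ℕ} (α : Real.Angle) (σ : Fin n' ≃ Fin n) :
    perm σ ≫ₓ Z n m α = Z n' m α := by
  simpa using perm_Z_perm (m := m) α σ (Equiv.refl _)

theorem fusion (a b c d : ℕ) (α β : Real.Angle) :
    (Z a (b + 1) α ⊗ₓ one c) ≫ₓ perm (assocP b 1 c) ≫ₓ (one b ⊗ₓ Z (1 + c) d β) =
      Z (a + c) (b + d) (α + β) :=
  mk_rule (.fusion a b c d 0 α β)

theorem Z_one : Z 1 1 0 = one 1 := mk_rule .identity

theorem Z_comp_one_tens (a b d : ℕ) (α β : Real.Angle) :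
    Z a (b + 1) α ≫ₓ (one b ⊗ₓ Z 1 d β) = Z a (b + d) (α + β) := by
  have h := fusion a b 0 d α β
  rw [tens_unit, show assocP b 1 0 = Equiv.refl _ from rfl] at h
  exact (congrArg (· ≫ₓ _) (comp_one _)).symm.trans h

theorem Z_comp_tens_one (a b d : ℕ) (α β : Real.Angle) :
    Z a (1 + b) α ≫ₓ (Z 1 d β ⊗ₓ one b) = Z a (d + b) (α + β) := by
  rw [← Z_perm α (finAddFlip (m := b) (n := 1)), assoc, ← swap_natural, ← assoc, Z_comp_one_tens,
    Z_perm]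

theorem Z_comp_Z (a d : ℕ) (α β : Real.Angle) : Z a 1 α ≫ₓ Z 1 d β = Z a d (α + β) := by
  have h := Z_comp_one_tens a 0 d α β
  rw [unit_tens, ← assoc, ← assoc, comp_perm_eq_iff] at h
  rw [Z_perm α (finCongr (Nat.zero_add 1)), Z_perm] at h
  exact h

theorem Z_comp_tens (a b : ℕ) : Z 1 (1 + 1) 0 ≫ₓ (Z 1 a 0 ⊗ₓ Z 1 b 0) = Z 1 (a + b) 0 := by
  rw [tens_eq_left, ← assoc, Z_comp_tens_one, Z_comp_one_tens, add_zero, add_zero]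

theorem tens_one_comp_Z (a c d : ℕ) (α β : Real.Angle) :
    (Z a 1 α ⊗ₓ one c) ≫ₓ Z (1 + c) d β = Z (a + c) d (α + β) := by
  have h := fusion a 0 c d α β
  rw [unit_tens, ← assoc, ← assoc, comp_perm_eq_iff, assoc (_ ⊗ₓ _), perm_comp,
    Equiv.symm_symm, Z_perm, assoc, perm_Z] at h
  exact h

/-! ### Copying and discarding -/

/-- Copy a block of wires. -/
noncomputable def cp : (n : ℕ) → ZX n (n + n)
  | 0 => one 0
  | n + 1 => (cp n ⊗ₓ Z 1 (1 + 1) 0) ≫ₓ perm (mid n n 1 1)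

/-- Discard a block of wires. -/
noncomputable def dsc : (n : ℕ) → ZX n 0
  | 0 => one 0
  | n + 1 => dsc n ⊗ₓ Z 1 0 0

theorem assocP_one (m n : ℕ) : assocP m n 1 = Equiv.refl _ := rfl

theorem dsc_add (m : ℕ) : (n : ℕ) → dsc (m + n) = dsc m ⊗ₓ dsc n
  | 0 => (tens_unit (dsc m)).symm
  | n + 1 => by
    have h := tens_assoc' (dsc m) (dsc n) (Z 1 0 0)
    rw [← dsc_add m n] at h
    refine h.trans ?_
    rw [show assocP 0 0 0 = Equiv.refl _ from rfl, assocP_one]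
    exact (comp_one _).trans (one_comp _)

theorem cp_add (m : ℕ) : (n : ℕ) → cp (m + n) = (cp m ⊗ₓ cp n) ≫ₓ perm (mid m m n n)
  | 0 => by
    have h : perm (mid m m 0 0) = one (m + m) :=
      perm_eq_one fun i => Fin.addCases (m := m) (n := m) (fun i => mid_1 i) (fun i => mid_2 i) i
    exact (((congrArg (_ ≫ₓ ·) h).trans (comp_one _)).trans (tens_unit (cp m))).symm
  | n + 1 => by
    have h := tens_assoc' (cp m) (cp n) (Z 1 (1 + 1) 0)
    rw [assocP_one, perm_refl] at h
    have h' : cp (m + (n + 1)) = ((cp m ⊗ₓ cp n) ≫ₓ perm (mid m m n n)) ⊗ₓ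
        (Z 1 (1 + 1) 0 ≫ₓ one (1 + 1)) ≫ₓ perm (mid (m + n) (m + n) 1 1) := by
      rw [← cp_add m n, comp_one]; rfl
    rw [h', interchange, h, cp]
    rw [← comp_one (cp m), interchange (cp m), comp_one (cp m)]
    rw [one_comp, one, perm_tens, one, perm_tens, comp_perm_assoc, comp_perm_assoc,
      comp_perm_assoc]
    refine congrArg (_ ≫ₓ ·) (perm_congr ?_)
    refine Fin.forall_addCases.2 ⟨Fin.forall_addCases.2 ⟨fun i => ?_, fun i => ?_⟩,
      Fin.forall_addCases.2 ⟨Fin.forall_addCases.2 ⟨fun i => ?_, fun i => ?_⟩,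
        Fin.forall_addCases.2 ⟨fun i => ?_, fun i => ?_⟩⟩⟩ <;>
    simp only [Equiv.trans_apply, permSum_castAdd, permSum_natAdd, assocP_symm_1, assocP_symm_2,
      assocP_symm_3, mid_1, mid_2, mid_3, mid_4, Equiv.refl_apply]
    all_goals first | rfl | (ext; simp [Nat.add_assoc])

/-- A morphism is copyable if it commutes with copying and discarding. -/
structure Copyable {n m : ℕ} (f : ZX n m) : Prop where
  dsc : f ≫ₓ dsc m = dsc n
  cp : f ≫ₓ cp m = cp n ≫ₓ (f ⊗ₓ f)

theorem Copyable.comp {n m k : ℕ} {f : ZX n m} {g : ZX m k} (hf : Copyable f) (hg : Copyable g) :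
    Copyable (f ≫ₓ g) := by
  constructor
  · rw [assoc, hg.dsc, hf.dsc]
  · rw [assoc, hg.cp, ← assoc, hf.cp, assoc, interchange]

theorem copyable_one (n : ℕ) : Copyable (one n) := by
  constructor
  · rw [one_comp]
  · rw [one_comp, one_tens_one, comp_one]

theorem Copyable.tens {n m n' m' : ℕ} {f : ZX n m} {g : ZX n' m'} (hf : Copyable f)
    (hg : Copyable g) : Copyable (f ⊗ₓ g) := by
  constructor
  · rw [dsc_add, ← interchange, hf.dsc, hg.dsc, dsc_add]
  · rw [cp_add, cp_add, ← assoc, ← interchange, hf.cp, hg.cp, interchange, assoc, mid_natural,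
      assoc]

theorem copyable_flip (m n : ℕ) : Copyable (perm (finAddFlip (m := m) (n := n))) := by
  constructor
  · rw [dsc_add, dsc_add, ← swap_natural]
    exact (congrArg (_ ≫ₓ ·) (perm_eq_one fun i => i.elim0)).trans (comp_one _)
  · rw [cp_add, cp_add, ← assoc, ← swap_natural, assoc, assoc, perm_tens, perm_comp, perm_comp]
    congr 1
    apply perm_congr
    simp [Fin.forall_addCases, -Fin.natAdd_eq_addNat]

theorem copyable_finCongr {m n : ℕ} (h : m = n) : Copyable (perm (finCongr h)) := by
  subst h
  rw [perm_finCongr]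
  exact copyable_one _

/-- Up to casts, an adjacent transposition is a flip of two single wires between two identities. -/
theorem copyable_swap {k : ℕ} (i : Fin k) : Copyable (perm (Equiv.swap i.castSucc i.succ)) := by
  obtain ⟨i, hi⟩ := i
  obtain ⟨j, rfl⟩ := Nat.exists_eq_add_of_lt hi
  have h : i + j + 1 + 1 = i + (1 + 1) + j := by omega
  have := ((copyable_finCongr h).comp
    (((copyable_one i).tens (copyable_flip 1 1)).tens (copyable_one j))).comp
    (copyable_finCongr h.symm)
  rw [one, one, perm_tens, perm_tens, perm_comp, perm_comp] at this
  convert this using 2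
  ext x : 1
  obtain ⟨x, rfl⟩ := (finCongr h.symm).surjective x
  have e : finCongr h (finCongr h.symm x) = x := rfl
  rw [Equiv.trans_apply, Equiv.trans_apply, e, Equiv.swap_apply_def]
  revert x
  simp only [Fin.forall_addCases]
  simp only [permSum_castAdd, permSum_natAdd, Equiv.refl_apply, finAddFlip_apply_castAdd,
    finAddFlip_apply_natAdd]
  refine ⟨⟨?_, ?_, ?_⟩, ?_⟩ <;> intro x <;> split_ifs <;> simp [Fin.ext_iff] at * <;> omega

/-- Copyable morphisms compose, and adjacent transpositions generate the symmetric group. -/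
theorem copyable_perm {n m : ℕ} (σ : Fin n ≃ Fin m) : Copyable (perm σ) := by
  obtain rfl : n = m := Fin.equiv_iff_eq.1 ⟨σ⟩
  obtain _ | k := n
  · convert copyable_one 0
    exact perm_eq_one fun i => i.elim0
  have : σ ∈ Submonoid.closure (Set.range fun i : Fin k => Equiv.swap i.castSucc i.succ) := by
    rw [Equiv.Perm.mclosure_swap_castSucc_succ]; trivial
  induction this using Submonoid.closure_induction with
  | mem x hx =>
    obtain ⟨i, rfl⟩ := hx
    exact copyable_swap i
  | one => exact copyable_one _
  | mul x y _ _ hx hy =>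
    have := hy.comp hx
    rwa [perm_comp] at this

theorem Z_comp_dsc : (n : ℕ) → Z 1 n 0 ≫ₓ dsc n = Z 1 0 0
  | 0 => comp_one _
  | n + 1 => by
    have h : (dsc n ⊗ₓ Z 1 0 0) = (one n ⊗ₓ Z 1 0 0) ≫ₓ dsc n := by
      rw [tens_eq_right, tens_unit]
    rw [dsc, h, ← assoc, Z_comp_one_tens]
    exact (congrArg (Z 1 n · ≫ₓ _) (add_zero _)).trans (Z_comp_dsc n)

theorem Z_comp_cp : (n : ℕ) → Z 1 n 0 ≫ₓ cp n = Z 1 (n + n) 0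
  | 0 => comp_one _
  | n + 1 => by
    rw [cp, ← assoc, ← Z_perm 0 (Equiv.refl (Fin (n + 1))), ← Z_comp_tens n 1, perm_refl,
      comp_one, assoc (Z _ _ _), ← interchange, Z_comp_cp n, Z_comp_Z, add_zero, Z_comp_tens,
      Z_perm]

/-- Discarding or copying all the legs of a phase-free spider only changes the number of legs, by
fusion. -/
theorem copyable_Z (n : ℕ) : Copyable (Z 1 n 0) where
  dsc := by
    rw [Z_comp_dsc, dsc, dsc, unit_tens]
    exact ((comp_one _).trans (one_comp _)).symm
  cp := by
    have h : cp 1 = Z 1 (1 + 1) 0 := by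
      rw [cp, cp, unit_tens]
      have h' : perm (mid 0 0 1 1) = one (1 + 1) := perm_eq_one (by decide)
      refine (congrArg (_ ≫ₓ ·) h').trans ?_
      exact ((comp_one _).trans (comp_one _)).trans (one_comp _)
    rw [Z_comp_cp, h, Z_comp_tens]

end ZX

/-! ### Projections and the classification of wirings -/

namespace ZX

open PropTerm

theorem copyable_dsc : (n : ℕ) → Copyable (dsc n)
  | 0 => copyable_one 0
  | n + 1 => (copyable_dsc n).tens (copyable_Z 0)

theorem copyable_cp : (n : ℕ) → Copyable (cp n)
  | 0 => copyable_one 0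
  | n + 1 => ((copyable_cp n).tens (copyable_Z _)).comp (copyable_perm _)

theorem exists_perm_of_last {m : ℕ} (σ : Fin (m + 1) ≃ Fin (m + 1))
    (h : σ (Fin.last m) = Fin.last m) :
    ∃ τ : Fin m ≃ Fin m, σ = permSum τ (Equiv.refl (Fin 1)) := by
  have hne (i : Fin m) : σ i.castSucc ≠ Fin.last m := fun h' =>
    (Fin.castSucc_lt_last i).ne (σ.injective (h'.trans h.symm))
  have hinj : Function.Injective fun i : Fin m => (σ i.castSucc).castPred (hne i) := by
    intro i j hij
    simpa using hij
  refine ⟨Equiv.ofBijective _ (Finite.injective_iff_bijective.1 hinj), ?_⟩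
  ext i : 1
  refine Fin.addCases (fun i => ?_) (fun i => ?_) i
  · rw [permSum_castAdd]
    exact (Fin.castSucc_castPred _ (hne i)).symm
  · rw [permSum_natAdd, Subsingleton.elim i 0]
    exact h

/-- The projection to the `i`-th wire. -/
noncomputable def proj : {n : ℕ} → Fin n → ZX n 1
  | 0, i => i.elim0
  | m + 1, i => perm (Equiv.swap i (Fin.last m)) ≫ₓ (dsc m ⊗ₓ one 1)

theorem perm_comp_dsc {n m : ℕ} (σ : Fin n ≃ Fin m) : perm σ ≫ₓ dsc m = dsc n :=
  (copyable_perm σ).dsc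

/-- Only the wire that is sent to the last place matters: any reordering of the others is swallowed
by `dsc`. -/
theorem proj_eq {n m : ℕ} (e : Fin n ≃ Fin (m + 1)) {i : Fin n} (h : e i = Fin.last m) :
    perm e ≫ₓ (dsc m ⊗ₓ one 1) = proj i := by
  obtain rfl : n = m + 1 := Fin.equiv_iff_eq.1 ⟨e⟩
  obtain ⟨τ, hτ⟩ := exists_perm_of_last ((Equiv.swap i (Fin.last m)).symm.trans e) (by simpa using h)
  have : e = (Equiv.swap i (Fin.last m)).trans (permSum τ (Equiv.refl (Fin 1))) := by
    rw [← hτ, ← Equiv.trans_assoc]; simp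
  rw [this, ← perm_comp, assoc, ← perm_tens, ← interchange, perm_comp_dsc, perm_refl, one_comp]
  rfl

theorem proj_last (m : ℕ) : proj (Fin.last m) = dsc m ⊗ₓ one 1 := by
  exact (proj_eq (Equiv.refl (Fin (m + 1))) rfl).symm.trans (one_comp _)

theorem proj_fin_one (i : Fin 1) : proj i = one 1 := by
  rw [Subsingleton.elim i (Fin.last 0), proj_last, dsc, one_tens_one]

theorem proj_natAdd {a b : ℕ} (j : Fin b) : proj (Fin.natAdd a j) = dsc a ⊗ₓ proj j := by
  obtain _ | k := b
  · exact j.elim0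
  have h := tens_assoc' (dsc a) (dsc k) (one 1)
  rw [← dsc_add, show assocP a k 1 = Equiv.refl _ from rfl,
    show assocP 0 0 1 = Equiv.refl _ from rfl] at h
  have h' := h.trans ((comp_one _).trans (one_comp _))
  have h3 := proj_eq (n := a + (k + 1)) (m := a + k) (i := Fin.natAdd a j)
    (show Fin (a + (k + 1)) ≃ Fin (a + (k + 1)) from
      permSum (Equiv.refl (Fin a)) (Equiv.swap j (Fin.last k)))
    (by show permSum _ _ _ = _; rw [permSum_natAdd, Equiv.swap_apply_left]; rfl)
  rw [h', ← perm_tens, ← interchange, perm_refl, one_comp] at h3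
  exact h3.symm

theorem proj_castAdd {a b : ℕ} (i : Fin a) : proj (Fin.castAdd b i) = proj i ⊗ₓ dsc b := by
  obtain _ | k := a
  · exact i.elim0
  have h1 : PermSq (finAddFlip (m := 1) (n := b)) (one 1 ⊗ₓ dsc b) (dsc b ⊗ₓ one 1) finAddFlip :=
    swap_natural _ _
  have h2 : PermSq _ ((dsc k ⊗ₓ one 1) ⊗ₓ dsc b) (dsc k ⊗ₓ dsc b ⊗ₓ one 1) _ :=
    .trans (tens_assoc _ _ _) (.trans (.tens (.refl _) h1) (.symm (tens_assoc _ _ _)))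
  rw [← dsc_add] at h2
  unfold PermSq at h2
  have h3 := h2
  rw [perm_eq_one (fun i => Subsingleton.elim (α := Fin 1) _ _), comp_one] at h3
  rw [proj, ← one_comp (dsc b), interchange, one, perm_tens, h3, perm_comp_assoc]
  symm
  apply proj_eq
  simp only [Equiv.trans_apply, permSum_castAdd, Equiv.swap_apply_left]
  rw [show Fin.last k = Fin.natAdd k (0 : Fin 1) from rfl]
  simp only [assocP_2, permSum_natAdd, finAddFlip_apply_castAdd, assocP_symm_3]
  rfl

/-- `f` is copyable and its `i`-th output is a copy of its `ρ i`-th input. -/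
structure Rep {m n : ℕ} (f : ZX m n) (ρ : Fin n → Fin m) : Prop where
  copyable : Copyable f
  comp_proj : ∀ i, f ≫ₓ proj i = proj (ρ i)

theorem rep_perm {n m : ℕ} (σ : Fin n ≃ Fin m) : Rep (perm σ) σ.symm := by
  refine ⟨copyable_perm σ, fun i => ?_⟩
  obtain _ | k := m
  · exact i.elim0
  · rw [proj, perm_comp_assoc]
    apply proj_eq
    simp

theorem rep_one (n : ℕ) : Rep (one n) id := rep_perm (Equiv.refl _)

theorem Rep.comp {n m k : ℕ} {f : ZX n m} {g : ZX m k} {ρ : Fin m → Fin n} {σ : Fin k → Fin m}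
    (hf : Rep f ρ) (hg : Rep g σ) : Rep (f ≫ₓ g) (ρ ∘ σ) :=
  ⟨hf.copyable.comp hg.copyable, fun i => by rw [assoc, hg.comp_proj, hf.comp_proj]; rfl⟩

theorem Rep.tens {n m n' m' : ℕ} {f : ZX n m} {g : ZX n' m'} {ρ : Fin m → Fin n}
    {σ : Fin m' → Fin n'} (hf : Rep f ρ) (hg : Rep g σ) :
    Rep (f ⊗ₓ g) (Fin.addCases (fun i => Fin.castAdd n' (ρ i)) fun j => Fin.natAdd n (σ j)) := by
  refine ⟨hf.copyable.tens hg.copyable, fun i => ?_⟩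
  refine Fin.addCases (fun i => ?_) (fun i => ?_) i
  · rw [Fin.addCases_left, proj_castAdd, proj_castAdd, ← hf.comp_proj, ← hg.copyable.dsc, interchange]
  · rw [Fin.addCases_right, proj_natAdd, proj_natAdd, ← hg.comp_proj, ← hf.copyable.dsc, interchange]

theorem Rep.congr {n m : ℕ} {f : ZX m n} {ρ σ : Fin n → Fin m} (hf : Rep f ρ)
    (h : ∀ i, ρ i = σ i) : Rep f σ := by
  rwa [← show ρ = σ from funext h]

theorem rep_Z (n : ℕ) : Rep (Z 1 n 0) fun _ => 0 := by
  refine ⟨copyable_Z n, fun i => ?_⟩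
  obtain _ | k := n
  · exact i.elim0
  · rw [proj, ← assoc, Z_perm, proj_fin_one, ← Z_comp_tens, assoc, ← interchange, Z_comp_dsc,
      comp_one, Z_comp_tens]
    exact Z_one

theorem rep_dsc (n : ℕ) : Rep (dsc n) Fin.elim0 := ⟨copyable_dsc n, fun i => i.elim0⟩

theorem cp_comp_one_tens_dsc : (n : ℕ) → cp n ≫ₓ (one n ⊗ₓ dsc n) = one n
  | 0 => by
    rw [cp, dsc, one_tens_one]; exact one_comp _
  | n + 1 => by
    have h := mid_natural (one n) (dsc n) (one 1) (Z 1 0 0)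
    have h' : perm (mid n 0 1 0) = one (n + 1) :=
      perm_eq_one fun i => Fin.addCases (m := n) (n := 1) (fun i => mid_1 i) (fun i => mid_3 i) i
    have h2 := (congrArg (_ ≫ₓ ·) h').symm.trans h
    rw [dsc, cp, ← one_tens_one n 1, assoc, ← h2]
    refine (congrArg (_ ≫ₓ ·) (comp_one _)).trans ?_
    rw [← interchange, cp_comp_one_tens_dsc n, Z_comp_one_tens, add_zero (0 : Real.Angle)]
    exact congrArg _ Z_one

theorem cp_comp_dsc_tens_one : (n : ℕ) →
    cp n ≫ₓ (dsc n ⊗ₓ one n) = perm (finCongr (Nat.zero_add n)).symm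
  | 0 => by
    rw [cp, dsc, one_tens_one]; exact one_comp _
  | n + 1 => by
    have h := mid_natural (dsc n) (one n) (Z 1 0 0) (one 1)
    rw [dsc, cp, ← one_tens_one n 1, assoc, ← h, ← assoc, ← interchange,
      cp_comp_dsc_tens_one n, Z_comp_tens_one, add_zero (0 : Real.Angle)]
    refine (congrArg (fun t => (_ ⊗ₓ t) ≫ₓ _) Z_one).trans ?_
    rw [one, perm_tens]
    refine (perm_comp _ _).trans (perm_congr ?_)
    refine Fin.forall_addCases.2 ⟨fun i => ?_, fun i => ?_⟩
    · rw [Equiv.trans_apply, permSum_castAdd]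
      have h4 : (finCongr (Nat.zero_add n)).symm i = Fin.natAdd 0 i := by ext; simp
      rw [h4]
      refine (mid_2 i).trans ?_
      ext; simp
    · obtain rfl := Subsingleton.elim i 0
      rw [Equiv.trans_apply, permSum_natAdd]
      refine (mid_4 (a := 0) (b := n) (c := 0) (d := 1) 0).trans ?_
      ext; simp

theorem rep_cp (n : ℕ) : Rep (cp n) (Fin.addCases id id) := by
  refine ⟨copyable_cp n, fun i => ?_⟩
  refine Fin.addCases (fun i => ?_) (fun i => ?_) i
  · rw [Fin.addCases_left, proj_castAdd, tens_eq_right, ← assoc, cp_comp_one_tens_dsc, one_comp]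
    exact tens_unit _
  · rw [Fin.addCases_right, proj_natAdd, tens_eq_left, ← assoc, cp_comp_dsc_tens_one, unit_tens,
      ← assoc, ← assoc, perm_comp, Equiv.symm_trans_self, perm_refl, one_comp]
    exact comp_one _

/-- Copyable morphisms behave as maps into a cartesian product: they are determined by their
projections. The induction on the number of outputs splits off the last one. -/
theorem Rep.unique : {n m : ℕ} → {f g : ZX m n} → {ρ : Fin n → Fin m} → Rep f ρ → Rep g ρ → f = g
  | 0, m, f, g, ρ, hf, hg => by
    have := hf.copyable.dsc.trans hg.copyable.dsc.symm
    rwa [dsc, comp_one, comp_one] at this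
  | n + 1, m, f, g, ρ, hf, hg => by
    -- Duplicate all wires, forget the last wire of the first copy and all but the last of the
    -- second: nothing has changed. Inserting this after `f` and pushing the copying through `f`
    -- rebuilds `f` from its first `n` outputs and its last projection.
    have key : cp (n + 1) ≫ₓ ((one n ⊗ₓ Z 1 0 0) ⊗ₓ proj (Fin.last n)) = one (n + 1) := by
      have h := mid_natural (one n) (dsc n) (Z 1 0 0) (one 1)
      have h' : perm (mid n 0 0 1) = one (n + 1) :=
        perm_eq_one fun i => Fin.addCases (m := n) (n := 1) (fun i => mid_1 i) (fun i => by
          obtain rfl := Subsingleton.elim i 0; exact mid_4 0) i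
      have h2 := (congrArg (_ ≫ₓ ·) h').symm.trans h
      rw [proj_last, cp, ← one_tens_one n 1, assoc, ← h2]
      refine (congrArg (_ ≫ₓ ·) (comp_one _)).trans ?_
      rw [← interchange, cp_comp_one_tens_dsc n, Z_comp_tens_one, add_zero (0 : Real.Angle)]
      exact congrArg _ Z_one
    have hf' {f : ZX m (n + 1)} (hf : Rep f ρ) :
        f = cp m ≫ₓ ((f ≫ₓ (one n ⊗ₓ Z 1 0 0)) ⊗ₓ proj (ρ (Fin.last n))) := by
      conv_lhs => rw [← comp_one f, ← key, ← assoc, hf.copyable.cp, assoc, ← interchange,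
        hf.comp_proj]
    rw [hf' hf, hf' hg]
    congr 2
    have := (rep_one n).tens (rep_Z 0)
    exact Rep.unique (hf.comp this) (hg.comp this)

/-- The morphism whose `i`-th output is a copy of its `ρ i`-th input. -/
noncomputable def dl : {n m : ℕ} → (Fin n → Fin m) → ZX m n
  | 0, m, _ => dsc m
  | n + 1, m, ρ => cp m ≫ₓ (dl (fun i : Fin n => ρ i.castSucc) ⊗ₓ proj (ρ (Fin.last n)))

theorem copyable_proj {n : ℕ} (i : Fin n) : Copyable (proj i) := by
  obtain _ | k := n
  · exact i.elim0
  · exact (copyable_perm _).comp ((copyable_dsc k).tens (copyable_one 1))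

theorem rep_proj {n : ℕ} (i : Fin n) : Rep (proj i) fun _ => i :=
  ⟨copyable_proj i, fun j => by rw [proj_fin_one, comp_one]⟩

theorem rep_dl : {n m : ℕ} → (ρ : Fin n → Fin m) → Rep (dl ρ) ρ
  | 0, m, ρ => (rep_dsc m).congr fun i => i.elim0
  | n + 1, m, ρ => by
    refine ((rep_cp m).comp ((rep_dl _).tens (rep_proj _))).congr fun i => ?_
    refine Fin.addCases (m := n) (n := 1) (fun i => ?_) (fun i => ?_) i
    · rw [Function.comp, Fin.addCases_left, Fin.addCases_left]; rfl
    · rw [Function.comp, Fin.addCases_right, Fin.addCases_right, Subsingleton.elim i 0]; rfl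

theorem Rep.eq_dl {n m : ℕ} {f : ZX m n} {ρ : Fin n → Fin m} (h : Rep f ρ) : f = dl ρ :=
  h.unique (rep_dl ρ)

end ZX

/-- Effects on `N` wires, thought of as functions of `N` variables: the wires of an effect carry
variables, and Z-spiders identify variables. -/
abbrev Fn (N : ℕ) : Type := ZX N 0

/-! ### The commutative monoid of functions, substitution and sums -/

namespace Fn

open ZX
open PropTerm (permSum permSum_castAdd permSum_natAdd)

/-- Substitute variables. -/
noncomputable def at' {n N : ℕ} (t : ZX n 0) (ρ : Fin n → Fin N) : Fn N := dl ρ ≫ₓ t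

noncomputable instance (N : ℕ) : Mul (Fn N) := ⟨fun f g => cp N ≫ₓ (f ⊗ₓ g)⟩
noncomputable instance (N : ℕ) : One (Fn N) := ⟨dsc N⟩

theorem mul_def {N : ℕ} (f g : Fn N) : f * g = cp N ≫ₓ (f ⊗ₓ g) := rfl
theorem one_def (N : ℕ) : (1 : Fn N) = dsc N := rfl

/-- Both wirings copy the same inputs to the same outputs, so they agree by uniqueness of `dl`. This
is how identities between wirings are settled from here on. -/
theorem at_tens {n m N : ℕ} (f : ZX n 0) (g : ZX m 0) (ρ : Fin (n + m) → Fin N) :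
    at' (f ⊗ₓ g : ZX (n + m) (0 + 0)) ρ =
      at' f (fun i => ρ (Fin.castAdd m i)) * at' g (fun i => ρ (Fin.natAdd n i)) := by
  rw [mul_def, at', at', at', interchange, ← assoc]
  congr 1
  symm
  refine (((rep_cp N).comp ((rep_dl _).tens (rep_dl _))).congr ?_).eq_dl
  refine Fin.forall_addCases.2 ⟨fun i => ?_, fun i => ?_⟩ <;> simp [-Fin.natAdd_eq_addNat]

theorem at_at {n m N : ℕ} (t : ZX n 0) (ρ : Fin n → Fin m) (σ : Fin m → Fin N) :
    at' (at' t ρ) σ = at' t (fun i => σ (ρ i)) := by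
  rw [at', at', at', ← assoc, ((rep_dl σ).comp (rep_dl ρ)).eq_dl]
  rfl

theorem at_id {n : ℕ} (t : ZX n 0) {ρ : Fin n → Fin n} (h : ∀ i, ρ i = i) : at' t ρ = t := by
  rw [at', ← ((rep_one n).congr fun i => (h i).symm).eq_dl, one_comp]

@[simp] theorem at_id_fun {n : ℕ} (t : ZX n 0) : at' t (fun i => id i) = t := at_id t fun _ => rfl

theorem perm_comp_eq_at {n N : ℕ} (t : ZX n 0) (σ : Fin N ≃ Fin n) :
    perm σ ≫ₓ t = at' t σ.symm := by
  rw [at', ← (rep_perm σ).eq_dl]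

theorem rep_comp_eq_at {n N : ℕ} (t : ZX n 0) {f : ZX N n} {ρ : Fin n → Fin N} (h : Rep f ρ) :
    f ≫ₓ t = at' t ρ := by
  rw [at', ← h.eq_dl]

theorem mul_eq_at {N : ℕ} (f g : Fn N) :
    f * g = at' (f ⊗ₓ g : ZX (N + N) (0 + 0)) (Fin.addCases id id) := by
  rw [at_tens]; simp only [Fin.addCases_left, Fin.addCases_right]
  rw [at_id_fun, at_id_fun]

theorem at_mul {n N : ℕ} (f g : Fn n) (ρ : Fin n → Fin N) :
    at' (f * g) ρ = at' f ρ * at' g ρ := by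
  rw [mul_eq_at, at_at, at_tens]; simp [-Fin.natAdd_eq_addNat]

theorem at_one {n N : ℕ} (ρ : Fin n → Fin N) : at' (1 : Fn n) ρ = 1 := (rep_dl ρ).copyable.dsc

theorem flip_zero : perm (finAddFlip (m := 0) (n := 0)) = one 0 := perm_eq_one fun i => i.elim0

theorem mul_comm' {N : ℕ} (f g : Fn N) : f * g = g * f := by
  have h := swap_natural f g
  rw [flip_zero] at h
  have h' : f ⊗ₓ g = _ := (comp_one _).symm.trans h
  rw [mul_eq_at, h', perm_comp_eq_at, at_at, at_tens]
  simp only [finAddFlip, Equiv.symm_trans_apply, Equiv.sumComm_symm, Equiv.symm_symm,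
    finSumFinEquiv_symm_apply_castAdd, finSumFinEquiv_symm_apply_natAdd, Equiv.sumComm_apply,
    Sum.swap_inl, Sum.swap_inr, finSumFinEquiv_apply_left, finSumFinEquiv_apply_right,
    Fin.addCases_left, Fin.addCases_right]
  rw [at_id_fun, at_id_fun]

theorem mul_assoc' {N : ℕ} (f g h : Fn N) : f * g * h = f * (g * h) := by
  have h' := tens_assoc' f g h
  rw [perm_eq_one (σ := (assocP 0 0 0).symm) fun i => i.elim0] at h'
  have h2 := h'.trans (comp_one _)
  have e1 : f * g * h = at' ((f ⊗ₓ g) ⊗ₓ h : ZX (N + N + N) (0 + 0 + 0))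
      (Fin.addCases (Fin.addCases id id) id) := by
    rw [at_tens (f ⊗ₓ g), at_tens]
    simp only [Fin.addCases_left, Fin.addCases_right]
    rw [at_id_fun, at_id_fun, at_id_fun]
  rw [e1, h2, perm_comp_eq_at, at_at, at_tens f, at_tens]
  simp only [assocP_symm_1, assocP_symm_2, assocP_symm_3, Fin.addCases_left, Fin.addCases_right]
  rw [at_id_fun, at_id_fun, at_id_fun]

theorem mul_one' {N : ℕ} (f : Fn N) : f * 1 = f := by
  rw [mul_def, one_def, tens_eq_right, ← assoc, cp_comp_one_tens_dsc]
  exact (one_comp _).trans (tens_unit f)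

noncomputable instance (N : ℕ) : CommMonoid (Fn N) where
  mul_assoc := mul_assoc'
  mul_one := mul_one'
  one_mul f := by rw [mul_comm', mul_one']
  mul_comm := mul_comm'

/-- Substitution of variables as a homomorphism. -/
noncomputable def atHom {n N : ℕ} (ρ : Fin n → Fin N) : Fn n →* Fn N where
  toFun f := at' f ρ
  map_one' := at_one ρ
  map_mul' f g := at_mul f g ρ

theorem at_prod {n N : ℕ} {ι : Type*} (s : Finset ι) (f : ι → Fn n) (ρ : Fin n → Fin N) :
    at' (∏ i ∈ s, f i : Fn n) ρ = ∏ i ∈ s, at' (f i) ρ :=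
  map_prod (atHom ρ) f s

/-! ### Summation over variables -/

/-- The state that sums over `m` variables. -/
noncomputable def plus : (m : ℕ) → ZX 0 m
  | 0 => one 0
  | m + 1 => plus m ⊗ₓ Z 0 1 0

/-- Sum over the last `m` variables. -/
noncomputable def sum {n : ℕ} (m : ℕ) (t : ZX (n + m) 0) : Fn n := (one n ⊗ₓ plus m) ≫ₓ t

/-- Extend a substitution by the identity on `m` further variables. -/
def ext {n N : ℕ} (ρ : Fin n → Fin N) (m : ℕ) : Fin (n + m) → Fin (N + m) :=
  Fin.addCases (fun i => Fin.castAdd m (ρ i)) (Fin.natAdd N)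

@[simp] theorem ext_castAdd {n N : ℕ} (ρ : Fin n → Fin N) (m : ℕ) (i : Fin n) :
    ext ρ m (Fin.castAdd m i) = Fin.castAdd m (ρ i) := by simp [ext]
@[simp] theorem ext_natAdd {n N : ℕ} (ρ : Fin n → Fin N) (m : ℕ) (i : Fin m) :
    ext ρ m (Fin.natAdd n i) = Fin.natAdd N i := by simp [ext, -Fin.natAdd_eq_addNat]

theorem rep_ext {n N : ℕ} (ρ : Fin n → Fin N) (m : ℕ) : Rep (dl ρ ⊗ₓ one m) (ext ρ m) :=
  (rep_dl ρ).tens (rep_one m)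

theorem at_sum {n N m : ℕ} (t : ZX (n + m) 0) (ρ : Fin n → Fin N) :
    at' (sum m t) ρ = sum m (at' t (ext ρ m)) := by
  rw [sum, sum, ← rep_comp_eq_at t (rep_ext ρ m), ← assoc, ← interchange, at', ← assoc]
  congr 1
  rw [one_comp, comp_one]
  have := interchange (dl ρ) (one n) (one 0) (plus m)
  rw [one_comp, comp_one, tens_unit] at this
  exact this.symm

theorem sum_zero {n : ℕ} (t : ZX n 0) : sum 0 t = t :=
  (congrArg (· ≫ₓ _) (tens_unit (one n))).trans (one_comp _)

theorem sum_succ {n m : ℕ} (t : ZX (n + (m + 1)) 0) :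
    sum (m + 1) t = sum m (sum (n := n + m) 1 t) := by
  have h := tens_assoc' (one n) (plus m) (Z 0 1 0)
  rw [show assocP n 0 0 = Equiv.refl _ from rfl, show assocP n m 1 = Equiv.refl _ from rfl] at h
  have h1 : plus 1 = Z 0 1 0 := by
    rw [plus, plus, unit_tens]
    exact (comp_one _).trans (one_comp _)
  have h2 : (one n ⊗ₓ plus m) ≫ₓ (one (n + m) ⊗ₓ Z 0 1 0 : ZX (n + m + 0) (n + m + 1)) = one n ⊗ₓ plus (m + 1) := by
    refine Eq.trans ?_ (h.trans ((comp_one _).trans (one_comp _)))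
    have := interchange (one n ⊗ₓ plus m) (one (n + m)) (one 0) (Z 0 1 0)
    rw [one_comp, comp_one, tens_unit] at this
    exact this.symm
  simp only [sum]
  rw [h1, ← assoc, h2]

/-- The copying acts on the outer wires only, so it slides past the state `plus m`. This is the
distributive law for a factor free of the summed variables. -/
theorem sum_mul {n m : ℕ} (f : Fn n) (g : Fn (n + m)) :
    sum m (at' f (Fin.castAdd m) * g) = f * sum m g := by
  have e1 : (at' f (Fin.castAdd m) * g : Fn (n + m)) =
      (cp n ⊗ₓ one m) ≫ₓ (perm (assocP n n m) ≫ₓ (f ⊗ₓ g)) := by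
    rw [← assoc, rep_comp_eq_at (f ⊗ₓ g)
      (((rep_cp n).tens (rep_one m)).comp (rep_perm (assocP n n m))), at_tens]
    congr 1
    · congr 1; ext i; simp
    · refine (at_id g ?_).symm
      refine Fin.forall_addCases.2 ⟨fun i => ?_, fun i => ?_⟩ <;> simp [-Fin.natAdd_eq_addNat]
  have h := tens_assoc (one n) (one n) (plus m)
  rw [show assocP n n 0 = Equiv.refl _ from rfl, perm_refl, one_tens_one] at h
  have h' := h.trans (one_comp _)
  have h2 : (one n ⊗ₓ plus m) ≫ₓ (cp n ⊗ₓ one m) = cp n ≫ₓ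
      (one (n + n) ⊗ₓ plus m : ZX (n + n + 0) (n + n + m)) := by
    have := interchange (cp n) (one (n + n)) (one 0) (plus m)
    rw [one_comp, comp_one, tens_unit] at this
    rw [← interchange, one_comp, comp_one]
    exact this
  simp only [sum]
  rw [e1, ← assoc, h2, assoc, ← assoc (one (n + n) ⊗ₓ _), h', ← interchange, one_comp]
  rfl

/-- The substitution exchanges the last two variables, and the state that sums over two variables is
invariant under the flip. -/
theorem sum_swap {n : ℕ} (t : ZX (n + 1 + 1) 0) :
    sum 1 (sum 1 (at' t (Fin.addCases (m := n + 1) (Fin.addCases (fun i => i.castSucc.castSucc)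
      (fun _ => Fin.last (n + 1))) fun _ => (Fin.last n).castSucc))) = sum 1 (sum 1 t) := by
  rw [← sum_succ, ← sum_succ]
  have h : (plus (1 + 1) ≫ₓ perm (finAddFlip (m := 1) (n := 1))) = plus (1 + 1) := by
    have h1 : plus (1 + 1) = Z 0 1 0 ⊗ₓ Z 0 1 0 := by
      rw [plus, plus, plus, unit_tens]
      exact congrArg (· ⊗ₓ Z 0 1 0) ((comp_one _).trans (one_comp _))
    rw [h1, swap_natural, flip_zero, one_comp]
  have h2 := rep_comp_eq_at t ((rep_one n).tens (rep_perm (finAddFlip (m := 1) (n := 1))))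
  simp only [sum]
  refine (congrArg (_ ≫ₓ ·) (Eq.trans ?_ h2.symm)).trans ?_
  · congr 1
    ext1 i
    refine Fin.addCases (m := n) (n := 1 + 1) (fun i => ?_) (fun i => ?_) i
    · rw [Fin.addCases_left]
      exact Fin.addCases_left (m := n + 1) (n := 1) (Fin.castAdd 1 i) |>.trans
        (Fin.addCases_left (m := n) (n := 1) i)
    · rw [Fin.addCases_right]
      refine Fin.addCases (m := 1) (n := 1) (fun i => ?_) (fun i => ?_) i
      · obtain rfl := Subsingleton.elim i 0
        exact Fin.addCases_left (m := n + 1) (n := 1) (Fin.natAdd n 0) |>.trans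
          (Fin.addCases_right (m := n) (n := 1) 0)
      · obtain rfl := Subsingleton.elim i 0
        exact Fin.addCases_right (m := n + 1) (n := 1) 0
  · rw [← assoc, ← interchange, one_comp, h]

end Fn

namespace Fn

open ZX
open PropTerm (permSum permSum_castAdd permSum_natAdd permSum_symm)

/-! ### Caps, cups and contraction -/

/-- The effect that identifies two blocks of wires. -/
noncomputable def cap : (m : ℕ) → ZX (m + m) 0
  | 0 => one 0
  | m + 1 => perm (mid m 1 m 1) ≫ₓ (cap m ⊗ₓ Z (1 + 1) 0 0)

/-- The state that identifies two blocks of wires. -/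
noncomputable def cup (m : ℕ) : ZX 0 (m + m) := plus m ≫ₓ cp m

theorem cup_succ (m : ℕ) : cup (m + 1) = (cup m ⊗ₓ Z 0 (1 + 1) 0) ≫ₓ perm (mid m m 1 1) := by
  rw [cup, plus, cp, ← assoc, ← interchange, Z_comp_Z, add_zero]; rfl

/-- The permutations `mid` bring the two zigzags side by side, where the tensor of the two
hypotheses applies. The rest is a comparison of wire permutations, block by block. -/
theorem snake_tens {m n : ℕ} {u : ZX 0 (m + m)} {c : ZX (m + m) 0} {u' : ZX 0 (n + n)}
    {c' : ZX (n + n) 0}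
    (h : (one m ⊗ₓ u) ≫ₓ perm (assocP m m m).symm ≫ₓ (c ⊗ₓ one m) =
      perm (finCongr (Nat.zero_add m)).symm)
    (h' : (one n ⊗ₓ u') ≫ₓ perm (assocP n n n).symm ≫ₓ (c' ⊗ₓ one n) =
      perm (finCongr (Nat.zero_add n)).symm) :
    (one (m + n) ⊗ₓ ((u ⊗ₓ u') ≫ₓ perm (mid m m n n)) :
        ZX (m + n + 0) (m + n + (m + n + (m + n)))) ≫ₓ
      perm (assocP (m + n) (m + n) (m + n)).symm ≫ₓ
      ((perm (mid m n m n) ≫ₓ (c ⊗ₓ c')) ⊗ₓ one (m + n)) =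
    perm (finCongr (Nat.zero_add (m + n))).symm := by
  have h1 := mid_natural (one m) (one n) u u'
  have h2 := mid_natural c c' (one m) (one n)
  rw [comp_perm_eq_iff, mid_symm] at h1 h2
  rw [← one_comp (one (m + n)), interchange, ← one_tens_one, h1, interchange,
    h2, one_tens_one, show one (m + n) = perm (Equiv.refl _) from rfl, perm_tens, perm_tens]
  have h3 := congrArg₂ tens h h'
  rw [interchange, interchange, perm_tens, perm_tens] at h3
  have h4 : perm (permSum (assocP m m m).symm (assocP n n n).symm) =
      perm (mid m (m + m) n (n + n)) ≫ₓ perm (permSum (Equiv.refl (Fin (m + n))) (mid m m n n)) ≫ₓ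
      perm (assocP (m + n) (m + n) (m + n)).symm ≫ₓ
      perm (permSum (mid m n m n) (Equiv.refl (Fin (m + n)))) ≫ₓ perm (mid (m + m) (n + n) m n) := by
    rw [perm_comp, perm_comp, perm_comp, perm_comp]
    apply perm_congr
    refine Fin.forall_addCases.2 ⟨Fin.forall_addCases.2 ⟨fun i => ?_, Fin.forall_addCases.2 ⟨fun i => ?_, fun i => ?_⟩⟩,
      Fin.forall_addCases.2 ⟨fun i => ?_, Fin.forall_addCases.2 ⟨fun i => ?_, fun i => ?_⟩⟩⟩ <;>
    simp only [Equiv.trans_apply, permSum_castAdd, permSum_natAdd, assocP_symm_1, assocP_symm_2,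
      assocP_symm_3, mid_1, mid_2, mid_3, mid_4, Equiv.refl_apply]
  rw [h4] at h3
  refine Eq.trans (b := perm (mid m n 0 0) ≫ₓ perm (permSum (finCongr (Nat.zero_add m)).symm
    (finCongr (Nat.zero_add n)).symm) ≫ₓ perm (mid 0 m 0 n)) ?_ ?_
  · rw [← h3]
    simp only [assoc]
  · rw [perm_comp, perm_comp]
    have e (k : ℕ) (i : Fin k) : (finCongr (Nat.zero_add k)).symm i = Fin.natAdd 0 i := by
      ext; simp
    refine perm_congr ((Fin.forall_addCases (a := m) (b := n)).2 ⟨fun i => ?_, fun i => ?_⟩)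
    · have : mid m n 0 0 (Fin.castAdd n i : Fin (m + n)) = (Fin.castAdd n i : Fin (m + n)) := mid_1 (b := n) (c := 0) (d := 0) i
      rw [Equiv.trans_apply, Equiv.trans_apply, this]
      refine (congrArg (mid 0 m 0 n) ((permSum_castAdd _ _ i).trans (congrArg _ (e m i)))).trans
        ((mid_2 _).trans ?_)
      ext; simp
    · have : mid m n 0 0 (Fin.natAdd m i : Fin (m + n)) = (Fin.natAdd m i : Fin (m + n)) := mid_2 (a := m) (c := 0) (d := 0) i
      rw [Equiv.trans_apply, Equiv.trans_apply, this]
      refine (congrArg (mid 0 m 0 n) ((permSum_natAdd _ _ i).trans (congrArg _ (e n i)))).trans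
        ((mid_4 _).trans ?_)
      ext; simp

/-- Fusion along one wire straightens the mirror image of this zigzag. Flips carry one into the
other, and the remaining swaps are absorbed by the legs of the two spiders. -/
theorem snake_one : (one 1 ⊗ₓ Z 0 (1 + 1) 0) ≫ₓ perm (assocP 1 1 1).symm ≫ₓ
    (Z (1 + 1) 0 0 ⊗ₓ one 1) = perm (finCongr (Nat.zero_add 1)).symm := by
  have hf := fusion 0 1 1 0 0 0
  have h1 : PermSq _ (one 1 ⊗ₓ Z 0 (1 + 1) 0) (Z 0 (1 + 1) 0 ⊗ₓ one 1) _ := swap_natural _ _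
  have h2 : PermSq _ (Z (1 + 1) 0 0 ⊗ₓ one 1) (one 1 ⊗ₓ Z (1 + 1) 0 0) _ := swap_natural _ _
  unfold PermSq at h1 h2
  rw [comp_perm_eq_iff] at h1 h2
  have e : perm (finAddFlip (m := 1) (n := 2)).symm ≫ₓ (perm (assocP 1 1 1).symm ≫ₓ
      perm (finAddFlip (m := 2) (n := 1))) =
      (perm (Equiv.swap 0 1) ⊗ₓ one 1) ≫ₓ (perm (assocP 1 1 1) ≫ₓ
        (one 1 ⊗ₓ perm (Equiv.swap 0 1))) := by
    rw [one, perm_tens, perm_tens, perm_comp, perm_comp, perm_comp, perm_comp]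
    exact perm_congr (by decide)
  have e1 : (Z 0 (1 + 1) 0 ⊗ₓ one 1) ≫ₓ (perm (Equiv.swap 0 1) ⊗ₓ one 1) =
      Z 0 (1 + 1) 0 ⊗ₓ one 1 := by rw [← interchange, Z_perm, one_comp]
  have e2 : (one 1 ⊗ₓ perm (Equiv.swap 0 1)) ≫ₓ (one 1 ⊗ₓ Z (1 + 1) 0 0) =
      one 1 ⊗ₓ Z (1 + 1) 0 0 := by rw [← interchange, perm_Z, one_comp]
  have key : (Z 0 (1 + 1) 0 ⊗ₓ one 1) ≫ₓ (perm (finAddFlip (m := 1) (n := 2)).symm ≫ₓ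
      (perm (assocP 1 1 1).symm ≫ₓ perm (finAddFlip (m := 2) (n := 1)))) ≫ₓ
      (one 1 ⊗ₓ Z (1 + 1) 0 0) = one 1 := by
    rw [e, ← assoc, e1, assoc, assoc, e2, ← assoc, hf, add_zero (0 : Real.Angle)]
    exact Z_one
  rw [h1, h2]
  have key' := congrArg (fun t => perm (finAddFlip (m := 1) (n := 0)) ≫ₓ
    (t ≫ₓ perm (finAddFlip (m := 0) (n := 1)).symm)) key
  simp only [assoc, one_comp] at key' ⊢
  rw [key', perm_comp]
  exact perm_congr (by decide)

theorem snake : (m : ℕ) → (one m ⊗ₓ cup m) ≫ₓ perm (assocP m m m).symm ≫ₓ (cap m ⊗ₓ one m) =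
      perm (finCongr (Nat.zero_add m)).symm
  | 0 => by
    rw [cup, plus, cp, cap, one_tens_one, one_comp]
    exact (congrArg (fun t => t ≫ₓ one _ ≫ₓ one _) (one_tens_one 0 0)).trans
      ((comp_one _).trans (comp_one _))
  | m + 1 => by
    rw [cup_succ, cap]
    exact snake_tens (snake m) snake_one

theorem finAddFlip_symm_castAdd {m n : ℕ} (i : Fin n) :
    (finAddFlip (m := m) (n := n)).symm (Fin.castAdd m i) = Fin.natAdd m i := by
  rw [Equiv.symm_apply_eq, finAddFlip_apply_natAdd]

theorem finAddFlip_symm_natAdd {m n : ℕ} (i : Fin m) :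
    (finAddFlip (m := m) (n := n)).symm (Fin.natAdd n i) = Fin.castAdd n i := by
  rw [Equiv.symm_apply_eq, finAddFlip_apply_castAdd]

/-- The reordering of wires that brings two blocks next to their partners. -/
def conP (n k m m' : ℕ) : Fin (n + k + (m + m')) ≃ Fin (n + m + (m' + k)) :=
  (mid n k m m').trans (permSum (Equiv.refl _) finAddFlip)

theorem conP_natural {n n' k k' m m' p p' : ℕ} (f : ZX n n') (g : ZX k k') (h : ZX m m')
    (l : ZX p p') : PermSq (conP n k m p) ((f ⊗ₓ g) ⊗ₓ (h ⊗ₓ l)) ((f ⊗ₓ h) ⊗ₓ (l ⊗ₓ g))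
      (conP n' k' m' p') :=
  .trans (mid_natural f g h l) (.tens (.refl _) (swap_natural g l))

/-- Contract two effects along a state. -/
noncomputable def con {n k m m' : ℕ} (u : ZX (n + m) 0) (w : ZX 0 (m + m')) (v : ZX (m' + k) 0) :
    ZX (n + k) 0 :=
  (one (n + k) ⊗ₓ w : ZX (n + k + 0) (n + k + (m + m'))) ≫ₓ (perm (conP n k m m') ≫ₓ (u ⊗ₓ v))

theorem con_slide {n k m m' p p' : ℕ} (u : ZX (n + p) 0) (w : ZX 0 (m + m')) (v : ZX (p' + k) 0)
    (f : ZX m p) (g : ZX m' p') :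
    con u (w ≫ₓ (f ⊗ₓ g)) v = con ((one n ⊗ₓ f) ≫ₓ u) w ((g ⊗ₓ one k) ≫ₓ v) := by
  have h := conP_natural (one n) (one k) f g
  unfold PermSq at h
  rw [con, con, ← one_comp (one (n + k)), interchange, interchange, ← assoc (perm _), ← h,
    one_tens_one, one_comp, assoc, assoc]

theorem con_comp {n k m m' p q : ℕ} (u : ZX (n + m) 0) (w : ZX 0 (m + m')) (v : ZX (m' + k) 0)
    (f : ZX p n) (g : ZX q k) :
    con ((f ⊗ₓ one m) ≫ₓ u) w ((one m' ⊗ₓ g) ≫ₓ v) = (f ⊗ₓ g) ≫ₓ con u w v := by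
  have h := conP_natural f g (one m) (one m')
  unfold PermSq at h
  rw [con, con, interchange, ← assoc (perm _), ← h,
    one_tens_one, ← assoc, ← assoc, ← interchange, one_comp, comp_one]
  have := interchange (f ⊗ₓ g) (one (n + k)) (one 0) w
  rw [one_comp, comp_one, tens_unit] at this
  rw [this, assoc, assoc]

/-- The snake equation applied to the first block of wires of `v`; the block `k` is only carried
along. -/
theorem con_cap {m k : ℕ} (v : ZX (m + k) 0) : con (cap m) (cup m) v = v := by
  have h1 : PermSq _ (one m ⊗ₓ one k ⊗ₓ cup m) (one m ⊗ₓ cup m ⊗ₓ one k) _ :=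
    .trans (tens_assoc _ _ _) (.trans (.tens (.refl _) (swap_natural (one k) (cup m)))
      (.symm (tens_assoc _ _ _)))
  have h2 : PermSq _ (cap m ⊗ₓ one m ⊗ₓ one k) (cap m ⊗ₓ (one m ⊗ₓ one k)) _ := tens_assoc _ _ _
  unfold PermSq at h1 h2
  rw [comp_perm_eq_iff] at h1
  rw [eq_comm, perm_comp_eq_iff] at h2
  have h3 := congrArg (· ⊗ₓ one k) (snake m)
  simp only [tens_comp_one] at h3
  rw [con, tens_eq_left (cap m) v, ← one_tens_one m k, h1, h2, unit_tens]
  have e : perm ((assocP m k 0).trans ((permSum (Equiv.refl (Fin m)) finAddFlip).trans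
      (assocP m 0 k).symm)) ≫ₓ (perm (finCongr (Nat.zero_add m)).symm ⊗ₓ one k) ≫ₓ
      perm (assocP 0 m k) ≫ₓ perm (finCongr (Nat.zero_add (m + k))) = one (m + k) := by
    rw [one, perm_tens, perm_comp, perm_comp, perm_comp]
    refine perm_eq_one ((Fin.forall_addCases (a := m) (b := k)).2 ⟨fun i => ?_, fun i => ?_⟩)
    · rw [show (Fin.castAdd k i : Fin (m + k)) = Fin.castAdd (n := m + k) 0 (Fin.castAdd k i) from rfl]
      simp only [Equiv.trans_apply, assocP_1, permSum_castAdd, Equiv.refl_apply, assocP_symm_1]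
      rfl
    · rw [show (Fin.natAdd m i : Fin (m + k)) = Fin.castAdd (n := m + k) 0 (Fin.natAdd m i) from rfl]
      simp only [Equiv.trans_apply, assocP_2, permSum_natAdd, Equiv.refl_apply, assocP_symm_3,
        finAddFlip_apply_castAdd, assocP_3]
      ext; simp
  have e' : perm ((assocP m k (m + m)).trans ((permSum (Equiv.refl (Fin m)) finAddFlip).trans
      (assocP m (m + m) k).symm)).symm ≫ₓ perm (conP m k m m) ≫ₓ perm (assocP (m + m) m k).symm =
      perm (assocP m m m).symm ⊗ₓ one k := by
    rw [one, perm_tens, perm_comp, perm_comp]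
    refine perm_congr (Fin.forall_addCases.2 ⟨Fin.forall_addCases.2 ⟨fun i => ?_,
      Fin.forall_addCases.2 ⟨fun i => ?_, fun i => ?_⟩⟩, fun i => ?_⟩) <;>
    simp only [Equiv.trans_apply, Equiv.symm_trans_apply, Equiv.symm_symm, permSum_symm, conP,
      permSum_castAdd, permSum_natAdd, assocP_1, assocP_2, assocP_3, assocP_symm_1, assocP_symm_2,
      assocP_symm_3, mid_1, mid_2, mid_3, mid_4, Equiv.refl_apply, Equiv.refl_symm,
      finAddFlip_symm_castAdd, finAddFlip_symm_natAdd, finAddFlip_apply_castAdd,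
      finAddFlip_apply_natAdd]
  rw [← e'] at h3
  refine Eq.trans (b := one (m + k) ≫ₓ v) ?_ (one_comp _)
  rw [← e, ← h3]
  simp only [assoc]
  congr 9
  exact (comp_one _).trans rfl

end Fn

/-! ### Fusion along several wires and colour change -/

namespace ZX

theorem fusion_all (a d k : ℕ) (α β : Real.Angle) :
    Z a (k + 1) α ≫ₓ Z (k + 1) d β = Z a d (α + β) := by
  have h : (Z a (0 + (k + 1)) α ⊗ₓ one 0) ≫ₓ perm (assocP 0 (k + 1) 0) ≫ₓ
      (one 0 ⊗ₓ Z (k + 1 + 0) d β) = Z (a + 0) (0 + d) (α + β) :=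
    mk_rule (.fusion a 0 0 d k α β)
  rw [tens_unit, unit_tens, ← assoc, ← assoc, comp_perm_eq_iff, Z_perm] at h
  have h' := (congrArg (fun t => t ≫ₓ _ ≫ₓ Z (k + 1 + 0) d β) (Z_perm α _)).symm.trans h
  exact (congrArg (· ≫ₓ Z (k + 1 + 0) d β) (Z_perm α _)).symm.trans h'

theorem mk_power_H_one : mk (PropTerm.power ZXTerm.H 1) = H := by
  show one 0 ⊗ₓ H = H
  rw [unit_tens]
  exact (comp_one _).trans (one_comp _)

theorem X_zero_one (α : Real.Angle) : X 0 1 α = Z 0 1 α ≫ₓ H := by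
  have h : mk _ = mk _ := mk_rule (.colourChange 0 1 α)
  rw [mk_comp, mk_power_H_one, mk_comp] at h
  exact h.symm.trans (congrArg (· ≫ₓ H) (one_comp _))

theorem X_one_zero (α : Real.Angle) : X 1 0 α = H ≫ₓ Z 1 0 α := by
  have h : mk _ = mk _ := mk_rule (.colourChange 1 0 α)
  rw [mk_comp, mk_comp, mk_power_H_one] at h
  exact h.symm.trans (comp_one _)

theorem X_one_one (α : Real.Angle) : X 1 1 α = H ≫ₓ Z 1 1 α ≫ₓ H := by
  have h : mk _ = mk _ := mk_rule (.colourChange 1 1 α)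
  rw [mk_comp, mk_comp, mk_power_H_one] at h
  exact h.symm

theorem H_comp_H : H ≫ₓ H = one 1 := mk_rule .hadamardTwice

end ZX

namespace Fn

open ZX
open PropTerm (permSum permSum_castAdd permSum_natAdd permSum_symm)

/-- The cup is `plus m` followed by copying, so contraction along it is a sum over variables shared
by the two effects. -/
theorem con_cup {n m k : ℕ} (u : ZX (n + m) 0) (v : ZX (m + k) 0) :
    con u (cup m) v = sum m
      (at' u (Fin.addCases (fun i => Fin.castAdd m (Fin.castAdd k i)) (Fin.natAdd (n + k))) *
        at' v (Fin.addCases (Fin.natAdd (n + k)) fun i => Fin.castAdd m (Fin.natAdd n i)) :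
          Fn (n + k + m)) := by
  have e : (at' u (Fin.addCases (fun i => Fin.castAdd m (Fin.castAdd k i)) (Fin.natAdd (n + k))) *
        at' v (Fin.addCases (Fin.natAdd (n + k)) fun i => Fin.castAdd m (Fin.natAdd n i)) :
          Fn (n + k + m)) =
      (one (n + k) ⊗ₓ cp m : ZX (n + k + m) (n + k + (m + m))) ≫ₓ
        (perm (conP n k m m) ≫ₓ (u ⊗ₓ v)) := by
    rw [← assoc, rep_comp_eq_at (u ⊗ₓ v)
      (((rep_one (n + k)).tens (rep_cp m)).comp (rep_perm (conP n k m m))), at_tens]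
    congr 2 <;> ext1 i <;> refine Fin.addCases (fun i => ?_) (fun i => ?_) i <;>
    simp only [Function.comp, conP, Equiv.symm_trans_apply, mid_symm, permSum_symm,
      permSum_castAdd, permSum_natAdd, finAddFlip_symm_castAdd, finAddFlip_symm_natAdd, mid_1,
      mid_2, mid_3, mid_4, Equiv.refl_symm, Equiv.refl_apply, Fin.addCases_left,
      Fin.addCases_right, id]
  have h := interchange (one (n + k)) (one (n + k)) (plus m) (cp m)
  rw [one_comp] at h
  rw [e, sum, con, cup, h, assoc]

/-- The equality of two variables. -/
noncomputable def dlt {N : ℕ} (x y : Fin N) : Fn N := at' (Z 2 0 0) ![x, y]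

theorem dlt_comm {N : ℕ} (x y : Fin N) : dlt x y = dlt y x := by
  have h := perm_comp_eq_at (Z 2 0 0) (Equiv.swap 0 1)
  rw [perm_Z] at h
  rw [dlt, h, at_at, dlt]
  congr 1
  ext1 i
  fin_cases i <;> rfl

theorem at_dlt {n N : ℕ} (x y : Fin n) (ρ : Fin n → Fin N) :
    at' (dlt x y) ρ = dlt (ρ x) (ρ y) := by
  rw [dlt, at_at, dlt]
  congr 1
  ext1 i
  fin_cases i <;> rfl

theorem at_cap {N : ℕ} : (m : ℕ) → (ρ : Fin (m + m) → Fin N) →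
    at' (cap m) ρ = ∏ i, dlt (ρ (Fin.castAdd m i)) (ρ (Fin.natAdd m i))
  | 0, ρ => by
    rw [Finset.univ_eq_empty, Finset.prod_empty]
    exact at_one (n := 0) ρ
  | m + 1, ρ => by
    rw [cap, perm_comp_eq_at, at_at, at_tens, at_cap m, Fin.prod_univ_castSucc]
    simp only [mid_symm]
    congr 1
    · refine Finset.prod_congr rfl fun i _ => ?_
      rw [mid_1, mid_2]; rfl
    · rw [dlt]
      congr 1
      ext1 i
      refine Fin.addCases (m := 1) (n := 1) (fun i => ?_) (fun i => ?_) i <;>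
        obtain rfl := Subsingleton.elim i 0
      · exact congrArg ρ (mid_3 _)
      · exact congrArg ρ (mid_4 _)

/-- In the form of a sum of products, contraction is symmetric in its two effects. Hence this is
`con_cap` after flipping the blocks. -/
theorem con_cup_cap {n m : ℕ} (u : ZX (n + m) 0) : con u (cup m) (cap m) = u := by
  have h := con_cap (at' u (finAddFlip (m := n) (n := m)))
  rw [con_cup, at_at, at_cap] at h
  have h' := congrArg (fun t => at' t (finAddFlip (m := m) (n := n))) h
  rw [at_at, at_sum, at_mul, at_at, at_prod] at h'
  rw [at_id] at h'
  · rw [con_cup, at_cap, mul_comm]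
    refine Eq.trans ?_ h'
    congr 2
    · refine Finset.prod_congr rfl fun i _ => ?_
      rw [at_dlt, dlt_comm]
      simp only [Fin.addCases_left, Fin.addCases_right, ext_castAdd, ext_natAdd,
        finAddFlip_apply_castAdd]
    · congr 1; ext1 i
      refine Fin.addCases (fun i => ?_) (fun i => ?_) i <;>
      simp only [Fin.addCases_left, Fin.addCases_right, ext_castAdd, ext_natAdd,
        finAddFlip_apply_castAdd, finAddFlip_apply_natAdd]
  · refine Fin.forall_addCases.2 ⟨fun i => ?_, fun i => ?_⟩ <;>
    simp only [finAddFlip_apply_castAdd, finAddFlip_apply_natAdd]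

theorem cap_one : cap 1 = Z (1 + 1) 0 0 := by
  rw [cap, cap, unit_tens, assoc, ← assoc (perm _), perm_comp, ← assoc, perm_Z]
  exact comp_one _

theorem plus_one : plus 1 = Z 0 1 0 := by
  rw [plus, plus, unit_tens]
  exact (comp_one _).trans (one_comp _)

theorem cp_one : cp 1 = Z 1 (1 + 1) 0 := by
  rw [((rep_cp 1).congr fun i => Subsingleton.elim _ _).unique (rep_Z (1 + 1))]

theorem cup_one : cup 1 = Z 0 (1 + 1) 0 := by
  rw [cup, plus_one, cp_one, Z_comp_Z, add_zero]

/-- The rule `hadamardSlide` concerns the cup. Contracting both of its sides with caps transposes it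
to the cap. -/
theorem H_slide : (H ⊗ₓ one 1) ≫ₓ cap 1 = (one 1 ⊗ₓ H) ≫ₓ cap 1 := by
  have h : Z 0 (1 + 1) 0 ≫ₓ (H ⊗ₓ one 1) = Z 0 (1 + 1) 0 ≫ₓ (one 1 ⊗ₓ H) := mk_rule .hadamardSlide
  have h1 := con_slide (n := 1) (k := 1) (cap 1) (cup 1) (cap 1) H (one 1)
  have h2 := con_slide (n := 1) (k := 1) (cap 1) (cup 1) (cap 1) (one 1) H
  rw [cup_one, ← h] at h2
  rw [cup_one] at h1
  have h3 := h2.symm.trans h1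
  rw [← cup_one, one_tens_one, one_comp, con_cap, con_cup_cap] at h3
  exact h3

theorem H_tens_H_cap : (H ⊗ₓ H) ≫ₓ cap 1 = cap 1 := by
  rw [tens_eq_right, assoc, H_slide, ← assoc, ← interchange, H_comp_H, one_comp, one_tens_one,
    one_comp]

theorem copy_zero (n : ℕ) : X 0 1 0 ≫ₓ Z 1 n 0 = ZX.mk (PropTerm.copies (ZXTerm.X 0 1 0) n) := by
  have h : ZX.mk _ = ZX.mk _ := mk_rule (.copy n 0 0)
  rw [Fin.val_zero, zero_smul] at h
  exact h

/-- This scalar must be trivial for a sum over an absent variable to do nothing. Evaluate `X 0 1 0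
≫ₓ Z 1 2 0 ≫ₓ cap 1` in two ways. Fusing the spiders gives `X 0 1 0 ≫ₓ Z 1 0 0`, which is empty by
the copy rule without outputs. Copying first gives two X-states on a cap; their Hadamard gates
cancel and the scalar in question remains. -/
theorem Z_zero_one_comp : Z 0 1 0 ≫ₓ Z 1 0 0 = one 0 := by
  have h0 : X 0 1 0 ≫ₓ Z 1 0 0 = one 0 := copy_zero 0
  have h2 : X 0 1 0 ≫ₓ Z 1 (1 + 1) 0 = X 0 1 0 ⊗ₓ X 0 1 0 := by
    refine (copy_zero 2).trans ?_
    show one 0 ⊗ₓ X 0 1 0 ⊗ₓ X 0 1 0 = _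
    rw [unit_tens]
    exact congrArg (· ⊗ₓ X 0 1 0) ((comp_one _).trans (one_comp _))
  have h3 := congrArg (· ≫ₓ cap 1) h2
  beta_reduce at h3
  rw [X_zero_one, interchange, assoc (_ ⊗ₓ _), H_tens_H_cap, cap_one, ← X_zero_one, assoc,
    fusion_all, add_zero, h0, tens_eq_right, assoc, tens_one_comp_Z, unit_tens, add_zero (0 : Real.Angle)] at h3
  exact ((congrArg (· ≫ₓ Z 1 0 0) (perm_Z_perm 0 _ _)).symm.trans h3.symm)

end Fn

namespace Fn

open ZX
open PropTerm (permSum permSum_castAdd permSum_natAdd permSum_symm)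

/-! ### Summation over a single variable -/

theorem plus_comp_dsc : (m : ℕ) → plus m ≫ₓ dsc m = one 0
  | 0 => one_comp _
  | m + 1 => by
    rw [plus, dsc, ← interchange, plus_comp_dsc m, Z_zero_one_comp, one_tens_one]

theorem sum_one' {n m : ℕ} : sum m (1 : Fn (n + m)) = 1 := by
  rw [sum, one_def, dsc_add, ← interchange, one_comp, plus_comp_dsc, tens_unit, one_def]

theorem sum_castAdd {n m : ℕ} (f : Fn n) : sum m (at' f (Fin.castAdd m)) = f := by
  have := sum_mul (m := m) f 1
  rwa [mul_one, sum_one', mul_one] at this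

/-- A left inverse of `ρ` undoes the substitution. Without variables there need be no left inverse;
then all wires are discarded and `plus N` removes them. -/
theorem at_injective {n N : ℕ} {ρ : Fin n → Fin N} (hρ : Function.Injective ρ) {f g : Fn n}
    (h : at' f ρ = at' g ρ) : f = g := by
  obtain _ | k := n
  · rw [at', at', (rep_dl ρ).unique ((rep_dsc N).congr fun i => i.elim0)] at h
    have h' := congrArg (plus N ≫ₓ ·) h
    beta_reduce at h'
    rwa [← assoc, ← assoc, plus_comp_dsc, one_comp, one_comp] at h'
  · have h' := congrArg (at' · (Function.invFun ρ)) h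
    beta_reduce at h'
    rw [at_at, at_at] at h'
    rwa [at_id _ fun i => Function.leftInverse_invFun hρ i,
      at_id _ fun i => Function.leftInverse_invFun hρ i] at h'

variable {N : ℕ}

/-- Separate the variable `x` from the others. -/
def sep (x y : Fin N) : Fin (N + 1) := if y = x then Fin.natAdd N 0 else Fin.castAdd 1 y

@[simp] theorem sep_self (x : Fin N) : sep x x = Fin.natAdd N 0 := if_pos rfl
theorem sep_of_ne {x y : Fin N} (h : y ≠ x) : sep x y = Fin.castAdd 1 y := if_neg h

/-- Sum over the variable `x`. -/
noncomputable def E (x : Fin N) (f : Fn N) : Fn N := sum 1 (at' f (sep x))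

theorem E_at_of_notMem {n : ℕ} (t : ZX n 0) {ρ : Fin n → Fin N} {x : Fin N} (h : ∀ i, ρ i ≠ x) :
    E x (at' t ρ) = at' t ρ := by
  rw [E, at_at, show (fun i => sep x (ρ i)) = fun i => Fin.castAdd 1 (ρ i) from
    funext fun i => sep_of_ne (h i), ← at_at, sum_castAdd]

theorem E_one (x : Fin N) : E x 1 = 1 := by
  rw [E, at_one, sum_one']

/-- `E x f` is free of `x`, so it does not matter where the substitution sends `x`. -/
theorem at_E_sep (x : Fin N) (f : Fn N) : at' (E x f) (sep x) = at' (E x f) (Fin.castAdd 1) := by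
  rw [E, at_sum, at_sum, at_at, at_at]
  congr 2
  ext1 i
  by_cases h : i = x
  · subst h; rw [sep_self, ext_natAdd, ext_natAdd]
  · rw [sep_of_ne h, ext_castAdd, ext_castAdd, sep_of_ne h]

theorem E_mul_E (x : Fin N) (f g : Fn N) : E x (f * E x g) = E x f * E x g := by
  rw [E, at_mul, at_E_sep, mul_comm, sum_mul, mul_comm]; rfl

theorem E_comm (x y : Fin N) (f : Fn N) : E x (E y f) = E y (E x f) := by
  by_cases hxy : x = y
  · rw [hxy]
  · have key (x y : Fin N) : E x (E y f) = sum 1 (sum 1 (at' f fun i => ext (sep x) 1 (sep y i))) := by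
      rw [E, E, at_sum, at_at]
    rw [key x y, key y x, ← sum_swap, at_at]
    congr 3
    ext1 i
    by_cases h : i = x
    · subst h
      rw [sep_of_ne hxy, sep_self, ext_castAdd, ext_natAdd, sep_self]
      exact (Fin.addCases_left (m := N + 1) (n := 1) (Fin.natAdd N 0)).trans
        (Fin.addCases_right (m := N) (n := 1) 0)
    by_cases h' : i = y
    · subst h'
      rw [sep_of_ne h, sep_self, ext_castAdd, ext_natAdd, sep_self]
      exact Fin.addCases_right (m := N + 1) (n := 1) 0
    · rw [sep_of_ne h, sep_of_ne h', ext_castAdd, ext_castAdd, sep_of_ne h, sep_of_ne h']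
      exact (Fin.addCases_left (m := N + 1) (n := 1) (Fin.castAdd 1 i)).trans
        (Fin.addCases_left (m := N) (n := 1) i)

/-- `f` does not depend on the variable `x`. -/
def Indep (x : Fin N) (f : Fn N) : Prop := E x f = f

theorem indep_at {n : ℕ} (t : ZX n 0) {ρ : Fin n → Fin N} {x : Fin N} (h : ∀ i, ρ i ≠ x) :
    Indep x (at' t ρ) := E_at_of_notMem t h

theorem Indep.E_mul {x : Fin N} {f : Fn N} (hf : Indep x f) (g : Fn N) :
    E x (f * g) = f * E x g := by
  unfold Indep at hf
  rw [← hf, mul_comm, E_mul_E, mul_comm]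

theorem Indep.E_mul' {x : Fin N} {f : Fn N} (hf : Indep x f) (g : Fn N) :
    E x (g * f) = E x g * f := by
  rw [mul_comm, hf.E_mul, mul_comm]

theorem indep_one (x : Fin N) : Indep x 1 := E_one x

theorem Indep.mul {x : Fin N} {f g : Fn N} (hf : Indep x f) (hg : Indep x g) :
    Indep x (f * g) := by
  unfold Indep at *
  rw [Indep.E_mul hf, hg]

theorem Indep.prod {ι : Type*} {s : Finset ι} {f : ι → Fn N} {x : Fin N}
    (h : ∀ i ∈ s, Indep x (f i)) : Indep x (∏ i ∈ s, f i) :=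
  Finset.prod_induction f (Indep x) (fun _ _ => .mul) (indep_one x) h

/-! ### Summation over a set of variables -/

/-- This makes the fold over a multiset in `Es` independent of the order of summation. -/
instance : LeftCommutative (E (N := N)) := ⟨E_comm⟩

/-- Sum over a finite set of variables. -/
noncomputable def Es (s : Finset (Fin N)) (f : Fn N) : Fn N := s.val.foldr E f

@[simp] theorem Es_empty (f : Fn N) : Es ∅ f = f := rfl

theorem Es_insert {x : Fin N} {s : Finset (Fin N)} (h : x ∉ s) (f : Fn N) :
    Es (insert x s) f = E x (Es s f) := by
  rw [Es, Finset.insert_val_of_notMem h, Multiset.foldr_cons, Es]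

theorem E_Es (x : Fin N) (s : Finset (Fin N)) (f : Fn N) : E x (Es s f) = Es s (E x f) := by
  induction s using Finset.induction_on with
  | empty => rfl
  | insert a s ha ih => rw [Es_insert ha, Es_insert ha, E_comm, ih]

theorem at_sum_one_eq_E {n : ℕ} (t : ZX (n + 1) 0) {ρ : Fin n → Fin N} {x : Fin N}
    (h : ∀ i, ρ i ≠ x) : at' (sum 1 t) ρ = E x (at' t (Fin.addCases ρ fun _ => x)) := by
  rw [E, at_sum, at_at]
  congr 2
  ext1 i
  refine Fin.addCases (fun i => ?_) (fun i => ?_) i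
  · rw [Fin.addCases_left, ext_castAdd, sep_of_ne (h i)]
  · rw [Fin.addCases_right, ext_natAdd, sep_self, Subsingleton.elim i 0]

/-- Summation in terms of named variables. -/
theorem at_sum_eq_Es {n : ℕ} : {m : ℕ} → (t : ZX (n + m) 0) → (ρ : Fin n → Fin N) →
    {b : Fin m → Fin N} → (hb : Function.Injective b) → (hρ : ∀ i j, ρ i ≠ b j) →
    at' (sum m t) ρ = Es (Finset.univ.image b) (at' t (Fin.addCases ρ b))
  | 0, t, ρ, b, hb, hρ => by
    rw [Finset.univ_eq_empty, Finset.image_empty, Es_empty, sum_zero]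
    congr 1
    ext1 i
    exact (Fin.addCases_left (m := n) (n := 0) (motive := fun _ => Fin N) (left := ρ) (right := b) i).symm
  | m + 1, t, ρ, b, hb, hρ => by
    have h1 : Finset.univ.image b =
        insert (b (Fin.last m)) (Finset.univ.image fun i : Fin m => b i.castSucc) := by
      ext x
      simp only [Finset.mem_image, Finset.mem_univ, true_and, Finset.mem_insert]
      constructor
      · rintro ⟨i, rfl⟩
        refine Fin.lastCases (.inl rfl) (fun i => .inr ⟨i, rfl⟩) i
      · rintro (rfl | ⟨i, rfl⟩)
        exacts [⟨_, rfl⟩, ⟨_, rfl⟩]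
    have h2 : b (Fin.last m) ∉ Finset.univ.image fun i : Fin m => b i.castSucc := by
      simp only [Finset.mem_image, Finset.mem_univ, true_and, not_exists]
      exact fun i hi => (Fin.castSucc_lt_last i).ne (hb hi)
    rw [sum_succ, at_sum_eq_Es (b := fun i : Fin m => b i.castSucc) _ ρ
      (fun i j hij => Fin.castSucc_injective m (hb hij)) (fun i j => hρ i _),
      at_sum_one_eq_E (x := b (Fin.last m)), ← E_Es, h1, Es_insert h2]
    · congr 3
      ext1 i
      refine Fin.addCases (m := n) (n := m + 1) (fun i => ?_) (fun i => ?_) i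
      · rw [Fin.addCases_left]
        exact (Fin.addCases_left (m := n + m) (n := 1) (Fin.castAdd m i)).trans
          (Fin.addCases_left (m := n) (n := m) i)
      · rw [Fin.addCases_right]
        refine Fin.addCases (m := m) (n := 1) (fun i => ?_) (fun i => ?_) i
        · exact (Fin.addCases_left (m := n + m) (n := 1) (Fin.natAdd n i)).trans
            (Fin.addCases_right (m := n) (n := m) i)
        · obtain rfl := Subsingleton.elim i 0
          exact Fin.addCases_right (m := n + m) (n := 1) 0
    · intro i
      refine Fin.addCases (fun i => ?_) (fun i => ?_) i
      · rw [Fin.addCases_left]; exact hρ i _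
      · rw [Fin.addCases_right]; exact fun hi => (Fin.castSucc_lt_last i).ne (hb hi)

end Fn

namespace Fn

open ZX
open PropTerm (permSum permSum_castAdd permSum_natAdd permSum_symm)

variable {N : ℕ}

/-! ### Evaluation of morphisms -/

/-- The name of a morphism: its outputs are bent to become inputs. -/
noncomputable def nm {n m : ℕ} (f : ZX n m) : ZX (n + m) 0 := (f ⊗ₓ one m) ≫ₓ cap m

/-- The morphism `f` as a function of the variables on its inputs and outputs. -/
noncomputable def ev {n m : ℕ} (f : ZX n m) (a : Fin n → Fin N) (b : Fin m → Fin N) : Fn N :=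
  at' (nm f) (Fin.addCases a b)

/-- Bending the outputs back with a cup recovers `f`, by the snake equation. -/
theorem nm_injective {n m : ℕ} {f g : ZX n m} (h : nm f = nm g) : f = g := by
  have key (f : ZX n m) : (one n ⊗ₓ cup m : ZX (n + 0) (n + (m + m))) ≫ₓ
      perm (assocP n m m).symm ≫ₓ (nm f ⊗ₓ one m) = f ≫ₓ perm (finCongr (Nat.zero_add m)).symm := by
    have h2 : PermSq _ (f ⊗ₓ one m ⊗ₓ one m) (f ⊗ₓ (one m ⊗ₓ one m)) _ := tens_assoc _ _ _
    have h3 := h2.symm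
    unfold PermSq at h3
    have h4 := interchange f (one m) (one 0) (cup m)
    rw [one_comp, comp_one, tens_unit] at h4
    have h5 := interchange (one n) f (cup m) (one m ⊗ₓ one m)
    rw [one_tens_one, comp_one, one_comp] at h5
    rw [nm, tens_comp_one, assoc, ← assoc (perm _), ← h3, ← snake, one_tens_one, ← assoc, ← assoc,
      ← h5, assoc, assoc, h4, assoc]
  have h' := (key f).symm.trans ((congrArg (fun t => _ ≫ₓ (t ⊗ₓ one m)) h).trans (key g))
  exact (comp_perm_eq_iff.1 h').trans ((comp_perm_assoc _ _ _).trans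
    ((congrArg (g ≫ₓ ·) (perm_eq_one fun _ => rfl)).trans (comp_one _)))

/-- An equality of functions at pairwise distinct variables is an equality in `ZX`. Soundness of the
graph operations is deduced through this. -/
theorem ev_injective {n m : ℕ} {f g : ZX n m} {a : Fin n → Fin N} {b : Fin m → Fin N}
    (ha : Function.Injective a) (hb : Function.Injective b) (hab : ∀ i j, a i ≠ b j)
    (h : ev f a b = ev g a b) : f = g := by
  refine nm_injective (at_injective ?_ h)
  intro i j
  refine Fin.addCases (fun i => ?_) (fun i => ?_) i <;>
  refine Fin.addCases (fun j => ?_) (fun j => ?_) j <;>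
  simp only [Fin.addCases_left, Fin.addCases_right] <;> intro hij
  · rw [ha hij]
  · exact absurd hij (hab _ _)
  · exact absurd hij.symm (hab _ _)
  · rw [hb hij]

theorem nm_comp {n m k : ℕ} (f : ZX n m) (g : ZX m k) : nm (f ≫ₓ g) = (f ⊗ₓ one k) ≫ₓ nm g := by
  rw [nm, nm, tens_comp_one, assoc]

theorem ev_effect {n : ℕ} (f : ZX n 0) (a : Fin n → Fin N) (b : Fin 0 → Fin N) :
    ev f a b = at' f a := by
  have : nm f = f := (congrArg (· ≫ₓ _) (tens_unit f)).trans (comp_one _)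
  rw [ev, this]
  congr 1
  ext1 i
  exact Fin.addCases_left (m := n) (n := 0) i

/-- Inserting the trivial contraction of `v` with a cap turns the wires between `f` and `v` into
summed variables. These must be distinct and must not occur at the outer wires. -/
theorem at_comp {n m k : ℕ} (f : ZX n m) (v : ZX (m + k) 0) {a : Fin n → Fin N} {c : Fin k → Fin N}
    (b : Fin m → Fin N) (hb : Function.Injective b) (ha : ∀ i j, a i ≠ b j)
    (hc : ∀ i j, c i ≠ b j) : at' ((f ⊗ₓ one k) ≫ₓ v) (Fin.addCases a c) =
      Es (Finset.univ.image b) (ev f a b * at' v (Fin.addCases b c)) := by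
  have h := con_comp (cap m) (cup m) v f (one k)
  rw [one_tens_one, one_comp, con_cap, con_cup] at h
  rw [← h, at_sum_eq_Es _ _ hb, at_mul, at_at, at_at]
  · congr 2
    · rw [ev, nm]
      congr 1; ext1 i
      refine Fin.addCases (fun i => ?_) (fun i => ?_) i <;>
      simp only [Fin.addCases_left, Fin.addCases_right]
    · congr 1; ext1 i
      refine Fin.addCases (fun i => ?_) (fun i => ?_) i <;>
      simp only [Fin.addCases_left, Fin.addCases_right]
  · intro i j
    refine Fin.addCases (fun i => ?_) (fun i => ?_) i
    · rw [Fin.addCases_left]; exact ha i j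
    · rw [Fin.addCases_right]; exact hc i j

theorem ev_comp {n m k : ℕ} (f : ZX n m) (g : ZX m k) {a : Fin n → Fin N} {c : Fin k → Fin N}
    (b : Fin m → Fin N) (hb : Function.Injective b) (ha : ∀ i j, a i ≠ b j)
    (hc : ∀ i j, c i ≠ b j) :
    ev (f ≫ₓ g) a c = Es (Finset.univ.image b) (ev f a b * ev g b c) := by
  rw [ev, nm_comp, at_comp f (nm g) b hb ha hc]
  rfl

theorem ev_rep_comp {n m k : ℕ} {f : ZX n m} {ρ : Fin m → Fin n} (h : Rep f ρ) (g : ZX m k)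
    (a : Fin n → Fin N) (c : Fin k → Fin N) : ev (f ≫ₓ g) a c = ev g (fun i => a (ρ i)) c := by
  rw [ev, nm_comp, rep_comp_eq_at _ (h.tens (rep_one k)), at_at, ev]
  congr 1; ext1 i
  refine Fin.addCases (fun i => ?_) (fun i => ?_) i <;>
  simp only [Fin.addCases_left, Fin.addCases_right, id]

theorem ev_perm_comp {n m k : ℕ} (σ : Fin n ≃ Fin m) (g : ZX m k)
    (a : Fin n → Fin N) (c : Fin k → Fin N) :
    ev (perm σ ≫ₓ g) a c = ev g (fun i => a (σ.symm i)) c := ev_rep_comp (rep_perm σ) g a c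

theorem cap_add (m m' : ℕ) : cap (m + m') = perm (mid m m' m m') ≫ₓ (cap m ⊗ₓ cap m') := by
  rw [← at_id (cap (m + m')) (fun _ => rfl), at_cap, perm_comp_eq_at, at_tens, at_cap, at_cap,
    Fin.prod_univ_add, mid_symm]
  simp only [mid_1, mid_2, mid_3, mid_4]

theorem ev_tens {n m n' m' : ℕ} (f : ZX n m) (g : ZX n' m') (a : Fin (n + n') → Fin N)
    (b : Fin (m + m') → Fin N) :
    ev (f ⊗ₓ g) a b = ev f (fun i => a (Fin.castAdd n' i)) (fun i => b (Fin.castAdd m' i)) *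
      ev g (fun i => a (Fin.natAdd n i)) fun i => b (Fin.natAdd m i) := by
  rw [ev, nm, cap_add, ← one_tens_one, ← assoc, mid_natural, assoc, ← interchange, perm_comp_eq_at,
    at_at, at_tens, mid_symm]
  congr 1 <;> rw [ev, nm] <;> congr 1 <;> ext1 i <;>
  refine Fin.addCases (fun i => ?_) (fun i => ?_) i <;>
  simp only [mid_1, mid_2, mid_3, mid_4, Fin.addCases_left, Fin.addCases_right]

/-- The hypothesis says that `f` is the wiring `dl ρ` bent backwards, so composing with it renames
output variables, where precomposing with a wiring renames inputs. -/
theorem ev_comp_transpose {n m k : ℕ} {f : ZX m k} {ρ : Fin m → Fin k}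
    (hf : nm f = ∏ i, (dlt (Fin.castAdd k i) (Fin.natAdd m (ρ i)) : Fn (m + k)))
    (g : ZX n m) (a : Fin n → Fin N) (c : Fin k → Fin N) :
    ev (g ≫ₓ f) a c = ev g a fun i => c (ρ i) := by
  have h : nm f = (one m ⊗ₓ dl ρ) ≫ₓ cap m := by
    rw [hf, rep_comp_eq_at _ ((rep_one m).tens (rep_dl ρ)), at_cap]
    simp only [Fin.addCases_left, Fin.addCases_right, id]
  rw [ev, nm_comp, h, ← assoc, ← tens_eq_left, tens_eq_right, assoc,
    rep_comp_eq_at _ ((rep_one n).tens (rep_dl ρ)), at_at, ev, nm]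
  congr 1; ext1 i
  refine Fin.addCases (fun i => ?_) (fun i => ?_) i <;>
  simp only [Fin.addCases_left, Fin.addCases_right, id]

end Fn

namespace Fn

open ZX
open PropTerm (permSum permSum_castAdd permSum_natAdd permSum_symm)

variable {N : ℕ}

/-! ### Equality of variables and Z-spiders -/

theorem one_tens_comp_Z (a c d : ℕ) (α β : Real.Angle) :
    (one c ⊗ₓ Z a 1 α) ≫ₓ Z (c + 1) d β = Z (c + a) d (α + β) := by
  rw [← perm_Z β (finAddFlip (m := c) (n := 1)), ← assoc, swap_natural, assoc, tens_one_comp_Z,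
    perm_Z]

theorem at_one_tens_comp {k j : ℕ} (v : ZX j 0) (t : ZX k 0) (ρ : Fin (k + j) → Fin N) :
    at' ((one k ⊗ₓ v : ZX (k + j) (k + 0)) ≫ₓ t) ρ =
      at' t (fun i => ρ (Fin.castAdd j i)) * at' v (fun i => ρ (Fin.natAdd k i)) := by
  have h := tens_eq_right t v
  rw [tens_unit] at h
  rw [← at_tens]
  exact congrArg (at' · ρ) h.symm

/-- By fusion, the merging spider copies its first input and compares one of the copies with its
second input. -/
theorem at_merge {k : ℕ} (t : ZX (k + 1) 0) (ρ : Fin k → Fin N) (x y : Fin N) :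
    at' ((one k ⊗ₓ Z (1 + 1) 1 0) ≫ₓ t) (Fin.addCases ρ ![x, y]) =
      at' t (Fin.addCases ρ fun _ => x) * dlt x y := by
  have h1 : Z (1 + 1) 1 0 = (Z 1 (1 + 1) 0 ⊗ₓ one 1) ≫ₓ perm (assocP 1 1 1) ≫ₓ
      (one 1 ⊗ₓ Z (1 + 1) 0 0 : ZX (1 + (1 + 1)) (1 + 0)) := by
    rw [fusion, add_zero (0 : Real.Angle)]
  have h2 := tens_assoc_symm (one k) (one 1) (Z (1 + 1) 0 0)
  have h3 : one k ⊗ₓ (one 1 ⊗ₓ Z (1 + 1) 0 0 : ZX (1 + (1 + 1)) (1 + 0)) =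
      perm (assocP k 1 (1 + 1)).symm ≫ₓ (one (k + 1) ⊗ₓ Z (1 + 1) 0 0 :
        ZX (k + 1 + (1 + 1)) (k + 1 + 0)) := by
    rw [one_tens_one] at h2
    exact h2.trans (comp_one _)
  rw [h1, one_tens_comp, assoc, h3, assoc, rep_comp_eq_at _ ((rep_one k).tens
    (((rep_Z (1 + 1)).tens (rep_one 1)).comp (rep_perm _))), at_at, perm_comp_eq_at, at_at,
    at_one_tens_comp, dlt]
  congr 2 <;> ext1 i
  · refine Fin.addCases (fun i => ?_) (fun i => ?_) i
    · simp only [Equiv.symm_symm, assocP_1, Fin.addCases_left, id]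
    · obtain rfl := Subsingleton.elim i 0
      simp only [Equiv.symm_symm, assocP_2, Fin.addCases_left, Fin.addCases_right, id,
        Function.comp, assocP_symm_1]
      rfl
  · have h0 : (assocP k 1 (1 + 1)).symm.symm (Fin.natAdd (k + 1) i) =
        Fin.natAdd k (Fin.natAdd 1 i) := assocP_3 i
    rw [h0, Fin.addCases_right]
    fin_cases i
    · exact (Fin.addCases_right (m := k) (n := 1 + 1) (motive := fun _ => Fin N) (left := ρ)
        (right := ![x, y]) 0)
    · exact (Fin.addCases_right (m := k) (n := 1 + 1) (motive := fun _ => Fin N) (left := ρ)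
        (right := ![x, y]) 1)

/-- The merging spider is symmetric in its inputs, so the common value can be read from either. -/
theorem dlt_mul_at_addCases {k : ℕ} (t : ZX (k + 1) 0) (ρ : Fin k → Fin N) (x y : Fin N) :
    dlt x y * at' t (Fin.addCases ρ fun _ => x) = dlt x y * at' t (Fin.addCases ρ fun _ => y) := by
  have h := perm_comp_eq_at ((one k ⊗ₓ Z (1 + 1) 1 0) ≫ₓ t)
    (permSum (Equiv.refl (Fin k)) (Equiv.swap (0 : Fin (1 + 1)) 1))
  rw [← perm_tens, perm_refl, ← assoc, ← interchange, one_comp, perm_Z] at h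
  have h' := congrArg (at' · (Fin.addCases ρ ![x, y])) h
  beta_reduce at h'
  rw [at_at, at_merge, mul_comm] at h'
  rw [h', dlt_comm, mul_comm, ← at_merge]
  congr 1; ext1 i
  rw [permSum_symm]
  refine Fin.addCases (fun i => ?_) (fun i => ?_) i
  · simp only [permSum_castAdd, Fin.addCases_left]; rfl
  · simp only [permSum_natAdd, Fin.addCases_right]
    fin_cases i <;> rfl

/-- Substitute the variable `y` for `x`. -/
noncomputable def sub (x y : Fin N) (f : Fn N) : Fn N := at' f fun i => if i = x then y else i

/-- All occurrences of `x` are first gathered in one extra variable, to which the symmetry of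
merging applies. -/
theorem dlt_mul (x y : Fin N) (f : Fn N) : dlt x y * f = dlt x y * sub x y f := by
  have h := dlt_mul_at_addCases
    (at' f fun i : Fin N => if i = x then Fin.natAdd N (0 : Fin 1) else Fin.castAdd 1 i) id x y
  rw [at_at, at_at, at_id] at h
  · rw [h, sub]
    congr 2; ext1 i
    split_ifs
    · rw [Fin.addCases_right]
    · rw [Fin.addCases_left]; rfl
  · intro i
    split_ifs with hi
    · rw [Fin.addCases_right, hi]
    · rw [Fin.addCases_left]; rfl

theorem sub_at {n : ℕ} (t : ZX n 0) (ρ : Fin n → Fin N) (x y : Fin N) :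
    sub x y (at' t ρ) = at' t fun i => if ρ i = x then y else ρ i := by
  rw [sub, at_at]

theorem E_dlt {x y : Fin N} (h : x ≠ y) : E x (dlt y x) = 1 := by
  have h1 := at_sum_one_eq_E (n := 1) (Z (1 + 1) 0 0) (ρ := fun _ => y) (x := x) fun _ => h.symm
  have h2 : sum (n := 1) 1 (Z (1 + 1) 0 0) = 1 := by
    rw [sum, plus_one, one_tens_comp_Z, one_def, dsc, dsc, unit_tens, add_zero (0 : Real.Angle)]
    exact ((comp_one _).trans (one_comp _)).symm
  rw [h2, at_one] at h1
  rw [h1, dlt]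
  congr 2; ext1 i
  fin_cases i <;> rfl

/-- The sum over `x` has a single surviving term, `x = y`. This is the main device for eliminating
variables. -/
theorem E_dlt_mul {x y : Fin N} (h : x ≠ y) (f : Fn N) : E x (dlt x y * f) = sub x y f := by
  have h1 : Indep x (sub x y f) := indep_at _ fun i => by
    split_ifs with hi
    exacts [h.symm, hi]
  rw [dlt_mul, h1.E_mul', dlt_comm, E_dlt h, one_mul]

/-- The phase function. -/
noncomputable def zf (α : Real.Angle) (x : Fin N) : Fn N := at' (Z 1 0 α) fun _ => x

theorem zf_zero (x : Fin N) : zf 0 x = 1 := by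
  rw [zf, ← at_one (n := 1), one_def, dsc, dsc, unit_tens]
  congr 1
  exact ((comp_one _).trans (one_comp _)).symm

theorem zf_mul (α β : Real.Angle) (x : Fin N) : zf α x * zf β x = zf (α + β) x := by
  rw [zf, zf, zf, ← at_mul, mul_def, cp_one, tens_eq_left, ← assoc, Z_comp_tens_one,
    Z_comp_one_tens, zero_add (α : Real.Angle)]

/-- A spider with many legs is fused from one phase and successive merges, so each further leg
contributes one equality with `x`. -/
theorem at_Z {n : ℕ} (α : Real.Angle) (ρ : Fin n → Fin N) (x : Fin N) :
    at' (Z (n + 1) 0 α) (Fin.addCases ρ fun _ => x) = zf α x * ∏ i, dlt (ρ i) x := by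
  induction n with
  | zero => 
    rw [Finset.univ_eq_empty, Finset.prod_empty, mul_one, zf]
    congr 1; ext1 i
    refine Fin.addCases (m := 0) (n := 1) (fun i => i.elim0) (fun i => ?_) i
    exact Fin.addCases_right (m := 0) (n := 1) (motive := fun _ => Fin N) i
  | succ k ih =>
    rw [Fin.prod_univ_castSucc, ← mul_assoc, ← ih, mul_comm, dlt_comm, dlt_mul_at_addCases, mul_comm, dlt_comm, ← at_merge, one_tens_comp_Z]
    rw [zero_add]
    congr 1; ext1 i
    refine Fin.addCases (m := k) (n := 1 + 1) (fun i => ?_) (fun i => ?_) i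
    · rw [Fin.addCases_left]
      exact (Fin.addCases_left (m := k + 1) (n := 1) (motive := fun _ => Fin N) (i.castSucc))
    · rw [Fin.addCases_right]
      fin_cases i
      · exact (Fin.addCases_left (m := k + 1) (n := 1) (motive := fun _ => Fin N) (Fin.last k))
      · exact (Fin.addCases_right (m := k + 1) (n := 1) (motive := fun _ => Fin N) 0)

theorem nm_Z_one (n : ℕ) (α : Real.Angle) : nm (Z n 1 α) = Z (n + 1) 0 α := by
  rw [nm, cap_one, tens_one_comp_Z, add_zero α]

theorem ev_Z_one {n : ℕ} (α : Real.Angle) (a : Fin n → Fin N) (x : Fin N) :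
    ev (Z n 1 α) a (fun _ => x) = zf α x * ∏ i, dlt (a i) x := by
  rw [ev, nm_Z_one, at_Z]

theorem ev_one {n : ℕ} (a b : Fin n → Fin N) : ev (one n) a b = ∏ i, dlt (a i) (b i) := by
  rw [ev, nm, one_tens_one, one_comp, at_cap]
  simp only [Fin.addCases_left, Fin.addCases_right]

theorem ev_rep {n m : ℕ} {f : ZX n m} {ρ : Fin m → Fin n} (h : Rep f ρ) (a : Fin n → Fin N)
    (b : Fin m → Fin N) : ev f a b = ∏ i, dlt (a (ρ i)) (b i) := by
  rw [← comp_one f, ev_rep_comp h, ev_one]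

theorem ev_Z_copy {n : ℕ} (x : Fin N) (b : Fin n → Fin N) :
    ev (Z 1 n 0) (fun _ => x) b = ∏ i, dlt x (b i) := ev_rep (rep_Z n) _ _

theorem ev_comp_one {n k : ℕ} (f : ZX n 1) (g : ZX 1 k) {a : Fin n → Fin N} {c : Fin k → Fin N}
    {y : Fin N} (ha : ∀ i, a i ≠ y) (hc : ∀ i, c i ≠ y) :
    ev (f ≫ₓ g) a c = E y (ev f a (fun _ => y) * ev g (fun _ => y) c) := by
  rw [ev_comp f g (fun _ => y) (fun i j _ => Subsingleton.elim i j) (fun i _ => ha i)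
    (fun i _ => hc i), show Finset.univ.image (fun _ : Fin 1 => y) = insert y ∅ from by
      ext; simp [eq_comm], Es_insert (Finset.notMem_empty _), Es_empty]

theorem ev_comp_perm {n m k : ℕ} (g : ZX n m) (σ : Fin m ≃ Fin k) (a : Fin n → Fin N)
    (c : Fin k → Fin N) : ev (g ≫ₓ perm σ) a c = ev g a fun i => c (σ i) := by
  refine ev_comp_transpose ?_ g a c
  have h := ev_rep (rep_perm σ) (Fin.castAdd k) (Fin.natAdd m)
  rw [ev, at_id _ (Fin.forall_addCases.2 ⟨fun i => Fin.addCases_left i,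
    fun i => Fin.addCases_right i⟩)] at h
  rw [h]
  exact (Fintype.prod_equiv σ _ _ fun i => by rw [Equiv.symm_apply_apply]).symm

theorem nm_eq_ev {n m : ℕ} (f : ZX n m) : nm f = ev f (Fin.castAdd m) (Fin.natAdd n) := by
  rw [ev, at_id _ (Fin.forall_addCases.2 ⟨fun i => Fin.addCases_left i,
    fun i => Fin.addCases_right i⟩)]

/-! ### The Hadamard function -/

/-- The Hadamard gate as a function. -/
noncomputable def hf (x y : Fin N) : Fn N := ev H (fun _ => x) fun _ => y

/-- Symmetry of the Hadamard gate is the sliding of `H` along the cap. -/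
theorem hf_comm (x y : Fin N) : hf x y = hf y x := by
  have h1 : nm H = perm finAddFlip ≫ₓ nm H := by
    conv_lhs => rw [nm, H_slide, cap_one, ← perm_Z 0 (finAddFlip (m := 1) (n := 1)), ← assoc,
      swap_natural, assoc, ← cap_one]
    rfl
  rw [hf, ev, h1, perm_comp_eq_at, at_at, hf, ev]
  congr 1; ext1 i
  fin_cases i <;> rfl

theorem indep_ev {n m : ℕ} (f : ZX n m) {a : Fin n → Fin N} {b : Fin m → Fin N} {x : Fin N}
    (ha : ∀ i, a i ≠ x) (hb : ∀ i, b i ≠ x) : Indep x (ev f a b) :=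
  indep_at _ (Fin.forall_addCases.2 ⟨fun i => by rw [Fin.addCases_left]; exact ha i,
    fun i => by rw [Fin.addCases_right]; exact hb i⟩)

theorem indep_hf {x a b : Fin N} (ha : a ≠ x) (hb : b ≠ x) : Indep x (hf a b) :=
  indep_ev _ (fun _ => ha) fun _ => hb

theorem indep_zf {α : Real.Angle} {x a : Fin N} (ha : a ≠ x) : Indep x (zf α a) :=
  indep_at _ fun _ => ha

theorem sub_ev {n m : ℕ} (f : ZX n m) (a : Fin n → Fin N) (b : Fin m → Fin N) (x y : Fin N) :
    sub x y (ev f a b) =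
      ev f (fun i => if a i = x then y else a i) (fun i => if b i = x then y else b i) := by
  rw [ev, sub_at, ev]
  congr 1; ext1 i
  refine Fin.addCases (fun i => ?_) (fun i => ?_) i <;>
  simp only [Fin.addCases_left, Fin.addCases_right]

theorem sub_mul (x y : Fin N) (f g : Fn N) : sub x y (f * g) = sub x y f * sub x y g := at_mul ..

theorem sub_hf (x y a b : Fin N) :
    sub x y (hf a b) = hf (if a = x then y else a) (if b = x then y else b) := sub_ev ..

theorem sub_zf (x y a : Fin N) (α : Real.Angle) :
    sub x y (zf α a) = zf α (if a = x then y else a) := sub_at ..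

theorem E_hf_mul_hf {x y z : Fin N} (hx : x ≠ y) (hz : z ≠ y) :
    E y (hf x y * hf y z) = dlt x z := by
  have h := congrArg (ev · (fun _ => x) fun _ => z) H_comp_H
  beta_reduce at h
  rw [ev_comp_one H H (fun _ => hx) (fun _ => hz), ev_one, Fin.prod_univ_one] at h
  exact h

end Fn

namespace Fn

open ZX
open PropTerm (permSum permSum_castAdd permSum_natAdd permSum_symm)

variable {N : ℕ}

/-! ### Equations of the ZX-calculus as equations of functions -/

/-- An identity may be checked after adjoining `k` fresh variables. This supplies the bound variable
wherever a composite has to be expanded as a sum. -/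
theorem eq_of_castAdd (k : ℕ) {f g : Fn N} (h : at' f (Fin.castAdd k) = at' g (Fin.castAdd k)) :
    f = g := at_injective (Fin.castAdd_injective N k) h

theorem at_ev {n m M : ℕ} (f : ZX n m) (a : Fin n → Fin N) (b : Fin m → Fin N)
    (ρ : Fin N → Fin M) : at' (ev f a b) ρ = ev f (fun i => ρ (a i)) fun i => ρ (b i) := by
  rw [ev, at_at, ev]
  congr 1; ext1 i
  refine Fin.addCases (fun i => ?_) (fun i => ?_) i <;>
  simp only [Fin.addCases_left, Fin.addCases_right]

theorem at_hf {M : ℕ} (x y : Fin N) (ρ : Fin N → Fin M) : at' (hf x y) ρ = hf (ρ x) (ρ y) :=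
  at_ev ..

theorem at_zf {M : ℕ} (α : Real.Angle) (x : Fin N) (ρ : Fin N → Fin M) :
    at' (zf α x) ρ = zf α (ρ x) := at_at ..

theorem castAdd_ne_natAdd {k : ℕ} (i : Fin N) (j : Fin k) : Fin.castAdd k i ≠ Fin.natAdd N j :=
    fun h => by
  have := congrArg Fin.val h
  simp only [Fin.val_castAdd, Fin.val_natAdd] at this
  omega

theorem castAdd_ne (i : Fin N) : Fin.castAdd 1 i ≠ Fin.natAdd N (0 : Fin 1) :=
  castAdd_ne_natAdd i 0

theorem ev_Z_comp {k : ℕ} (α : Real.Angle) (g : ZX 1 k) (x : Fin N) (c : Fin k → Fin N) :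
    ev (Z 1 1 α ≫ₓ g) (fun _ => x) c = zf α x * ev g (fun _ => x) c := by
  refine eq_of_castAdd 1 ?_
  rw [at_mul, at_ev, at_ev, at_zf, ev_comp_one _ _ (y := Fin.natAdd N 0) (fun _ => castAdd_ne x)
    (fun i => castAdd_ne _), ev_Z_one, Fin.prod_univ_one, mul_comm (zf _ _), dlt_comm, mul_assoc,
    E_dlt_mul (castAdd_ne x).symm, sub_mul, sub_zf, sub_ev, if_pos rfl]
  congr 2; ext1 i
  rw [if_neg (castAdd_ne _)]

theorem ev_comp_Z {k : ℕ} (α : Real.Angle) (g : ZX k 1) (a : Fin k → Fin N) (x : Fin N) :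
    ev (g ≫ₓ Z 1 1 α) a (fun _ => x) = zf α x * ev g a (fun _ => x) := by
  refine eq_of_castAdd 1 ?_
  rw [at_mul, at_ev, at_ev, at_zf, ev_comp_one _ _ (y := Fin.natAdd N 0) (fun _ => castAdd_ne _)
    (fun i => castAdd_ne x), ev_Z_one, Fin.prod_univ_one, mul_left_comm, mul_comm _ (dlt _ _),
    (indep_zf (castAdd_ne x)).E_mul, E_dlt_mul (castAdd_ne x).symm, sub_ev]
  congr 2
  · ext1 i
    rw [if_neg (castAdd_ne _)]
  · ext1 i
    rw [if_pos rfl]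

/-- The X-effect as a function. -/
noncomputable def xf (α : Real.Angle) (x : Fin N) : Fn N := at' (X 1 0 α) fun _ => x

theorem xf_eq {α : Real.Angle} {x y : Fin N} (h : x ≠ y) : xf α x = E y (hf x y * zf α y) := by
  rw [xf, X_one_zero, ← ev_effect _ _ Fin.elim0, ev_comp_one _ _ (fun _ => h) (fun i => i.elim0),
    ev_effect]
  rfl

theorem E_hf_mul_xf {α : Real.Angle} {x y : Fin N} (h : x ≠ y) :
    E y (hf x y * xf α y) = zf α x := by
  rw [zf, show Z 1 0 α = H ≫ₓ X 1 0 α by rw [X_one_zero, ← assoc, H_comp_H, one_comp],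
    ← ev_effect _ _ Fin.elim0, ev_comp_one _ _ (fun _ => h) (fun i => i.elim0), ev_effect]
  rfl

theorem at_xf {M : ℕ} (α : Real.Angle) (x : Fin N) (ρ : Fin N → Fin M) :
    at' (xf α x) ρ = xf α (ρ x) := at_at ..

theorem indep_xf {α : Real.Angle} {x a : Fin N} (ha : a ≠ x) : Indep x (xf α a) :=
  indep_at _ fun _ => ha

theorem sub_xf (x y a : Fin N) (α : Real.Angle) :
    sub x y (xf α a) = xf α (if a = x then y else a) := sub_at ..

theorem ev_X_zero_one (α : Real.Angle) (a : Fin 0 → Fin N) (x : Fin N) :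
    ev (X 0 1 α) a (fun _ => x) = xf α x := by
  refine eq_of_castAdd 1 ?_
  rw [at_ev, at_xf, X_zero_one, ev_comp_one _ _ (y := Fin.natAdd N 0) (fun i => i.elim0)
    (fun i => castAdd_ne x), ev_Z_one, Finset.univ_eq_empty, Finset.prod_empty, mul_one,
    xf_eq (castAdd_ne x), hf_comm, mul_comm]
  rfl

/-! The copy rule. -/

theorem copy (a : Fin 2) (n : ℕ) (β : Real.Angle) : X 0 1 ((a : ℕ) • (π : Real.Angle)) ≫ₓ Z 1 n β =
    ZX.mk (PropTerm.copies (ZXTerm.X 0 1 ((a : ℕ) • (π : Real.Angle))) n) :=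
  mk_rule (.copy n a β)

theorem copies_one (t : ZXTerm 0 1) : ZX.mk (PropTerm.copies t 1) = ZX.mk t := by
  show one 0 ⊗ₓ ZX.mk t = ZX.mk t
  rw [unit_tens]
  exact (comp_one _).trans (one_comp _)

theorem copies_two (t : ZXTerm 0 1) :
    ZX.mk (PropTerm.copies t 2) = (ZX.mk t ⊗ₓ ZX.mk t : ZX (0 + 0) (1 + 1)) := by
  show ZX.mk (PropTerm.copies t 1) ⊗ₓ ZX.mk t = _
  rw [copies_one]

/-- The copy rule without outputs: the indicator of `x = a` sums to `1`. -/
theorem E_xf (a : Fin 2) (x : Fin N) : E x (xf ((a : ℕ) • (π : Real.Angle)) x) = 1 := by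
  have h := congrArg (ev · (Fin.elim0 : Fin 0 → Fin N) Fin.elim0) (copy a 0 0)
  beta_reduce at h
  rw [ev_comp_one _ _ (y := x) (fun i => i.elim0) (fun i => i.elim0), ev_X_zero_one, ev_effect] at h
  have h2 : at' (Z 1 0 0) (fun _ => x) = 1 := zf_zero x
  rw [h2, mul_one] at h
  rw [h]
  exact (ev_one _ _).trans (by rw [Finset.univ_eq_empty, Finset.prod_empty])

/-- The copy rule with one output. At a fixed value of `x` a phase is a scalar, and the copy rule
drops scalars. -/
theorem xf_mul_zf (a : Fin 2) (β : Real.Angle) (x : Fin N) :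
    xf ((a : ℕ) • (π : Real.Angle)) x * zf β x = xf ((a : ℕ) • (π : Real.Angle)) x := by
  have h := congrArg (ev · (Fin.elim0 : Fin 0 → Fin N) fun _ => x) ((copy a 1 β).trans (copies_one _))
  beta_reduce at h
  rw [ev_comp_Z, ev_X_zero_one, mul_comm] at h
  exact h.trans (ev_X_zero_one _ _ x)

/-- The copy rule with two outputs: if `x = a` and `x = y`, then both equal `a`. -/
theorem xf_mul_dlt (a : Fin 2) (x y : Fin N) :
    xf ((a : ℕ) • (π : Real.Angle)) x * dlt x y =
      xf ((a : ℕ) • (π : Real.Angle)) x * xf ((a : ℕ) • (π : Real.Angle)) y := by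
  refine eq_of_castAdd 1 ?_
  rw [at_mul, at_mul, at_xf, at_xf, at_dlt]
  generalize hx : Fin.castAdd 1 x = x'
  generalize hy : Fin.castAdd 1 y = y'
  have hx' := hx ▸ castAdd_ne x
  have hy' := hy ▸ castAdd_ne y
  have h := congrArg (ev · (Fin.elim0 : Fin 0 → Fin (N + 1)) ![x', y'])
    ((copy a (1 + 1) 0).trans (copies_two _))
  beta_reduce at h
  have e1 := ev_tens (ZX.mk (ZXTerm.X 0 1 ((a : ℕ) • (π : Real.Angle))))
    (ZX.mk (ZXTerm.X 0 1 ((a : ℕ) • (π : Real.Angle)))) (Fin.elim0 : Fin 0 → Fin (N + 1)) ![x', y']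
  have e2 := (ev_X_zero_one ((a : ℕ) • (π : Real.Angle)) (Fin.elim0 : Fin 0 → Fin (N + 1)) x')
  have e3 := (ev_X_zero_one ((a : ℕ) • (π : Real.Angle)) (Fin.elim0 : Fin 0 → Fin (N + 1)) y')
  have h' := h.trans (e1.trans (congrArg₂ (· * ·) e2 e3))
  rw [ev_comp_one _ _ (y := Fin.natAdd N 0) (fun i => i.elim0) (Fin.forall_fin_two.2 ⟨hx', hy'⟩),
    ev_X_zero_one, ev_Z_copy, Fin.prod_univ_two, Matrix.cons_val_zero, Matrix.cons_val_one,
    mul_left_comm, E_dlt_mul hx'.symm, sub_mul, sub_xf, if_pos rfl, dlt, sub_at] at h'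
  rw [← h', dlt]
  congr 2; ext1 i
  fin_cases i
  · exact (if_pos rfl).symm
  · exact (if_neg hy').symm

/-- At `x = a` the sign `(-1)^(xv)` is the phase `aπ` on `v`. In the proof that phase is written as
a Hadamard sum of the indicator, to which `xf_mul_dlt` applies. -/
theorem xf_mul_hf (a : Fin 2) (x v : Fin N) :
    xf ((a : ℕ) • (π : Real.Angle)) x * hf x v =
      xf ((a : ℕ) • (π : Real.Angle)) x * zf ((a : ℕ) • (π : Real.Angle)) v := by
  refine eq_of_castAdd 1 ?_
  rw [at_mul, at_mul, at_xf, at_hf, at_zf]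
  have hx' := castAdd_ne x
  have hv' := castAdd_ne v
  rw [← E_hf_mul_xf hv', ← (indep_xf hx').E_mul, mul_left_comm, ← xf_mul_dlt, mul_left_comm,
    (indep_xf hx').E_mul, mul_comm (hf _ _), dlt_comm, E_dlt_mul hx'.symm, sub_hf, if_neg hv',
    if_pos rfl, hf_comm]

/-! The bialgebra law. -/

theorem ev_power_H : (n : ℕ) → (a b : Fin n → Fin N) →
    ev (ZX.mk (PropTerm.power ZXTerm.H n)) a b = ∏ i, hf (a i) (b i)
  | 0, a, b => (ev_one a b).trans (by rw [Finset.univ_eq_empty, Finset.prod_empty,Finset.prod_empty])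
  | n + 1, a, b => by
    have h : ev (ZX.mk (PropTerm.power ZXTerm.H n) ⊗ₓ H) a b = _ := ev_tens _ _ _ _
    rw [Fin.prod_univ_castSucc]
    exact h.trans (congrArg₂ (· * ·) (ev_power_H n _ _) rfl)

/-- The parity function. -/
noncomputable def xor (a b c : Fin N) : Fn N := ev (X 2 1 0) ![a, b] fun _ => c

theorem at_xor {M : ℕ} (a b c : Fin N) (ρ : Fin N → Fin M) :
    at' (xor a b c) ρ = xor (ρ a) (ρ b) (ρ c) := by
  rw [xor, at_ev, xor]
  congr 1; ext1 i
  fin_cases i <;> rfl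

theorem indep_xor {a b c x : Fin N} (ha : a ≠ x) (hb : b ≠ x) (hc : c ≠ x) :
    Indep x (xor a b c) := indep_ev _ (Fin.forall_fin_two.2 ⟨ha, hb⟩) fun _ => hc

theorem sub_xor {a b c x y : Fin N} (ha : a ≠ x) (hb : b ≠ x) :
    sub x y (xor a b c) = xor a b (if c = x then y else c) := by
  rw [xor, sub_ev, xor]
  congr 1; ext1 i
  fin_cases i
  exacts [if_neg ha, if_neg hb]

theorem X_two_one : X 2 1 0 = ZX.mk (PropTerm.power ZXTerm.H 2) ≫ₓ Z 2 1 0 ≫ₓ H := by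
  have h : ZX.mk _ = ZX.mk _ := mk_rule (.colourChange 2 1 0)
  rw [mk_comp, mk_comp, mk_power_H_one] at h
  exact h.symm

theorem ev_power_H_comp_Z (a b y : Fin N) :
    ev (ZX.mk (PropTerm.power ZXTerm.H 2) ≫ₓ Z 2 1 0) ![a, b] (fun _ => y) = hf a y * hf b y := by
  rw [ev_comp_transpose (ρ := fun _ => 0), ev_power_H, Fin.prod_univ_two]
  · rfl
  · rw [nm_eq_ev]
    refine (ev_Z_one (N := 2 + 1) (n := 2) 0 _ (Fin.natAdd 2 0)).trans ?_
    rw [zf_zero, one_mul]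

theorem xor_eq {a b c y : Fin N} (ha : a ≠ y) (hb : b ≠ y) (hc : c ≠ y) :
    xor a b c = E y (hf a y * hf b y * hf y c) := by
  rw [xor, X_two_one, ev_comp_one _ _ (Fin.forall_fin_two.2 ⟨ha, hb⟩) (fun _ => hc),
    ev_power_H_comp_Z]
  rfl

theorem E_xor_mul_hf {a b c w : Fin N} (ha : a ≠ c) (hb : b ≠ c) (hw : w ≠ c) :
    E c (xor a b c * hf c w) = hf a w * hf b w := by
  rw [← ev_power_H_comp_Z, ← comp_one (_ ≫ₓ _), ← H_comp_H, ← assoc, ← X_two_one,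
    ev_comp_one _ _ (Fin.forall_fin_two.2 ⟨ha, hb⟩) (fun _ => hw)]
  rfl

theorem xor_comm (a b c : Fin N) : xor a b c = xor c b a := by
  refine eq_of_castAdd 1 ?_
  rw [at_xor, at_xor, xor_eq (castAdd_ne a) (castAdd_ne b) (castAdd_ne c),
    xor_eq (castAdd_ne c) (castAdd_ne b) (castAdd_ne a), hf_comm _ (Fin.castAdd 1 c), mul_comm,
    hf_comm _ (Fin.castAdd 1 a), ← mul_assoc, mul_right_comm]

/-- The bialgebra law read as functionality of parity: two variables that equal `a ⊕ b` are equal.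
-/
theorem xor_mul_xor (a b c c' : Fin N) : xor a b c * xor a b c' = dlt c c' * xor a b c := by
  refine eq_of_castAdd 1 ?_
  rw [at_mul, at_mul, at_xor, at_xor, at_dlt]
  have ha' := castAdd_ne a
  have hb' := castAdd_ne b
  have hc' := castAdd_ne c
  have hd' := castAdd_ne c'
  generalize Fin.castAdd 1 a = a at *
  generalize Fin.castAdd 1 b = b at *
  generalize Fin.castAdd 1 c = c at *
  generalize Fin.castAdd 1 c' = c' at *
  have h : X 2 1 0 ≫ₓ Z 1 2 0 =
    (Z 1 2 0 ⊗ₓ Z 1 2 0) ≫ₓ perm (Equiv.swap (1 : Fin 4) 2) ≫ₓ (X 2 1 0 ⊗ₓ X 2 1 0) :=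
    mk_rule .bialgebra
  have h' := congrArg (ev · ![a, b] ![c, c']) h
  beta_reduce at h'
  rw [ev_comp_one _ _ (y := Fin.natAdd N 0) (Fin.forall_fin_two.2 ⟨ha', hb'⟩)
    (Fin.forall_fin_two.2 ⟨hc', hd'⟩), ev_Z_copy, Fin.prod_univ_two, Matrix.cons_val_zero,
    Matrix.cons_val_one, mul_left_comm, E_dlt_mul hc'.symm, ← xor, sub_mul, sub_xor ha' hb',
    if_pos rfl, dlt, sub_at] at h'
  have e := (ev_rep_comp (((rep_Z 2).tens (rep_Z 2)).comp (rep_perm (Equiv.swap (1 : Fin 4) 2)))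
    (X 2 1 0 ⊗ₓ X 2 1 0) ![a, b] ![c, c']).trans (ev_tens _ _ _ _)
  refine Eq.trans ?_ ((h'.trans e).symm.trans ?_)
  · rw [xor, xor]
    congr 2 <;> ext1 i <;> fin_cases i <;> rfl
  · rw [mul_comm, dlt]
    congr 2; ext1 i
    fin_cases i
    · exact if_pos rfl
    · exact if_neg hd'

/-- On `c = a ⊕ b` the character `(-1)^(cw)` is the product of those of `a` and `b`. `E_xor_mul_hf`
says this with `c` summed out, and `xor_mul_xor` removes the sum. -/
theorem xor_mul_hf (a b c w : Fin N) : xor a b c * hf c w = xor a b c * (hf a w * hf b w) := by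
  refine eq_of_castAdd 1 ?_
  rw [at_mul, at_mul, at_mul, at_xor, at_hf, at_hf, at_hf]
  have ha' := castAdd_ne a
  have hb' := castAdd_ne b
  have hc' := castAdd_ne c
  have hw' := castAdd_ne w
  rw [← E_xor_mul_hf ha' hb' hw', ← (indep_xor ha' hb' hc').E_mul, ← mul_assoc, xor_mul_xor,
    mul_assoc, dlt_comm, E_dlt_mul hc'.symm, sub_mul, sub_hf, if_pos rfl, if_neg hw', sub_xor ha' hb',
    if_neg hc']

theorem E_hf_eq_xf {x y : Fin N} (h : x ≠ y) : E y (hf x y) = xf 0 x := by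
  simpa only [zf_zero, mul_one] using (xf_eq (α := 0) h).symm

theorem E_xf_zero (x : Fin N) : E x (xf 0 x) = 1 := by
  simpa using E_xf 0 x

theorem xf_zero_mul_hf (x v : Fin N) : xf 0 x * hf x v = xf 0 x := by
  simpa [zf_zero] using xf_mul_hf 0 x v

theorem xf_zero_mul_zf (β : Real.Angle) (x : Fin N) : xf 0 x * zf β x = xf 0 x := by
  simpa using xf_mul_zf 0 β x

/-- Exactly one `c` has the given parity. With the parity written as a Hadamard sum over `y`,
summing `c` forces `y = 0`, where the other signs disappear. -/
theorem E_xor {a b c y : Fin N} (ha : a ≠ c) (hb : b ≠ c) (hay : a ≠ y) (hby : b ≠ y)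
    (hcy : c ≠ y) : E c (xor a b c) = 1 := by
  rw [xor_eq hay hby hcy, E_comm, ← E_xf_zero y]
  congr 1
  rw [((indep_hf ha hcy.symm).mul (indep_hf hb hcy.symm)).E_mul, E_hf_eq_xf hcy.symm, mul_comm,
    hf_comm, ← mul_assoc, xf_zero_mul_hf, hf_comm, xf_zero_mul_hf]

/-- The Hopf law. -/
theorem hf_mul_self (x y : Fin N) : hf x y * hf x y = 1 := by
  refine eq_of_castAdd 3 ?_
  rw [at_mul, at_hf, at_one]
  have hx0 := castAdd_ne_natAdd x (0 : Fin 3)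
  have hx1 := castAdd_ne_natAdd x (1 : Fin 3)
  have hx2 := castAdd_ne_natAdd x (2 : Fin 3)
  have hy0 := castAdd_ne_natAdd y (0 : Fin 3)
  have hy1 := castAdd_ne_natAdd y (1 : Fin 3)
  have hn {i j : Fin 3} (h : i ≠ j) : Fin.natAdd N i ≠ Fin.natAdd N j :=
    fun h' => h (Fin.natAdd_injective 3 N h')
  have h1 := hn (i := 0) (j := 1) (by decide)
  have h2 := hn (i := 0) (j := 2) (by decide)
  have h3 := hn (i := 1) (j := 2) (by decide)
  generalize Fin.natAdd N (0 : Fin 3) = a at *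
  generalize Fin.natAdd N (1 : Fin 3) = c at *
  generalize Fin.natAdd N (2 : Fin 3) = d at *
  generalize Fin.castAdd 3 x = x at *
  generalize Fin.castAdd 3 y = y at *
  -- Since `c = a ⊕ x`, the sign `hf a y * hf x y` is `hf c y`; since also `a = c ⊕ x`, multiplying
  -- once more by `hf x y` returns `hf a y`. The variables `c` and `a` are auxiliary: the first is
  -- then summed out, the second is set to `0` by `xf 0 a` and summed out.
  have key : xor a x c * hf a y = xor a x c * (hf a y * (hf x y * hf x y)) := by
    rw [← mul_assoc, ← mul_assoc, mul_assoc (xor a x c), ← xor_mul_hf, mul_assoc, xor_comm a x c,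
      xor_mul_hf]
  have key2 := congrArg (E c) key
  rw [(indep_hf h1 hy1).E_mul', ((indep_hf h1 hy1).mul ((indep_hf hx1 hy1).mul
    (indep_hf hx1 hy1))).E_mul', E_xor h1 hx1 h2 hx2 h3, one_mul, one_mul] at key2
  have key3 := congrArg (fun f => E a (xf 0 a * f)) key2
  beta_reduce at key3
  rw [← mul_assoc, xf_zero_mul_hf, ((indep_hf hx0 hy0).mul
    (indep_hf hx0 hy0)).E_mul', E_xf_zero, one_mul] at key3
  exact key3.symm

/-! The Euler decomposition. -/

theorem Z_comp_Z_neg (α : Real.Angle) : Z 1 1 α ≫ₓ Z 1 1 (-α) = one 1 := by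
  rw [Z_comp_Z, add_neg_cancel, Z_one]

theorem Z_neg_comp_Z (α : Real.Angle) : Z 1 1 (-α) ≫ₓ Z 1 1 α = one 1 := by
  rw [Z_comp_Z, neg_add_cancel, Z_one]

theorem X_comp_X_neg (α : Real.Angle) : X 1 1 α ≫ₓ X 1 1 (-α) = one 1 := by
  rw [X_one_one, X_one_one, assoc, ← assoc H, ← assoc H, H_comp_H, one_comp, ← assoc,
    assoc H, Z_comp_Z_neg, comp_one, H_comp_H]

theorem X_neg_comp_X (α : Real.Angle) : X 1 1 (-α) ≫ₓ X 1 1 α = one 1 := by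
  simpa using X_comp_X_neg (-α)

/-- The Euler rule solved for the X-rotation. As a function it has no bound variable, only phases
and one sign. -/
theorem X_halfPi : X 1 1 halfPi = Z 1 1 (-halfPi) ≫ₓ H ≫ₓ Z 1 1 (-halfPi) := by
  have h : H = Z 1 1 halfPi ≫ₓ X 1 1 halfPi ≫ₓ Z 1 1 halfPi := mk_rule .euler
  rw [h, assoc, assoc, assoc, Z_comp_Z_neg, comp_one, ← assoc, Z_neg_comp_Z, one_comp]

theorem X_neg_halfPi : X 1 1 (-halfPi) = Z 1 1 halfPi ≫ₓ H ≫ₓ Z 1 1 halfPi := by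
  have h : X 1 1 halfPi ≫ₓ (Z 1 1 halfPi ≫ₓ H ≫ₓ Z 1 1 halfPi) = one 1 := by
    rw [X_halfPi, assoc, assoc, assoc, ← assoc (Z 1 1 (-halfPi)) (Z 1 1 halfPi), Z_neg_comp_Z,
      one_comp, ← assoc H, H_comp_H, one_comp, Z_neg_comp_Z]
  rw [← comp_one (X 1 1 (-halfPi)), ← h, ← assoc, X_neg_comp_X, one_comp]

theorem ev_X_halfPi (x y : Fin N) : ev (X 1 1 halfPi) (fun _ => x) (fun _ => y) =
    zf (-halfPi) x * hf x y * zf (-halfPi) y := by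
  rw [X_halfPi, ev_comp_Z, ev_Z_comp, mul_comm]; rfl

theorem ev_X_neg_halfPi (x y : Fin N) : ev (X 1 1 (-halfPi)) (fun _ => x) (fun _ => y) =
    zf halfPi x * hf x y * zf halfPi y := by
  rw [X_neg_halfPi, ev_comp_Z, ev_Z_comp, mul_comm]; rfl

theorem ev_X_one_one {α : Real.Angle} {x y z : Fin N} (hx : x ≠ y) (hz : z ≠ y) :
    ev (X 1 1 α) (fun _ => x) (fun _ => z) = E y (hf x y * zf α y * hf y z) := by
  rw [X_one_one, ev_comp_one _ _ (fun _ => hx) (fun _ => hz), ev_comp_Z, mul_comm (zf _ _)]; rfl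

theorem E_hf_mul_zf_mul_hf {x y z : Fin N} (hx : x ≠ y) (hz : z ≠ y) :
    E y (hf x y * zf halfPi y * hf y z) = zf (-halfPi) x * hf x z * zf (-halfPi) z := by
  rw [← ev_X_one_one hx hz, ev_X_halfPi]

theorem E_hf_mul_zf_neg_mul_hf {x y z : Fin N} (hx : x ≠ y) (hz : z ≠ y) :
    E y (hf x y * zf (-halfPi) y * hf y z) = zf halfPi x * hf x z * zf halfPi z := by
  rw [← ev_X_one_one hx hz, ev_X_neg_halfPi]

/-- The hypothesis at `z = 0`: multiplying by `xf 0 z` and summing over `z` removes every factor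
that contains `z`. -/
theorem E_hf_mul_zf {α β : Real.Angle} {x y z : Fin N} (hz : z ≠ y) (hxz : x ≠ z)
    (h : E y (hf x y * zf α y * hf y z) = zf β x * hf x z * zf β z) :
    E y (hf x y * zf α y) = zf β x := by
  have h1 := congrArg (fun f => E z (xf 0 z * f)) h
  beta_reduce at h1
  rw [← (indep_xf hz).E_mul, hf_comm y, hf_comm x z, mul_left_comm, xf_zero_mul_hf, mul_comm, E_comm,
    ((indep_hf hxz hz.symm).mul (indep_zf hz.symm)).E_mul', E_xf_zero, one_mul, mul_assoc,
    mul_left_comm, (indep_zf hxz).E_mul, ← mul_assoc (xf 0 z), xf_zero_mul_hf, xf_zero_mul_zf,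
    E_xf_zero, mul_one] at h1
  exact h1

/-- For bits, `y ⊕ a = y + a - 2ya`, so `i^(y ⊕ a) = i^y (-1)^(ya) i^a`. The variable `x` is the
bound variable in the Hadamard expansion of the parity. -/
theorem E_xor_mul_zf {y a c x : Fin N} (hx : x ≠ c) (ha : a ≠ c) (hyc : y ≠ c) (hax : a ≠ x)
    (hyx : y ≠ x) : E c (xor y a c * zf halfPi c) = zf halfPi y * hf y a * zf halfPi a := by
  rw [xor_eq hyx hax hx.symm, ← (indep_zf hx.symm).E_mul', E_comm,
    ← E_hf_mul_zf_neg_mul_hf hyx hax]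
  congr 1
  rw [mul_assoc, ((indep_hf hyc hx).mul (indep_hf ha hx)).E_mul,
    E_hf_mul_zf hyc hyx.symm (E_hf_mul_zf_mul_hf hx hyc), mul_right_comm, hf_comm a]

theorem xor_mul_prod_hf {ι : Type*} (f : ι → Fin N) (T : Finset ι) (a b c : Fin N) :
    xor a b c * ∏ w ∈ T, hf c (f w) =
      xor a b c * ((∏ w ∈ T, hf a (f w)) * ∏ w ∈ T, hf b (f w)) := by
  classical
  induction T using Finset.induction_on with
  | empty => simp
  | insert w T hw ih =>
    rw [Finset.prod_insert hw, Finset.prod_insert hw, Finset.prod_insert hw, mul_left_comm, ih,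
      mul_left_comm, ← mul_assoc (xor a b c), xor_mul_hf]
    ac_rfl

/-- The Hadamard function of an unordered pair. -/
noncomputable def hs {ι : Type*} (f : ι → Fin N) : Sym2 ι → Fn N :=
  Sym2.lift ⟨fun v w => hf (f v) (f w), fun _ _ => hf_comm _ _⟩

@[simp] theorem hs_mk {ι : Type*} (f : ι → Fin N) (v w : ι) : hs f s(v, w) = hf (f v) (f w) := rfl

theorem hs_mul_self {ι : Type*} (f : ι → Fin N) (e : Sym2 ι) : hs f e * hs f e = 1 := by
  induction e using Sym2.ind
  exact hf_mul_self _ _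

theorem _root_.Finset.prod_sym2_insert {ι M : Type*} [DecidableEq ι] [CommMonoid M] {a : ι}
    {T : Finset ι} (ha : a ∉ T) (g : Sym2 ι → M) :
    ∏ e ∈ (insert a T).sym2, g e = g s(a, a) * (∏ b ∈ T, g s(a, b)) * ∏ e ∈ T.sym2, g e := by
  rw [Finset.sym2_insert, Finset.prod_union, Finset.prod_image, Finset.prod_insert ha]
  · intro b _ c _ h
    exact Sym2.congr_right.1 h
  · rw [Finset.disjoint_left]
    intro e he he'
    obtain ⟨b, -, rfl⟩ := Finset.mem_image.1 he
    exact ha (Finset.mem_sym2_iff.1 he' a (Sym2.mem_mk_left _ _))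

open Classical in
/-- Summing out a variable with phase `-π/2`. -/
theorem E_prod_hf {ι : Type*} (f : ι → Fin N) {x : Fin N} (T : Finset ι) :
    ∀ {y c : Fin N}, (∀ w ∈ T, f w ≠ x) → (∀ w ∈ T, f w ≠ y) → (∀ w ∈ T, f w ≠ c) → y ≠ x →
    c ≠ x → y ≠ c →
    E x (zf (-halfPi) x * (hf x y * ∏ w ∈ T, hf x (f w))) =
      zf halfPi y * (∏ w ∈ T, hf y (f w)) * (∏ w ∈ T, zf halfPi (f w)) *
        ∏ e ∈ T.sym2, if e.IsDiag then 1 else hs f e := by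
  induction T using Finset.induction_on with
  | empty =>
    intro y c _ _ _ hyx hcx hyc
    have := E_hf_mul_zf hcx hyc (E_hf_mul_zf_neg_mul_hf hyx hcx)
    simpa [hf_comm y, mul_comm] using this
  | insert a T ha ih =>
    intro y c hx hy hc hyx hcx hyc
    have hT {P : ι → Prop} (h : ∀ w ∈ insert a T, P w) : ∀ w ∈ T, P w :=
      fun w hw => h w (Finset.mem_insert_of_mem hw)
    have hax := hx a (Finset.mem_insert_self a T)
    have hac := hc a (Finset.mem_insert_self a T)
    -- The induction hypothesis is used with `y` and `c` interchanged: the parity `c` takes the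
    -- place of `y`, and `y` becomes the spare variable. Hence both are quantified inside the
    -- induction.
    have ih' := ih (hT hx) (hT hc) (hT hy) hcx hyx hyc.symm
    have hi : Indep x (xor y (f a) c) := indep_xor hyx hax hcx
    -- The two signs of `x` against `y` and `f a` are replaced by one sign against their parity `c`,
    -- so the product over `T` alone remains.
    have h1 : hf x y * hf x (f a) = E c (xor y (f a) c * hf c x) := by
      rw [E_xor_mul_hf hyc hac hcx.symm, hf_comm x, hf_comm x]
    have h2 : Indep c (zf (-halfPi) x * ∏ w ∈ T, hf x (f w)) :=
      (indep_zf hcx.symm).mul (.prod fun w hw => indep_hf hcx.symm (hc w (Finset.mem_insert_of_mem hw)))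
    have h3 : zf (-halfPi) x * (hf x y * ∏ w ∈ insert a T, hf x (f w)) =
        E c ((zf (-halfPi) x * ∏ w ∈ T, hf x (f w)) * (xor y (f a) c * hf c x)) := by
      rw [h2.E_mul, ← h1, Finset.prod_insert ha]
      ac_rfl
    have h4 : (zf (-halfPi) x * ∏ w ∈ T, hf x (f w)) * (xor y (f a) c * hf c x) =
        xor y (f a) c * (zf (-halfPi) x * (hf x c * ∏ w ∈ T, hf x (f w))) := by
      rw [hf_comm c]
      ac_rfl
    rw [h3, E_comm, h4, hi.E_mul, ih']
    generalize hP : (∏ e ∈ T.sym2, if e.IsDiag then 1 else hs f e) = P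
    have hP' : Indep c P := hP ▸ .prod fun e he => by
      split_ifs
      · exact indep_one c
      · induction e using Sym2.ind with | _ v w =>
        rw [Finset.mk_mem_sym2_iff] at he
        exact indep_hf (hT hc v he.1) (hT hc w he.2)
    have h5 : xor y (f a) c * (zf halfPi c * (∏ w ∈ T, hf c (f w)) * (∏ w ∈ T, zf halfPi (f w)) * P) =
        (((∏ w ∈ T, hf y (f w)) * ∏ w ∈ T, hf (f a) (f w)) * (∏ w ∈ T, zf halfPi (f w)) * P) *
          (xor y (f a) c * zf halfPi c) := by
      have := xor_mul_prod_hf f T y (f a) c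
      calc _ = (xor y (f a) c * ∏ w ∈ T, hf c (f w)) *
            (zf halfPi c * (∏ w ∈ T, zf halfPi (f w)) * P) := by ac_rfl
        _ = _ := by rw [this]; ac_rfl
    have h6 : Indep c (((∏ w ∈ T, hf y (f w)) * ∏ w ∈ T, hf (f a) (f w)) *
        (∏ w ∈ T, zf halfPi (f w)) * P) :=
      (((Indep.prod fun w hw => indep_hf hyc (hT hc w hw)).mul
        (.prod fun w hw => indep_hf hac (hT hc w hw))).mul
        (.prod fun w hw => indep_zf (hT hc w hw))).mul hP'
    rw [h5, h6.E_mul, E_xor_mul_zf hcx.symm hac hyc hax hyx, Finset.prod_insert ha,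
      Finset.prod_insert ha, Finset.prod_sym2_insert ha, if_pos (Sym2.mk_isDiag_iff.2 rfl), hP,
      one_mul]
    have h7 : (∏ b ∈ T, if s(a, b).IsDiag then 1 else hs f s(a, b)) = ∏ w ∈ T, hf (f a) (f w) :=
      Finset.prod_congr rfl fun w hw => by
        rw [if_neg, hs_mk]
        rintro h
        exact ha (Sym2.mk_isDiag_iff.1 h ▸ hw)
    rw [h7]
    ac_rfl

end Fn

namespace ZX

/-! ### Measurement effects and local Clifford operators -/

theorem two_halfPi : halfPi + halfPi = (π : Real.Angle) := by
  rw [halfPi, ← Real.Angle.coe_add, add_halves]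

theorem X_pi_comp_Z (α : Real.Angle) : X 1 1 (π : Real.Angle) ≫ₓ Z 1 0 α = Z 1 0 (-α) := by
  have h : ZX.mk _ = ZX.mk _ := mk_rule (.piCommute 0 α)
  exact h.trans (comp_one (Z 1 0 (-α)))

theorem Z_pi_comp_X (α : Real.Angle) : Z 1 1 (π : Real.Angle) ≫ₓ X 1 0 α = X 1 0 (-α) := by
  rw [X_one_zero, X_one_zero, ← X_pi_comp_Z, X_one_one, assoc, assoc, ← assoc H, H_comp_H, one_comp]

/-- The effect of a measurement label. -/
noncomputable def eff (l : MeasLabel) : ZX 1 0 := ZX.mk l.toZX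

theorem eff_XY (α : Real.Angle) : eff (.XY, α) = Z 1 0 α := rfl
theorem eff_XZ (α : Real.Angle) : eff (.XZ, α) = Z 1 1 halfPi ≫ₓ X 1 0 α := rfl
theorem eff_YZ (α : Real.Angle) : eff (.YZ, α) = X 1 0 α := rfl

theorem Z_halfPi_comp_X (α : Real.Angle) :
    Z 1 1 halfPi ≫ₓ X 1 0 (-α) = Z 1 1 (-halfPi) ≫ₓ X 1 0 α := by
  rw [← Z_pi_comp_X, ← assoc, Z_comp_Z, ← Real.Angle.neg_coe_pi, ← two_halfPi, neg_add,
    add_neg_cancel_left]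

/-- In the planes `XY` and `XZ` the Hadamard gate from the Euler decomposition exchanges X- and
Z-effects; for `XY` the sign of the angle is reversed by splitting off a `Z(π)`. In the plane `YZ`
two X-phases simply add. -/
theorem X_halfPi_comp_eff (l : MeasLabel) : X 1 1 halfPi ≫ₓ eff l = eff l.lcSelf := by
  obtain ⟨_ | _ | _, α⟩ := l
  · rw [MeasLabel.lcSelf, eff_XY, eff_XZ, Fn.X_halfPi, assoc, Z_comp_Z, assoc, ← X_one_zero,
      ← neg_sub, Z_halfPi_comp_X, neg_add_eq_sub]
  · rw [MeasLabel.lcSelf, eff_XY, eff_XZ, Fn.X_halfPi, assoc, ← assoc (Z 1 1 (-halfPi)) (Z 1 1 halfPi),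
      Fn.Z_neg_comp_Z, one_comp, assoc, X_one_zero, ← assoc H, H_comp_H, one_comp, Z_comp_Z,
      neg_add_eq_sub]
  · rw [MeasLabel.lcSelf, eff_YZ, eff_YZ, X_one_one, X_one_zero, assoc, ← assoc H, H_comp_H, one_comp,
      assoc, Z_comp_Z, X_one_zero, add_comm]

theorem Z_neg_halfPi_comp_eff (l : MeasLabel) : Z 1 1 (-halfPi) ≫ₓ eff l = eff l.lcNbr := by
  obtain ⟨_ | _ | _, α⟩ := l
  · rw [MeasLabel.lcNbr, eff_XY, eff_XY, Z_comp_Z, neg_add_eq_sub]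
  · rw [MeasLabel.lcNbr, eff_XZ, eff_YZ, ← assoc, Fn.Z_neg_comp_Z, one_comp]
  · rw [MeasLabel.lcNbr, eff_XZ, eff_YZ, Z_halfPi_comp_X]

theorem Z_comp_X_sign (a : Fin 2) (α : Real.Angle) :
    Z 1 1 ((a : ℕ) • (π : Real.Angle)) ≫ₓ X 1 0 α = X 1 0 (((-1 : ℤ) ^ (a : ℕ)) • α) := by
  fin_cases a
  · simp [Z_one, one_comp]
  · simpa using Z_pi_comp_X α

theorem Z_comp_eff (a : Fin 2) (l : MeasLabel) :
    Z 1 1 ((a : ℕ) • (π : Real.Angle)) ≫ₓ eff l = eff (l.removeNbr a) := by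
  obtain ⟨_ | _ | _, α⟩ := l
  · rw [MeasLabel.removeNbr, eff_XY, eff_XY, Z_comp_Z, add_comm]
  · rw [MeasLabel.removeNbr, eff_XZ, eff_XZ, ← assoc, Z_comp_Z, add_comm, ← Z_comp_Z, assoc,
      Z_comp_X_sign]
  · rw [MeasLabel.removeNbr, eff_YZ, eff_YZ, Z_comp_X_sign]

/-- The morphism of a word of local Clifford operators. -/
noncomputable def lc (w : LC) : ZX 1 1 := ZX.mk w.toZX

theorem lc_one : lc 1 = one 1 := rfl

theorem lc_of_mul (x : LCGen) (w : LC) : lc (FreeMonoid.of x * w) = ZX.mk x.toZX ≫ₓ lc w := rfl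

theorem lc_mul (w w' : LC) : lc (w * w') = lc w ≫ₓ lc w' := by
  induction w using FreeMonoid.inductionOn' with
  | one => rw [one_mul, lc_one, one_comp]
  | of_mul x w ih => rw [mul_assoc, lc_of_mul, lc_of_mul, ih, assoc]

theorem lc_of (x : LCGen) : lc (FreeMonoid.of x) = ZX.mk x.toZX := comp_one (ZX.mk x.toZX)

theorem lc_rHalf_mul (w : LC) : lc (FreeMonoid.of .rHalf * w) = X 1 1 halfPi ≫ₓ lc w := rfl

theorem lc_gNegHalf_mul (w : LC) : lc (FreeMonoid.of .gNegHalf * w) = Z 1 1 (-halfPi) ≫ₓ lc w := rfl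

theorem lc_g_pow_mul (a : Fin 2) (w : LC) : lc (FreeMonoid.of .g ^ (a : ℕ) * w) =
    Z 1 1 ((a : ℕ) • (π : Real.Angle)) ≫ₓ lc w := by
  fin_cases a
  · simp [Z_one, one_comp]
  · simp only [pow_one, one_smul]; rfl

/-- The letters appended to the label of an expanded input are the Euler decomposition of `H`. -/
theorem lc_mul_euler (w : LC) :
    lc (w * FreeMonoid.of .gHalf * FreeMonoid.of .rHalf * FreeMonoid.of .gHalf) = lc w ≫ₓ H := by
  have h : H = Z 1 1 halfPi ≫ₓ X 1 1 halfPi ≫ₓ Z 1 1 halfPi := mk_rule .euler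
  rw [lc_mul, lc_mul, lc_mul, lc_of, lc_of, h, ← assoc, ← assoc]
  rfl

end ZX

namespace Fn

open ZX
open PropTerm (permSum permSum_castAdd permSum_natAdd permSum_symm tensorFin recast)

variable {N m : ℕ}

/-! ### Families of terms in parallel -/

theorem finSigmaFinEquiv_zero {K : ℕ} {a : Fin (K + 1) → ℕ} (j : Fin (a 0)) :
    finSigmaFinEquiv (⟨0, j⟩ : Σ i, Fin (a i)) =
      (finCongr (Fin.sum_univ_succ a)).symm (Fin.castAdd _ j) := by
  ext
  rw [finSigmaFinEquiv_apply]
  simp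

theorem finSigmaFinEquiv_succ {K : ℕ} {a : Fin (K + 1) → ℕ} (i : Fin K) (j : Fin (a i.succ)) :
    finSigmaFinEquiv (⟨i.succ, j⟩ : Σ i, Fin (a i)) =
      (finCongr (Fin.sum_univ_succ a)).symm (Fin.natAdd _
        (finSigmaFinEquiv (⟨i, j⟩ : Σ i : Fin K, Fin (a i.succ)))) := by
  ext
  rw [finSigmaFinEquiv_apply]
  simp only [finCongr_symm, finCongr_apply, Fin.val_cast, Fin.val_natAdd, finSigmaFinEquiv_apply]
  rw [← add_assoc]
  congr 1
  exact Fin.sum_univ_succ _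

/-- Parallel composition is multiplication of functions, with variables indexed as in
`finSigmaFinEquiv`. -/
theorem ev_tensorFin : (K : ℕ) → {a b : Fin K → ℕ} → (t : ∀ i, ZXTerm (a i) (b i)) →
    (x : Fin (∑ i, a i) → Fin N) → (y : Fin (∑ i, b i) → Fin N) →
    ev (ZX.mk (tensorFin K t)) x y = ∏ i, ev (ZX.mk (t i))
      (fun j => x (finSigmaFinEquiv ⟨i, j⟩)) (fun j => y (finSigmaFinEquiv ⟨i, j⟩))
  | 0, a, b, t, x, y => by
    rw [tensorFin, mk_recast]
    exact (ev_rep (rep_perm _) x y).trans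
      (Finset.prod_eq_one fun i _ => (i.cast (by simp) : Fin 0).elim0)
  | K + 1, a, b, t, x, y => by
    rw [tensorFin, mk_comp, mk_comp, mk_recast, mk_recast, mk_tensor, ev_comp_perm, ev_perm_comp,
      ev_tens, ev_tensorFin K, Fin.prod_univ_succ]
    simp only [finSigmaFinEquiv_zero, finSigmaFinEquiv_succ]
    rfl

theorem mk_tensorFin_congr : (K : ℕ) → {a b : Fin K → ℕ} → {s t : ∀ i, ZXTerm (a i) (b i)} →
    (∀ i, ZX.mk (s i) = ZX.mk (t i)) → ZX.mk (tensorFin K s) = ZX.mk (tensorFin K t)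
  | 0, _, _, _, _, _ => rfl
  | K + 1, _, _, s, t, h => by
    rw [tensorFin, tensorFin, mk_comp, mk_comp, mk_comp, mk_comp, mk_tensor, mk_tensor, h 0,
      mk_tensorFin_congr K fun i => h i.succ]

theorem mk_tensorFin_comp : (K : ℕ) → {a b c : Fin K → ℕ} → (s : ∀ i, ZXTerm (a i) (b i)) →
    (t : ∀ i, ZXTerm (b i) (c i)) → ZX.mk (tensorFin K fun i => (s i).comp (t i)) =
      ZX.mk (tensorFin K s) ≫ₓ ZX.mk (tensorFin K t)
  | 0, a, b, c, s, t => by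
    rw [tensorFin, tensorFin, tensorFin, mk_recast, mk_recast, mk_recast, perm_comp]
    exact perm_congr fun i => rfl
  | K + 1, a, b, c, s, t => by
    simp only [tensorFin, mk_comp, mk_tensor, mk_recast, mk_tensorFin_comp K]
    rw [assoc _ (perm _) (_ ≫ₓ _), assoc (perm (finCongr (Fin.sum_univ_succ b))),
      ← assoc (perm _) (perm (finCongr (Fin.sum_univ_succ b))), perm_comp, perm_eq_one fun i => rfl,
      one_comp, assoc, interchange, assoc, ← assoc]

/-- A product taken place by place is a product over all attached legs; the arbitrary enumerations
inside `fibreEquiv` cancel. -/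
theorem prod_fibreEquiv {A M : Type} [Fintype A] [CommMonoid M] {K : ℕ} (f : A → Fin K)
    (F : Fin K → A → M) :
    ∏ i, ∏ j : Fin (Nat.card {x // f x = i}),
      F i ((MBQCLCGraph.fibreEquiv f).symm (finSigmaFinEquiv ⟨i, j⟩)) = ∏ x, F (f x) x := by
  have h (s : Σ i, Fin (Nat.card {x // f x = i})) :
      f ((MBQCLCGraph.fibreEquiv f).symm (finSigmaFinEquiv s)) = s.1 := by
    simp only [MBQCLCGraph.fibreEquiv, Equiv.symm_trans_apply, Equiv.symm_apply_apply]
    exact ((Finite.equivFin {x // f x = s.1}).symm s.2).2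
  refine (Fintype.prod_sigma' _).symm.trans ?_
  refine Fintype.prod_equiv (finSigmaFinEquiv.trans (MBQCLCGraph.fibreEquiv f).symm) _ _ fun s => ?_
  rw [Equiv.trans_apply, h]

/-- Spiders without outputs. -/
theorem ev_in_spiders {A : Type} [Fintype A] {n K : ℕ} (e : Fin n ≃ A) (f : A → Fin K)
    (h : K = ∑ _i : Fin K, 1) (g : ZX m n) (x : Fin m → Fin N) (y : Fin K → Fin N) :
    ev (g ≫ₓ (perm (e.trans (MBQCLCGraph.fibreEquiv f)) ≫ₓ
      ZX.mk (tensorFin K (fun i => ZXTerm.Z (Nat.card {x // f x = i}) 1 0)) ≫ₓ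
      perm (finCongr h.symm))) x y = ev g x fun i => y (f (e i)) := by
  refine ev_comp_transpose ?_ g x y
  have h1 (i : Fin K) : finCongr h.symm (finSigmaFinEquiv ⟨i, 0⟩) = i := by
    ext
    simp
  rw [nm_eq_ev, ev_comp_perm, ev_perm_comp, ev_tensorFin]
  have h2 (i : Fin K) (j : Fin 1) : finCongr h.symm (finSigmaFinEquiv ⟨i, j⟩) = i := by
    rw [Subsingleton.elim j 0, h1]
  simp only [h2]
  have h3 := prod_fibreEquiv f fun i x =>
    (dlt (Fin.castAdd K (e.symm x)) (Fin.natAdd n i) : Fn (n + K))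
  refine Eq.trans ?_ (h3.trans ?_)
  · refine Finset.prod_congr rfl fun i _ => ?_
    refine (ev_Z_one (N := n + K) 0 _ _).trans ?_
    rw [zf_zero, one_mul]
    rfl
  · exact Fintype.prod_equiv e.symm _ _ fun x => by rw [Equiv.apply_symm_apply]

/-- The outgoing halves of the spiders, followed by the rearrangement of legs, form the wiring in
which each leg copies the variable of its vertex. -/
theorem ev_out_spiders {A : Type} [Fintype A] {n K : ℕ} (e : A ≃ Fin n) (f : A → Fin K)
    (h : K = ∑ _i : Fin K, 1) (g : ZX n m) (x : Fin K → Fin N) (y : Fin m → Fin N) :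
    ev (perm (finCongr h) ≫ₓ
      ZX.mk (tensorFin K (fun i => ZXTerm.Z 1 (Nat.card {x // f x = i}) 0)) ≫ₓ
      perm ((MBQCLCGraph.fibreEquiv f).symm.trans e) ≫ₓ g) x y =
        ev g (fun i => x (f (e.symm i))) y := by
  have key : perm (finCongr h) ≫ₓ
      ZX.mk (tensorFin K (fun i => ZXTerm.Z 1 (Nat.card {x // f x = i}) 0)) ≫ₓ
      perm ((MBQCLCGraph.fibreEquiv f).symm.trans e) = dl (f ∘ e.symm) := by
    refine ev_injective (N := K + n) (a := Fin.castAdd n) (b := Fin.natAdd K)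
      (Fin.castAdd_injective _ _) (Fin.natAdd_injective _ _) (castAdd_ne_natAdd) ?_
    have h2 (i : Fin K) (j : Fin 1) : (finCongr h).symm (finSigmaFinEquiv ⟨i, j⟩) = i := by
      rw [Subsingleton.elim j 0]
      ext
      simp
    rw [ev_rep (rep_dl _), ev_comp_perm, ev_perm_comp, ev_tensorFin]
    simp only [h2]
    have h3 := prod_fibreEquiv f fun i x =>
      (dlt (Fin.castAdd n i) (Fin.natAdd K (e x)) : Fn (K + n))
    refine Eq.trans ?_ (h3.trans ?_)
    · refine Finset.prod_congr rfl fun i _ => ?_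
      exact ev_Z_copy (N := K + n) _ _
    · exact Fintype.prod_equiv e _ _ fun x => by
        rw [Function.comp, Equiv.symm_apply_apply]
  rw [key, ev_rep_comp (rep_dl _)]
  rfl

end Fn

namespace MBQCLCGraph

open ZX Fn
open PropTerm (tensorFin)

variable {VS : Type u} {N : ℕ} (G : MBQCLCGraph VS)

/-! ### The diagram of a graph as a function -/

theorem finSigmaFinEquiv_one {K : ℕ} (h : K = ∑ _i : Fin K, 1) (k : Fin K) (j : Fin 1) :
    (finSigmaFinEquiv ⟨k, j⟩ : Fin (∑ _i : Fin K, 1)) = finCongr h k := by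
  obtain rfl := Subsingleton.elim j 0
  ext
  simp

/-- The function of the part of the diagram of a graph that follows the spiders. -/
theorem ev_ends (y : Fin G.V.card → Fin N) (c : Fin G.O.length → Fin N)
    (h : ∑ _i : Fin G.O.length, 1 + (∑ _i : Fin (Nat.card G.Measured), 0 +
      ∑ _i : Fin (Nat.card G.Edges), 0) = G.O.length) :
    ev ((ZX.mk (tensorFin G.O.length (a := fun _ => 1) (b := fun _ => 1)
      (fun k => (G.lo ⟨G.O.get k, List.get_mem _ _⟩).toZX)) ⊗ₓ
    (ZX.mk (tensorFin (Nat.card G.Measured) (a := fun _ => 1) (b := fun _ => 0)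
        (fun i => (G.meas ⟨(G.vtx ((Finite.equivFin G.Measured).symm i).1).1,
          (G.vtx ((Finite.equivFin G.Measured).symm i).1).2,
          ((Finite.equivFin G.Measured).symm i).2⟩).toZX)) ⊗ₓ
      ZX.mk (tensorFin (Nat.card G.Edges) (a := fun _ => 2) (b := fun _ => 0)
        (fun _ => (ZXTerm.H.tensor (PropTerm.idt 1)).comp (ZXTerm.Z 2 0 0))))) ≫ₓ
        perm (finCongr h)) (fun i => y (G.legVertex (G.legArrangement.symm i))) c =
      (∏ k, ev (lc (G.lo ⟨G.O.get k, List.get_mem _ _⟩)) (fun _ => y (G.outputVertex k))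
        fun _ => c k) *
      ((∏ i, at' (eff (G.meas ⟨(G.vtx ((Finite.equivFin G.Measured).symm i).1).1,
          (G.vtx ((Finite.equivFin G.Measured).symm i).1).2,
          ((Finite.equivFin G.Measured).symm i).2⟩))
            fun _ => y ((Finite.equivFin G.Measured).symm i).1) *
        ∏ i, hf (y ((Finite.equivFin G.Edges).symm i).1.1)
          (y ((Finite.equivFin G.Edges).symm i).1.2)) := by
  rw [ev_comp_perm, ev_tens, ev_tens, ev_tensorFin, ev_tensorFin, ev_tensorFin]
  congr 1
  · refine Finset.prod_congr rfl fun k _ => ?_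
    have h1 (j : Fin 1) : G.legArrangement.symm (Fin.castAdd _ (finSigmaFinEquiv ⟨k, j⟩)) =
        .inl k := by
      rw [Equiv.symm_apply_eq, finSigmaFinEquiv_one (by simp)]
      rfl
    have h2 (j : Fin 1) : finCongr h (Fin.castAdd _ (finSigmaFinEquiv ⟨k, j⟩)) = k := by
      rw [finSigmaFinEquiv_one (by simp)]
      rfl
    simp only [h1, h2]
    rfl
  congr 1
  · refine Finset.prod_congr rfl fun k _ => ?_
    have h1 (j : Fin 1) : G.legArrangement.symm
        (Fin.natAdd _ (Fin.castAdd _ (finSigmaFinEquiv ⟨k, j⟩))) =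
        .inr (.inl ((Finite.equivFin G.Measured).symm k)) := by
      rw [Equiv.symm_apply_eq, finSigmaFinEquiv_one (by simp), ← Equiv.symm_apply_eq]
      simp [legArrangement]
    simp only [h1]
    exact ev_effect _ _ _
  · refine Finset.prod_congr rfl fun k _ => ?_
    have h1 (j : Fin 2) : G.legArrangement.symm
        (Fin.natAdd _ (Fin.natAdd _ (finSigmaFinEquiv ⟨k, j⟩))) =
        .inr (.inr ((Finite.equivFin G.Edges).symm k, j)) := by
      rw [Equiv.symm_apply_eq]
      simp [legArrangement]
    simp only [h1]
    refine (ev_effect _ _ _).trans ?_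
    rw [hf, ev]
    have : ZX.mk ((ZXTerm.H.tensor (PropTerm.idt 1)).comp (ZXTerm.Z 2 0 0)) = nm H := by
      rw [nm, cap_one]; rfl
    rw [this]
    congr 1; ext1 i
    fin_cases i <;> rfl

/-- The variables `y` sit on one wire inside each vertex spider. The composite is cut along these
wires, and the two halves are evaluated separately. -/
theorem ev_toZX_wires (y : Fin G.V.card → Fin N) (hy : Function.Injective y)
    (a : Fin G.I.length → Fin N) (c : Fin G.O.length → Fin N) (ha : ∀ i j, a i ≠ y j)
    (hc : ∀ i j, c i ≠ y j) :
    ev (ZX.mk G.toZX) a c = Es (Finset.univ.image y)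
      ((∏ k, ev (lc (G.li ⟨G.I.get k, List.get_mem _ _⟩)) (fun _ => a k)
        fun _ => y (G.inputVertex k)) *
      ((∏ k, ev (lc (G.lo ⟨G.O.get k, List.get_mem _ _⟩)) (fun _ => y (G.outputVertex k))
        fun _ => c k) *
      ((∏ i, at' (eff (G.meas ⟨(G.vtx ((Finite.equivFin G.Measured).symm i).1).1,
          (G.vtx ((Finite.equivFin G.Measured).symm i).1).2,
          ((Finite.equivFin G.Measured).symm i).2⟩))
            fun _ => y ((Finite.equivFin G.Measured).symm i).1) *
        ∏ i, hf (y ((Finite.equivFin G.Edges).symm i).1.1)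
          (y ((Finite.equivFin G.Edges).symm i).1.2)))) := by
  have h : G.V.card = ∑ _i : Fin G.V.card, 1 := by simp
  have hI : G.I.length = ∑ _i : Fin G.I.length, 1 := by simp
  have : Fintype G.Legs := Fintype.ofFinite _
  -- By fusion each spider is split into one that gathers its inputs to a single wire and one that
  -- spreads it to the other legs.
  have hS : ZX.mk (tensorFin G.V.card fun i =>
      ZXTerm.Z (Nat.card {k // G.inputVertex k = i}) (Nat.card {x // G.legVertex x = i}) 0) =
      ZX.mk (tensorFin G.V.card fun i =>
        ZXTerm.Z (Nat.card {k // G.inputVertex k = i}) 1 0) ≫ₓ perm (finCongr h.symm) ≫ₓ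
      (perm (finCongr h) ≫ₓ ZX.mk (tensorFin G.V.card fun i =>
        ZXTerm.Z 1 (Nat.card {x // G.legVertex x = i}) 0)) := by
    rw [assoc, ← assoc (perm _), perm_comp, perm_eq_one fun i => rfl, one_comp, ← mk_tensorFin_comp]
    refine mk_tensorFin_congr _ fun i => ?_
    have := Z_comp_Z (Nat.card {k // G.inputVertex k = i}) (Nat.card {x // G.legVertex x = i}) 0 0
    rw [add_zero (0 : Real.Angle)] at this
    exact this.symm
  have key : ZX.mk G.toZX = perm (finCongr hI) ≫ₓ
      ZX.mk (tensorFin G.I.length (a := fun _ => 1) (b := fun _ => 1)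
        (fun k => (G.li ⟨G.I.get k, List.get_mem _ _⟩).toZX)) ≫ₓ
      perm ((finCongr hI.symm).trans (fibreEquiv G.inputVertex)) ≫ₓ
      ZX.mk (tensorFin G.V.card fun i =>
        ZXTerm.Z (Nat.card {k // G.inputVertex k = i}) (Nat.card {x // G.legVertex x = i}) 0) ≫ₓ
      perm ((fibreEquiv G.legVertex).symm.trans G.legArrangement) ≫ₓ
      (ZX.mk (tensorFin G.O.length (a := fun _ => 1) (b := fun _ => 1)
        (fun k => (G.lo ⟨G.O.get k, List.get_mem _ _⟩).toZX)) ⊗ₓ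
      (ZX.mk (tensorFin (Nat.card G.Measured) (a := fun _ => 1) (b := fun _ => 0)
        (fun i => (G.meas ⟨(G.vtx ((Finite.equivFin G.Measured).symm i).1).1,
          (G.vtx ((Finite.equivFin G.Measured).symm i).1).2,
          ((Finite.equivFin G.Measured).symm i).2⟩).toZX)) ⊗ₓ
      ZX.mk (tensorFin (Nat.card G.Edges) (a := fun _ => 2) (b := fun _ => 0)
        (fun _ => (ZXTerm.H.tensor (PropTerm.idt 1)).comp (ZXTerm.Z 2 0 0))))) ≫ₓ
        perm (finCongr (by simp)) := rfl
  have regroup {n₁ n₂ n₃ n₄ n₅ n₆ n₇ n₈ n₉ n : ℕ} (f₁ : ZX n₁ n₂) (f₂ : ZX n₂ n₃) (f₃ : ZX n₃ n₄)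
      (f₄ : ZX n₄ n₅) (f₅ : ZX n₅ n₆) (f₆ : ZX n₆ n₅) (f₇ : ZX n₅ n₇) (f₈ : ZX n₇ n₈)
      (f₉ : ZX n₈ n₉) (f : ZX n₉ n) :
      f₁ ≫ₓ f₂ ≫ₓ f₃ ≫ₓ (f₄ ≫ₓ f₅ ≫ₓ (f₆ ≫ₓ f₇)) ≫ₓ f₈ ≫ₓ f₉ ≫ₓ f =
        ((f₁ ≫ₓ f₂) ≫ₓ (f₃ ≫ₓ f₄ ≫ₓ f₅)) ≫ₓ (f₆ ≫ₓ f₇ ≫ₓ f₈ ≫ₓ (f₉ ≫ₓ f)) := by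
    simp only [assoc]
  rw [key, hS, regroup, ev_comp _ _ y hy ha hc, ev_in_spiders _ _ h, ev_out_spiders _ _ h, ev_ends,
    ev_perm_comp, ev_tensorFin]
  have h1 (k : Fin G.I.length) (j : Fin 1) : finCongr hI.symm (finSigmaFinEquiv ⟨k, j⟩) = k := by
    rw [finSigmaFinEquiv_one hI]
    rfl
  have h2 (k : Fin G.I.length) (j : Fin 1) : (finCongr hI).symm (finSigmaFinEquiv ⟨k, j⟩) = k :=
    h1 k j
  simp only [h1, h2]
  rfl

end MBQCLCGraph

/-! ### The function of a graph in terms of vertex names -/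

namespace MBQCLCGraph

open ZX Fn

variable {VS : Type u} {N : ℕ}

open Classical in
/-- The factor of the input wire at a vertex. -/
noncomputable def inF (G : MBQCLCGraph VS) (ia : VS → Fin N) (v : VS) (x : Fin N) : Fn N :=
  if h : v ∈ G.I then ev (lc (G.li ⟨v, h⟩)) (fun _ => ia v) fun _ => x else 1

open Classical in
/-- The factor of the output wire or of the measurement at a vertex. -/
noncomputable def outF (G : MBQCLCGraph VS) (oa : VS → Fin N) (v : VS) (x : Fin N) : Fn N :=
  if h : v ∈ G.O then ev (lc (G.lo ⟨v, h⟩)) (fun _ => x) fun _ => oa v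
  else if h' : v ∈ G.V then at' (eff (G.meas ⟨v, h', h⟩)) fun _ => x else 1

open Classical in
/-- The factor of an edge. -/
noncomputable def edF (E : SimpleGraph VS) (η : VS → Fin N) (e : Sym2 VS) : Fn N :=
  if e ∈ E.edgeSet then hs η e else 1

open Classical in
/-- The function of a graph, where `ia`, `oa` and `η` name the variables at the input wires, at the
output wires and at the vertices. -/
noncomputable def sem (G : MBQCLCGraph VS) (ia oa η : VS → Fin N) : Fn N :=
  Es (G.V.image η) ((∏ v ∈ G.V, inF G ia v (η v)) * (∏ v ∈ G.V, outF G oa v (η v)) *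
    ∏ e ∈ G.V.sym2, edF G.E η e)

/-- The variables at the vertices in `W` are distinct, and distinct from those at the wires. -/
structure Naming (W : Finset VS) (ia oa η : VS → Fin N) : Prop where
  injOn : Set.InjOn η W
  ia_ne : ∀ v w, ia v ≠ η w
  oa_ne : ∀ v w, oa v ≠ η w

theorem prod_get {α M : Type*} [CommMonoid M] [DecidableEq α] {l : List α} (hl : l.Nodup)
    (F : α → M) : ∏ k : Fin l.length, F (l.get k) = ∏ v ∈ l.toFinset, F v := by
  rw [List.prod_toFinset F hl]
  exact Fin.prod_univ_fun_getElem l F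

/-- Replaces the arbitrary enumerations in the diagram by products over vertices and unordered
pairs. Every later comparison of graphs takes place in this form. -/
theorem ev_toZX {G : MBQCLCGraph VS} {ia oa η : VS → Fin N} (h : Naming G.V ia oa η) :
    ev (ZX.mk G.toZX) (fun k => ia (G.I.get k)) (fun k => oa (G.O.get k)) = sem G ia oa η := by
  classical
  have hvtx (i : Fin G.V.card) : (G.vtx i).1 ∈ G.V := (G.vtx i).2
  rw [G.ev_toZX_wires (fun i => η (G.vtx i).1) (fun i j hij => G.vtx.injective
    (Subtype.ext (h.injOn (hvtx i) (hvtx j) hij))) _ _ (fun i j => h.ia_ne _ _)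
    (fun i j => h.oa_ne _ _), sem, mul_assoc (∏ v ∈ G.V, _)]
  have hV : Finset.univ.image (fun i => η (G.vtx i).1) = G.V.image η := by
    ext x
    simp only [Finset.mem_image, Finset.mem_univ, true_and]
    constructor
    · rintro ⟨i, rfl⟩
      exact ⟨_, hvtx i, rfl⟩
    · rintro ⟨v, hv, rfl⟩
      exact ⟨G.vtx.symm ⟨v, hv⟩, by rw [Equiv.apply_symm_apply]⟩
  rw [hV]
  congr 2
  · have hI : ∏ v ∈ G.V, inF G ia v (η v) = ∏ v ∈ G.I.toFinset, inF G ia v (η v) := by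
      refine (Finset.prod_subset (fun v hv => G.I_sub v (List.mem_toFinset.1 hv)) ?_).symm
      intro v _ hv
      exact dif_neg fun h => hv (List.mem_toFinset.2 h)
    rw [hI, ← prod_get G.I_nodup fun v => inF G ia v (η v)]
    refine Finset.prod_congr rfl fun k _ => ?_
    rw [inF, dif_pos (List.get_mem _ _), inputVertex, Equiv.apply_symm_apply]
  rw [← mul_assoc]
  congr 1
  · rw [← Finset.prod_filter_mul_prod_filter_not G.V (· ∈ G.O)]
    congr 1
    · have hO : G.V.filter (· ∈ G.O) = G.O.toFinset := by
        ext v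
        simp only [Finset.mem_filter, List.mem_toFinset, and_iff_right_iff_imp]
        exact G.O_sub v
      rw [hO, ← prod_get G.O_nodup fun v => outF G oa v (η v)]
      refine Finset.prod_congr rfl fun k _ => ?_
      rw [outF, dif_pos (List.get_mem _ _), outputVertex, Equiv.apply_symm_apply]
    · refine Finset.prod_bij (fun i _ => (G.vtx ((Finite.equivFin G.Measured).symm i).1).1)
        (fun i _ => Finset.mem_filter.2 ⟨hvtx _, ((Finite.equivFin G.Measured).symm i).2⟩) ?_ ?_ ?_
      · intro i _ j _ hij
        exact (Finite.equivFin G.Measured).symm.injective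
          (Subtype.ext (G.vtx.injective (Subtype.ext hij)))
      · intro v hv
        rw [Finset.mem_filter] at hv
        refine ⟨Finite.equivFin G.Measured ⟨G.vtx.symm ⟨v, hv.1⟩, ?_⟩, Finset.mem_univ _, ?_⟩
        · rw [Equiv.apply_symm_apply]; exact hv.2
        · rw [Equiv.symm_apply_apply, Equiv.apply_symm_apply]
      · intro i _
        rw [outF, dif_neg ((Finite.equivFin G.Measured).symm i).2, dif_pos (hvtx _)]
  · have hE : ∏ e ∈ G.V.sym2, edF G.E η e = ∏ e ∈ G.V.sym2.filter (· ∈ G.E.edgeSet), hs η e := by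
      rw [Finset.prod_filter]
      rfl
    rw [hE]
    have inj {i j : Fin G.V.card} (h : (G.vtx i).1 = (G.vtx j).1) : i = j :=
      G.vtx.injective (Subtype.ext h)
    have inj2 (p q : G.Edges) (h : s((G.vtx p.1.1).1, (G.vtx p.1.2).1) =
        s((G.vtx q.1.1).1, (G.vtx q.1.2).1)) : p = q := by
      rcases Sym2.eq_iff.1 h with ⟨h1, h2⟩ | ⟨h1, h2⟩
      · exact Subtype.ext (Prod.ext (inj h1) (inj h2))
      · exact absurd p.2.1 (inj h1 ▸ inj h2 ▸ q.2.1.asymm)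
    refine Finset.prod_bij (fun i _ => s((G.vtx ((Finite.equivFin G.Edges).symm i).1.1).1,
      (G.vtx ((Finite.equivFin G.Edges).symm i).1.2).1)) ?_ ?_ ?_ ?_
    · intro i _
      rw [Finset.mem_filter, Finset.mk_mem_sym2_iff, SimpleGraph.mem_edgeSet]
      exact ⟨⟨hvtx _, hvtx _⟩, ((Finite.equivFin G.Edges).symm i).2.2⟩
    · intro i _ j _ hij
      refine (Finite.equivFin G.Edges).symm.injective (inj2 _ _ hij)
    · intro e he
      induction e using Sym2.ind with | _ v w =>
      rw [Finset.mem_filter, Finset.mk_mem_sym2_iff, SimpleGraph.mem_edgeSet] at he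
      obtain ⟨⟨hv, hw⟩, hvw⟩ := he
      rcases lt_trichotomy (G.vtx.symm ⟨v, hv⟩) (G.vtx.symm ⟨w, hw⟩) with hlt | heq | hlt
      · refine ⟨Finite.equivFin G.Edges ⟨(_, _), hlt, ?_⟩, Finset.mem_univ _, ?_⟩
        · rw [Equiv.apply_symm_apply, Equiv.apply_symm_apply]; exact hvw
        · simp only [Equiv.symm_apply_apply, Equiv.apply_symm_apply]
      · exact absurd (congrArg Subtype.val (G.vtx.symm.injective heq)) hvw.ne
      · refine ⟨Finite.equivFin G.Edges ⟨(_, _), hlt, ?_⟩, Finset.mem_univ _, ?_⟩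
        · rw [Equiv.apply_symm_apply, Equiv.apply_symm_apply]; exact hvw.symm
        · simp only [Equiv.symm_apply_apply, Equiv.apply_symm_apply]; exact Sym2.eq_swap
    · intro i _
      rw [hs_mk]

/-- Four disjoint blocks of variables serve vertices, inputs, outputs and auxiliary variables. `s`
and `c` are the auxiliary ones needed for local complementation; `s` alone serves input expansion.
-/
theorem exists_naming (W : Finset VS) : ∃ (N : ℕ) (ia oa η : VS → Fin N) (s c : Fin N),
    Naming W ia oa η ∧ Set.InjOn ia W ∧ Set.InjOn oa W ∧ (∀ v w, ia v ≠ oa w) ∧ s ≠ c ∧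
    (∀ v, η v ≠ s) ∧ (∀ v, η v ≠ c) ∧ (∀ v, ia v ≠ s) ∧ (∀ v, oa v ≠ s) := by
  classical
  -- The default value for names outside `W` is harmless: injectivity is needed only on `W`, and
  -- different blocks never meet. The two extra places make room for `s` and `c` even if `W` is
  -- empty.
  let e (v : VS) : Fin (W.card + 2) :=
    if h : v ∈ W then Fin.castAdd 2 (W.equivFin ⟨v, h⟩) else 0
  have he : Set.InjOn e W := by
    intro v hv w hw h
    simp only [e, dif_pos (Finset.mem_coe.1 hv), dif_pos (Finset.mem_coe.1 hw)] at h
    exact congrArg Subtype.val (W.equivFin.injective (Fin.castAdd_injective _ _ h))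
  let f (i : Fin 4) (j : Fin (W.card + 2)) : Fin (4 * (W.card + 2)) := finProdFinEquiv (i, j)
  have hf {i j : Fin 4} (hij : i ≠ j) (k l : Fin (W.card + 2)) : f i k ≠ f j l := fun h =>
    hij (congrArg Prod.fst (finProdFinEquiv.injective h))
  have hf' (i : Fin 4) : Set.InjOn (fun v => f i (e v)) W := fun v hv w hw h =>
    he hv hw (congrArg Prod.snd (finProdFinEquiv.injective h))
  refine ⟨_, fun v => f 1 (e v), fun v => f 2 (e v), fun v => f 0 (e v), f 3 0, f 3 1,
    ⟨hf' 0, fun _ _ => hf (by decide) _ _, fun _ _ => hf (by decide) _ _⟩, hf' 1, hf' 2,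
    fun _ _ => hf (by decide) _ _, fun h => ?_, fun _ => hf (by decide) _ _,
    fun _ => hf (by decide) _ _, fun _ => hf (by decide) _ _, fun _ => hf (by decide) _ _⟩
  have := congrArg Prod.snd (finProdFinEquiv.injective h)
  simp at this

/-- The diagrams of two graphs agree up to a cast. -/
def SameZX (G G' : MBQCLCGraph VS) : Prop :=
  ∃ (hI : G'.I.length = G.I.length) (hO : G'.O.length = G.O.length),
    ZX.mk G'.toZX = perm (finCongr hI) ≫ₓ ZX.mk G.toZX ≫ₓ perm (finCongr hO.symm)

theorem SameZX.trans {G G' G'' : MBQCLCGraph VS} (h : SameZX G G') (h' : SameZX G' G'') :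
    SameZX G G'' := by
  obtain ⟨hI, hO, h⟩ := h
  obtain ⟨hI', hO', h'⟩ := h'
  refine ⟨hI'.trans hI, hO'.trans hO, ?_⟩
  rw [h', h, assoc, assoc, perm_comp, ← assoc, ← assoc, perm_comp]
  rfl

/-- The names of wires and vertices may differ between the two graphs, as long as the `k`-th wires
carry the same variables. -/
theorem sameZX_of_sem {G G' : MBQCLCGraph VS} (hI : G'.I.length = G.I.length)
    (hO : G'.O.length = G.O.length) {ia oa η ia' oa' η' : VS → Fin N} (h : Naming G.V ia oa η)
    (h' : Naming G'.V ia' oa' η') (hi : Set.InjOn ia G.V) (ho : Set.InjOn oa G.V)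
    (hio : ∀ v w, ia v ≠ oa w)
    (hia : ∀ k, ia' (G'.I.get k) = ia (G.I.get (finCongr hI k)))
    (hoa : ∀ k, oa' (G'.O.get k) = oa (G.O.get (finCongr hO k)))
    (hsem : sem G' ia' oa' η' = sem G ia oa η) : SameZX G G' := by
  refine ⟨hI, hO, ?_⟩
  have hinj {l : List VS} (hl : l.Nodup) (hl' : ∀ x ∈ l, x ∈ G.V) {f : VS → Fin N}
      (hf : Set.InjOn f G.V) {k : ℕ} (hk : k = l.length) :
      Function.Injective fun i => f (l.get (finCongr hk i)) := by
    intro i j hij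
    exact (finCongr hk).injective (List.nodup_iff_injective_get.1 hl
      (hf (hl' _ (List.get_mem _ _)) (hl' _ (List.get_mem _ _)) hij))
  refine ev_injective (hinj G.I_nodup G.I_sub hi hI) (hinj G.O_nodup G.O_sub ho hO)
    (fun _ _ => hio _ _) ?_
  have e1 := ev_toZX h'
  simp only [hia, hoa] at e1
  rw [e1, hsem, ev_comp_perm, ev_perm_comp, ← ev_toZX h]
  rfl

end MBQCLCGraph

/-! ### Local complementation and removal as identities of functions -/

namespace Fn

open ZX

variable {N : ℕ}

/-- Renaming of a bound variable: insert an equality of `x` and `s`, and sum it out in either order.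
-/
theorem E_rename {x s : Fin N} (h : s ≠ x) {f : Fn N} (hf : Indep x f) :
    E x (sub s x f) = E s f := by
  rw [← E_dlt_mul h, E_comm, hf.E_mul', E_dlt h.symm, one_mul]

theorem prod_hf_sub {ι : Type*} (f : ι → Fin N) (T : Finset ι) {x s : Fin N}
    (hs : ∀ w ∈ T, f w ≠ s) : sub s x (∏ w ∈ T, hf s (f w)) = ∏ w ∈ T, hf x (f w) := by
  rw [sub, at_prod]
  refine Finset.prod_congr rfl fun w hw => ?_
  rw [at_hf, if_pos rfl, if_neg (hs w hw)]

open Classical in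
/-- Local complementation for functions. -/
theorem E_localComp {ι : Type*} (f : ι → Fin N) (T : Finset ι) {x s c : Fin N} (Φ : Fin N → Fn N)
    (hx : ∀ w ∈ T, f w ≠ x) (hs : ∀ w ∈ T, f w ≠ s) (hc : ∀ w ∈ T, f w ≠ c) (hsx : s ≠ x)
    (hcx : c ≠ x) (hsc : s ≠ c) (hΦx : sub s x (Φ s) = Φ x) (hΦ : Indep x (Φ s)) :
    E x (E s (zf (-halfPi) x * hf x s * zf (-halfPi) s * Φ s) * ∏ w ∈ T, hf x (f w)) *
      ((∏ w ∈ T, zf (-halfPi) (f w)) * ∏ e ∈ T.sym2, if e.IsDiag then 1 else Fn.hs f e) =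
    E x (Φ x * ∏ w ∈ T, hf x (f w)) := by
  have hr : E x (Φ x * ∏ w ∈ T, hf x (f w)) = E s (Φ s * ∏ w ∈ T, hf s (f w)) := by
    rw [← E_rename hsx (hΦ.mul (.prod fun w hw => indep_hf hsx (hx w hw))), sub_mul, hΦx,
      prod_hf_sub f T hs]
  have hB : Indep s (∏ w ∈ T, hf x (f w)) := .prod fun w hw => indep_hf hsx.symm (hs w hw)
  -- Exchanging the sums, the one over `x` is a Gauss sum, which moves the signs from `x` to `s`.
  -- The phases it creates on `s` and on the neighbours cancel the given ones, the pairwise signs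
  -- square to `1`, and `s` has taken over the role of `x`.
  have h1 : E x (E s (zf (-halfPi) x * hf x s * zf (-halfPi) s * Φ s) * ∏ w ∈ T, hf x (f w)) =
      E s (E x ((zf (-halfPi) s * Φ s) *
        (zf (-halfPi) x * (hf x s * ∏ w ∈ T, hf x (f w))))) := by
    rw [← hB.E_mul', E_comm]
    congr 2
    ac_rfl
  rw [h1, ((indep_zf hsx).mul hΦ).E_mul, E_prod_hf f T hx hs hc hsx hcx hsc, hr]
  generalize hK : (∏ e ∈ T.sym2, if e.IsDiag then 1 else Fn.hs f e) = K
  have hK2 : K * K = 1 := by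
    rw [← hK, ← Finset.prod_mul_distrib]
    refine Finset.prod_eq_one fun e _ => ?_
    split_ifs
    · exact one_mul 1
    · exact hs_mul_self f e
  have hKs : Indep s K := hK ▸ .prod fun e he => by
    split_ifs
    · exact indep_one s
    · induction e using Sym2.ind with | _ v w =>
      rw [Finset.mk_mem_sym2_iff] at he
      exact indep_hf (hs v he.1) (hs w he.2)
  have h2 : zf (-halfPi) s * Φ s * (zf halfPi s * (∏ w ∈ T, hf s (f w)) *
      (∏ w ∈ T, zf halfPi (f w)) * K) =
      (zf (-halfPi) s * zf halfPi s) * (Φ s * ∏ w ∈ T, hf s (f w)) *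
        ((∏ w ∈ T, zf halfPi (f w)) * K) := by ac_rfl
  have h3 : Indep s ((∏ w ∈ T, zf halfPi (f w)) * K) :=
    (Indep.prod fun w hw => indep_zf (hs w hw)).mul hKs
  have h4 : (∏ w ∈ T, zf halfPi (f w)) * (∏ w ∈ T, zf (-halfPi) (f w)) = (1 : Fn N) := by
    rw [← Finset.prod_mul_distrib]
    refine Finset.prod_eq_one fun w _ => ?_
    rw [zf_mul, add_neg_cancel, zf_zero]
  rw [h2, zf_mul, neg_add_cancel, zf_zero, one_mul, h3.E_mul', mul_assoc, mul_mul_mul_comm, h4, hK2,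
    one_mul, mul_one]

theorem xf_mul_prod_hf {ι : Type*} (f : ι → Fin N) (T : Finset ι) (a : Fin 2) (x : Fin N) :
    xf ((a : ℕ) • (π : Real.Angle)) x * ∏ w ∈ T, hf x (f w) =
      xf ((a : ℕ) • (π : Real.Angle)) x * ∏ w ∈ T, zf ((a : ℕ) • (π : Real.Angle)) (f w) := by
  classical
  induction T using Finset.induction_on with
  | empty => rfl
  | insert w T hw ih =>
    rw [Finset.prod_insert hw, Finset.prod_insert hw, mul_left_comm, ih, mul_left_comm, ← mul_assoc,
      xf_mul_hf, mul_assoc]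

end Fn

/-! ### Local complementation of graphs -/

namespace MBQCLCGraph

open ZX Fn

variable {VS : Type u} {N : ℕ}

open Classical in
theorem prod_edF_insert (E : SimpleGraph VS) (η : VS → Fin N) {u : VS} {W : Finset VS} (hu : u ∉ W) :
    ∏ e ∈ (insert u W).sym2, edF E η e =
      (∏ b ∈ W.filter (E.Adj u), hf (η u) (η b)) * ∏ e ∈ W.sym2, edF E η e := by
  rw [Finset.prod_sym2_insert hu, edF, if_neg, one_mul, Finset.prod_filter]
  · rfl
  · exact fun h => E.loopless.irrefl u h

open Classical in
-- A symmetric difference of edge sets becomes a product because the sign of a doubled edge is `1`,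
-- by the Hopf law.
theorem prod_edF_localComp (E : SimpleGraph VS) (η : VS → Fin N) (u : VS) (W : Finset VS) :
    ∏ e ∈ W.sym2, edF (E.localComp u) η e = (∏ e ∈ W.sym2, edF E η e) *
      ∏ e ∈ (W.filter (E.Adj u)).sym2, if e.IsDiag then 1 else hs η e := by
  have h1 : (∏ e ∈ (W.filter (E.Adj u)).sym2, if e.IsDiag then 1 else hs η e) =
      ∏ e ∈ W.sym2, edF (E.nbrClique u) η e := by
    refine (Finset.prod_congr rfl ?_).trans
      (Finset.prod_subset (Finset.sym2_mono (Finset.filter_subset _ _)) ?_)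
    · intro e he
      induction e using Sym2.ind with | _ v w =>
      simp only [Finset.mk_mem_sym2_iff, Finset.mem_filter] at he
      rw [edF]
      by_cases hvw : v = w
      · rw [if_pos (Sym2.mk_isDiag_iff.2 hvw), if_neg]
        exact fun h => h.2 hvw
      · rw [if_neg (fun h => hvw (Sym2.mk_isDiag_iff.1 h)), if_pos]
        exact ⟨⟨he.1.2, he.2.2⟩, hvw⟩
    · intro e he he'
      induction e using Sym2.ind with | _ v w =>
      simp only [Finset.mk_mem_sym2_iff, Finset.mem_filter] at he he'
      exact if_neg fun h => he' ⟨⟨he.1, h.1.1⟩, ⟨he.2, h.1.2⟩⟩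
  rw [h1, ← Finset.prod_mul_distrib]
  refine Finset.prod_congr rfl fun e _ => ?_
  induction e using Sym2.ind with | _ v w =>
  have h : s(v, w) ∈ (E.localComp u).edgeSet ↔
      (s(v, w) ∈ E.edgeSet ∧ ¬ s(v, w) ∈ (E.nbrClique u).edgeSet) ∨
        (s(v, w) ∈ (E.nbrClique u).edgeSet ∧ ¬ s(v, w) ∈ E.edgeSet) := Iff.rfl
  rw [edF, edF, edF]
  by_cases h2 : s(v, w) ∈ E.edgeSet <;> by_cases h3 : s(v, w) ∈ (E.nbrClique u).edgeSet <;>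
    simp only [h, h2, h3, not_true, not_false_iff, and_true, and_false, or_false, false_or, if_true,
      if_false, or_self, mul_one, one_mul, hs_mul_self]

theorem localComp_adj_self (E : SimpleGraph VS) (u b : VS) :
    (E.localComp u).Adj u b ↔ E.Adj u b := by
  have h : (E.localComp u).Adj u b ↔ (E.Adj u b ∧ ¬ (E.nbrClique u).Adj u b) ∨
    ((E.nbrClique u).Adj u b ∧ ¬ E.Adj u b) := Iff.rfl
  have h2 : ¬ (E.nbrClique u).Adj u b := fun h => E.loopless.irrefl u h.1.1
  rw [h]
  tauto

theorem sub_outF (G : MBQCLCGraph VS) {oa : VS → Fin N} {s : Fin N} (x : Fin N) (v : VS)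
    (h : oa v ≠ s) : sub s x (outF G oa v s) = outF G oa v x := by
  rw [outF, outF]
  split_ifs
  · rw [sub_ev, if_pos rfl, if_neg h]
  · rw [sub_at, if_pos rfl]
  · exact at_one _

theorem indep_outF (G : MBQCLCGraph VS) {oa : VS → Fin N} {x y : Fin N} (v : VS) (h : oa v ≠ x)
    (hy : y ≠ x) : Indep x (outF G oa v y) := by
  rw [outF]
  split_ifs
  · exact indep_ev _ (fun _ => hy) fun _ => h
  · exact indep_at _ fun _ => hy
  · exact indep_one x

theorem indep_inF (G : MBQCLCGraph VS) {ia : VS → Fin N} {x y : Fin N} (v : VS) (h : ia v ≠ x)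
    (hy : y ≠ x) : Indep x (inF G ia v y) := by
  rw [inF]
  split_ifs
  · exact indep_ev _ (fun _ => h) fun _ => hy
  · exact indep_one x

theorem indep_edF (E : SimpleGraph VS) {η : VS → Fin N} {x : Fin N} {W : Finset VS}
    (h : ∀ v ∈ W, η v ≠ x) : Indep x (∏ e ∈ W.sym2, edF E η e) := .prod fun e he => by
  rw [edF]
  split_ifs
  · induction e using Sym2.ind with | _ v w =>
    rw [Finset.mk_mem_sym2_iff] at he
    exact indep_hf (h v he.1) (h w he.2)
  · exact indep_one x

/-- For an output and for a measurement alike, the new label is the old one preceded by `X(π/2)`;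
`s` is the variable on the wire between them. -/
theorem outF_localComp_self (G : MBQCLCGraph VS) {u : VS} (hu : u ∈ G.V) {oa : VS → Fin N}
    {x s : Fin N} (hx : x ≠ s) (hs : oa u ≠ s) : outF (G.localCompNonInput u) oa u x =
      E s (zf (-halfPi) x * hf x s * zf (-halfPi) s * outF G oa u s) := by
  rw [outF, outF, ← ev_X_halfPi]
  by_cases h : u ∈ G.O
  · have h' : u ∈ (G.localCompNonInput u).O := h
    rw [dif_pos h', dif_pos h, ← ev_comp_one _ _ (fun _ => hx) (fun _ => hs), ← lc_rHalf_mul]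
    congr 2
    exact if_pos rfl
  · have h' : u ∉ (G.localCompNonInput u).O := h
    have hu' : u ∈ (G.localCompNonInput u).V := hu
    rw [dif_neg h', dif_neg h, dif_pos hu, dif_pos hu', ← ev_effect _ _ Fin.elim0,
      ← ev_effect _ _ Fin.elim0, ← ev_comp_one _ _ (fun _ => hx) (fun i => i.elim0),
      X_halfPi_comp_eff]
    congr 2
    exact if_pos rfl

theorem outF_localComp_nbr (G : MBQCLCGraph VS) {u v : VS} (hv : v ∈ G.V) (huv : G.E.Adj u v)
    {oa : VS → Fin N} (x : Fin N) : outF (G.localCompNonInput u) oa v x =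
      outF G oa v x * zf (-halfPi) x := by
  rw [outF, outF, mul_comm]
  have hne : v ≠ u := huv.ne'
  by_cases h : v ∈ G.O
  · have h' : v ∈ (G.localCompNonInput u).O := h
    rw [dif_pos h', dif_pos h, ← ev_Z_comp, ← lc_gNegHalf_mul]
    congr 2
    exact (if_neg hne).trans (if_pos huv)
  · have h' : v ∉ (G.localCompNonInput u).O := h
    have hv' : v ∈ (G.localCompNonInput u).V := hv
    rw [dif_neg h', dif_neg h, dif_pos hv, dif_pos hv', ← ev_effect _ _ Fin.elim0,
      ← ev_effect _ _ Fin.elim0, ← ev_Z_comp, Z_neg_halfPi_comp_eff]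
    congr 2
    exact (if_neg hne).trans (if_pos huv)

theorem outF_localComp_of_not_adj (G : MBQCLCGraph VS) {u v : VS} (hv : v ∈ G.V) (hne : v ≠ u)
    (huv : ¬ G.E.Adj u v) {oa : VS → Fin N} (x : Fin N) :
    outF (G.localCompNonInput u) oa v x = outF G oa v x := by
  rw [outF, outF]
  by_cases h : v ∈ G.O
  · have h' : v ∈ (G.localCompNonInput u).O := h
    rw [dif_pos h', dif_pos h]
    congr 2
    exact (if_neg hne).trans (if_neg huv)
  · have h' : v ∉ (G.localCompNonInput u).O := h
    have hv' : v ∈ (G.localCompNonInput u).V := hv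
    rw [dif_neg h', dif_neg h, dif_pos hv, dif_pos hv']
    congr 2
    exact (if_neg hne).trans (if_neg huv)

open Classical in
/-- The function of a graph, with the sum over the variable at one vertex inside. -/
theorem sem_eq (G : MBQCLCGraph VS) {u : VS} {W : Finset VS} (hu : u ∉ W) (hV : G.V = insert u W)
    {ia oa η : VS → Fin N} (h : Naming G.V ia oa η) :
    sem G ia oa η = Es (W.image η) ((∏ v ∈ W, inF G ia v (η v)) * (∏ v ∈ W, outF G oa v (η v)) *
      (∏ e ∈ W.sym2, edF G.E η e) *
      E (η u) (inF G ia u (η u) * outF G oa u (η u) *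
        ∏ b ∈ W.filter (G.E.Adj u), hf (η u) (η b))) := by
  have hne (v : VS) (hv : v ∈ W) : η v ≠ η u := fun h' => hu (by
    rwa [← h.injOn (by rw [hV]; exact Finset.mem_insert_of_mem hv)
      (by rw [hV]; exact Finset.mem_insert_self _ _) h'])
  have hx : η u ∉ W.image η := by
    intro h'
    obtain ⟨v, hv, h'⟩ := Finset.mem_image.1 h'
    exact hne v hv h'
  rw [sem, hV, Finset.image_insert, Es_insert hx, E_Es, Finset.prod_insert hu,
    Finset.prod_insert hu, prod_edF_insert _ _ hu]
  congr 1
  have hi : Indep (η u) ((∏ v ∈ W, inF G ia v (η v)) * (∏ v ∈ W, outF G oa v (η v)) *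
      (∏ e ∈ W.sym2, edF G.E η e)) :=
    ((Indep.prod fun v hv => indep_inF G v (h.ia_ne _ _) (hne v hv)).mul
      (.prod fun v hv => indep_outF G v (h.oa_ne _ _) (hne v hv))).mul (indep_edF _ hne)
  rw [← hi.E_mul]
  congr 1
  ac_rfl

/-- Isolate the sum over the variable of `u`. The new phases on the neighbours and the toggled edges
among them are exactly the correction in `E_localComp`. -/
theorem sem_localComp (G : MBQCLCGraph VS) {u : VS} (hu : u ∈ G.V) (hI : u ∉ G.I)
    {ia oa η : VS → Fin N} (h : Naming G.V ia oa η) {s c : Fin N} (hsc : s ≠ c)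
    (hs : ∀ v, η v ≠ s) (hc : ∀ v, η v ≠ c) (hs' : ∀ v, oa v ≠ s) :
    sem (G.localCompNonInput u) ia oa η = sem G ia oa η := by
  classical
  have hV : G.V = insert u (G.V.erase u) := (Finset.insert_erase hu).symm
  have hu' : u ∉ G.V.erase u := Finset.notMem_erase _ _
  rw [sem_eq G hu' hV h, sem_eq (G.localCompNonInput u) hu' hV h]
  generalize hW : G.V.erase u = W at *
  have hWV (v : VS) (hv : v ∈ W) : v ≠ u ∧ v ∈ G.V := by rwa [← hW, Finset.mem_erase] at hv
  have hT : W.filter ((G.localCompNonInput u).E.Adj u) = W.filter (G.E.Adj u) :=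
    Finset.filter_congr fun b _ => localComp_adj_self G.E u b
  have hE : ∏ e ∈ W.sym2, edF (G.localCompNonInput u).E η e = _ :=
    prod_edF_localComp G.E η u W
  have hout : ∏ v ∈ W, outF (G.localCompNonInput u) oa v (η v) = (∏ v ∈ W, outF G oa v (η v)) *
      ∏ v ∈ W.filter (G.E.Adj u), zf (-halfPi) (η v) := by
    rw [Finset.prod_filter, ← Finset.prod_mul_distrib]
    refine Finset.prod_congr rfl fun v hv => ?_
    split_ifs with huv
    · exact outF_localComp_nbr G (hWV v hv).2 huv _
    · rw [mul_one, outF_localComp_of_not_adj G (hWV v hv).2 (hWV v hv).1 huv]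
  have hin (v : VS) (x : Fin N) : inF (G.localCompNonInput u) ia v x = inF G ia v x := rfl
  have hin' (x : Fin N) : inF G ia u x = 1 := dif_neg hI
  have hne (v : VS) (hv : v ∈ W.filter (G.E.Adj u)) : η v ≠ η u := fun h' => by
    have hv' := hWV v (Finset.mem_filter.1 hv).1
    exact hv'.1 (h.injOn hv'.2 hu h')
  have key := E_localComp η (W.filter (G.E.Adj u)) (x := η u) (outF G oa u) hne
    (fun v _ => hs v) (fun v _ => hc v) (hs u).symm (hc u).symm hsc (sub_outF G _ u (hs' u))
    (indep_outF G u (h.oa_ne _ _) (hs u).symm)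
  rw [hT, hE, hout, ← outF_localComp_self G hu (hs u) (hs' u)] at *
  simp only [hin, hin', one_mul]
  rw [← key]
  congr 1
  ac_rfl

end MBQCLCGraph

namespace MBQCLCGraph

open ZX Fn

variable {VS : Type u} {N : ℕ}

/-! ### Vertex removal -/

theorem outF_removeVertex (G : MBQCLCGraph VS) {u v : VS} (hI : u ∉ G.I) (hO : u ∉ G.O) (a : Fin 2)
    (hv : v ∈ G.V) (hvu : v ≠ u) {oa : VS → Fin N} (x : Fin N) :
    (G.E.Adj u v → outF (G.removeVertex u hI hO a) oa v x =
      outF G oa v x * zf ((a : ℕ) • (π : Real.Angle)) x) ∧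
    (¬ G.E.Adj u v → outF (G.removeVertex u hI hO a) oa v x = outF G oa v x) := by
  classical
  rw [outF, outF]
  by_cases h : v ∈ G.O
  · have h' : v ∈ (G.removeVertex u hI hO a).O := h
    rw [dif_pos h', dif_pos h]
    refine ⟨fun huv => ?_, fun huv => ?_⟩
    · rw [mul_comm, ← ev_Z_comp, ← lc_g_pow_mul]
      congr 2
      exact if_pos huv
    · congr 2
      exact if_neg huv
  · have h' : v ∉ (G.removeVertex u hI hO a).O := h
    have hv' : v ∈ (G.removeVertex u hI hO a).V := Finset.mem_erase.2 ⟨hvu, hv⟩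
    rw [dif_neg h', dif_neg h, dif_pos hv, dif_pos hv']
    refine ⟨fun huv => ?_, fun huv => ?_⟩
    · rw [mul_comm, ← ev_effect _ _ Fin.elim0, ← ev_effect _ _ Fin.elim0, ← ev_Z_comp, Z_comp_eff]
      congr 2
      exact if_pos huv
    · congr 2
      exact if_neg huv

/-- At the angle `aπ` the X-effect absorbs the additional Z-phase, so the planes `XZ` and `YZ` give
the same effect and need no separate treatment in vertex removal. -/
theorem at_eff_XZ (a : Fin 2) (x : Fin N) :
    at' (eff (.XZ, (a : ℕ) • (π : Real.Angle))) (fun _ => x) =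
      xf ((a : ℕ) • (π : Real.Angle)) x := by
  rw [eff_XZ, ← ev_effect _ _ Fin.elim0, ev_Z_comp, ev_effect, mul_comm]
  exact xf_mul_zf a _ x

/-- The measurement sets the variable of `u` to `a`. The edges at `u` then become phases `aπ` on its
neighbours, and the sum over the variable of `u` is `1`. -/
theorem sem_removeVertex (G : MBQCLCGraph VS) {u : VS} (hV : u ∈ G.V) (hI : u ∉ G.I) (hO : u ∉ G.O)
    (a : Fin 2) (hm : G.meas ⟨u, hV, hO⟩ = (.YZ, (a : ℕ) • (π : Real.Angle)) ∨
      G.meas ⟨u, hV, hO⟩ = (.XZ, (a : ℕ) • (π : Real.Angle)))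
    {ia oa η : VS → Fin N} (h : Naming G.V ia oa η) :
    sem (G.removeVertex u hI hO a) ia oa η = sem G ia oa η := by
  classical
  have hu' : u ∉ G.V.erase u := Finset.notMem_erase _ _
  rw [sem_eq G hu' (Finset.insert_erase hV).symm h, sem]
  have hVW : (G.removeVertex u hI hO a).V = G.V.erase u := rfl
  rw [hVW]
  have hWV (v : VS) (hv : v ∈ G.V.erase u) : v ≠ u ∧ v ∈ G.V := Finset.mem_erase.1 hv
  generalize G.V.erase u = W at *
  have hne (v : VS) (hv : v ∈ W) : η v ≠ η u := fun h' =>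
    (hWV v hv).1 (h.injOn (hWV v hv).2 hV h')
  have hu : outF G oa u (η u) = xf ((a : ℕ) • (π : Real.Angle)) (η u) := by
    rw [outF, dif_neg hO, dif_pos hV]
    rcases hm with hm | hm <;> rw [hm]
    · rfl
    · exact at_eff_XZ a _
  have hz : Indep (η u) (∏ b ∈ W.filter (G.E.Adj u), zf ((a : ℕ) • (π : Real.Angle)) (η b)) :=
    .prod fun b hb => indep_zf (hne b (Finset.mem_filter.1 hb).1)
  have hin' (x : Fin N) : inF G ia u x = 1 := dif_neg hI
  rw [hin', one_mul, hu, xf_mul_prod_hf, hz.E_mul', E_xf, one_mul]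
  have hE : ∏ e ∈ W.sym2, edF (G.removeVertex u hI hO a).E η e = ∏ e ∈ W.sym2, edF G.E η e := by
    refine Finset.prod_congr rfl fun e he => ?_
    rw [edF, edF]
    refine if_congr ?_ rfl rfl
    induction e using Sym2.ind with | _ v w =>
    rw [Finset.mk_mem_sym2_iff] at he
    have : (G.removeVertex u hI hO a).E.Adj v w ↔ _ := SimpleGraph.deleteIncidenceSet_adj
    rw [SimpleGraph.mem_edgeSet, SimpleGraph.mem_edgeSet, this]
    exact ⟨fun h => h.1, fun h => ⟨h, (hWV v he.1).1, (hWV w he.2).1⟩⟩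
  have hout : ∏ v ∈ W, outF (G.removeVertex u hI hO a) oa v (η v) =
      (∏ v ∈ W, outF G oa v (η v)) *
        ∏ v ∈ W.filter (G.E.Adj u), zf ((a : ℕ) • (π : Real.Angle)) (η v) := by
    rw [Finset.prod_filter, ← Finset.prod_mul_distrib]
    refine Finset.prod_congr rfl fun v hv => ?_
    have := outF_removeVertex G hI hO a (hWV v hv).2 (hWV v hv).1 (oa := oa) (η v)
    split_ifs with huv
    · exact this.1 huv
    · rw [mul_one, this.2 huv]
  have hin (v : VS) (x : Fin N) : inF (G.removeVertex u hI hO a) ia v x = inF G ia v x := rfl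
  simp only [hE, hout, hin]
  congr 1
  ac_rfl

/-! ### Expansion of an input -/

open Classical in
theorem mem_replaceName_iff {l : List VS} {u u' v : VS} (hu : u ∈ l) :
    v ∈ replaceName l u u' ↔ v = u' ∨ (v ∈ l ∧ v ≠ u) := by
  constructor
  · intro h
    simp only [replaceName, List.mem_map] at h
    obtain ⟨y, hy, rfl⟩ := h
    split_ifs with h
    · exact .inl rfl
    · exact .inr ⟨hy, h⟩
  · rintro (rfl | ⟨h, h'⟩)
    · exact List.mem_map.2 ⟨u, hu, if_pos rfl⟩
    · exact List.mem_map.2 ⟨v, h, if_neg h'⟩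

open Classical in
-- The wire formerly at `u` now ends at `u'`, so the name `u'` is given the wire variable `ia u`.
-- The Hadamard gates from the extended label and from the new edge cancel.
theorem sem_expandInput (G : MBQCLCGraph VS) {u u' : VS} (hu : u ∈ G.I) (hu' : u' ∉ G.V)
    {ia oa η : VS → Fin N} (h : Naming (insert u' G.V) ia oa η) {s : Fin N}
    (hs : ∀ v, η v ≠ s) (hs' : ∀ v, ia v ≠ s) :
    sem (G.expandInput u u' hu hu') (Function.update ia u' (ia u)) oa η = sem G ia oa η := by
  have huV := G.I_sub u hu
  have huu : u ≠ u' := fun h => hu' (h ▸ huV)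
  have hia (v : VS) : Function.update ia u' (ia u) v = if v = u' then ia u else ia v := by
    by_cases hv : v = u'
    · rw [hv, Function.update_self, if_pos rfl]
    · rw [Function.update_of_ne hv, if_neg hv]
  have h2 : Naming (insert u' G.V) (Function.update ia u' (ia u)) oa η := by
    refine ⟨h.injOn, fun v w => ?_, h.oa_ne⟩
    rw [hia]
    split_ifs
    exacts [h.ia_ne _ _, h.ia_ne _ _]
  rw [sem_eq (G.expandInput u u' hu hu') hu' rfl h2, sem]
  have hne (v : VS) (hv : v ∈ G.V) : η v ≠ η u' := fun h' => hu' (by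
    rwa [← h.injOn (Finset.mem_insert_of_mem hv) (Finset.mem_insert_self _ _) h'])
  have hin1 : inF (G.expandInput u u' hu hu') (Function.update ia u' (ia u)) u' (η u') =
      E s (inF G ia u s * hf s (η u')) := by
    have hm : u' ∈ (G.expandInput u u' hu hu').I := (mem_replaceName_iff hu).2 (.inl rfl)
    rw [inF, inF, dif_pos hu, dif_pos hm, Function.update_self]
    refine Eq.trans ?_ (ev_comp_one (lc (G.li ⟨u, hu⟩)) H (fun _ => hs' u) (fun _ => hs u'))
    rw [← lc_mul_euler]
    congr 2
    exact dif_pos rfl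
  have hout1 (x : Fin N) : outF (G.expandInput u u' hu hu') oa u' x = 1 := by
    have hm : u' ∉ (G.expandInput u u' hu hu').O := fun h => hu' (G.O_sub _ h)
    have hm' : u' ∈ (G.expandInput u u' hu hu').V := Finset.mem_insert_self _ _
    rw [outF, dif_neg hm, dif_pos hm', ← zf_zero x, zf, ← eff_XY]
    congr 2
    exact dif_pos rfl
  have hout (v : VS) (hv : v ∈ G.V) (x : Fin N) :
      outF (G.expandInput u u' hu hu') oa v x = outF G oa v x := by
    have hv' : v ∈ (G.expandInput u u' hu hu').V := Finset.mem_insert_of_mem hv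
    have hvu : v ≠ u' := fun h => hu' (h ▸ hv)
    rw [outF, outF]
    by_cases h : v ∈ G.O
    · have h' : v ∈ (G.expandInput u u' hu hu').O := h
      rw [dif_pos h, dif_pos h']
      rfl
    · have h' : v ∉ (G.expandInput u u' hu hu').O := h
      rw [dif_neg h, dif_neg h', dif_pos hv, dif_pos hv']
      congr 2
      exact dif_neg hvu
  have hin (v : VS) (hv : v ∈ G.V) (hvu' : v ≠ u) (x : Fin N) :
      inF (G.expandInput u u' hu hu') (Function.update ia u' (ia u)) v x = inF G ia v x := by
    have hvu : v ≠ u' := fun h => hu' (h ▸ hv)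
    rw [inF, inF, hia, if_neg hvu]
    by_cases h : v ∈ G.I
    · have h' : v ∈ (G.expandInput u u' hu hu').I := (mem_replaceName_iff hu).2 (.inr ⟨h, hvu'⟩)
      rw [dif_pos h, dif_pos h']
      congr 2
      exact dif_neg hvu
    · have h' : v ∉ (G.expandInput u u' hu hu').I := fun h' =>
        ((mem_replaceName_iff hu).1 h').elim hvu fun h'' => h h''.1
      rw [dif_neg h, dif_neg h']
  have hin2 (x : Fin N) :
      inF (G.expandInput u u' hu hu') (Function.update ia u' (ia u)) u x = 1 := by
    refine dif_neg fun h' => ((mem_replaceName_iff hu).1 h').elim huu fun h'' => h''.2 rfl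
  have hadj (v w : VS) : (G.expandInput u u' hu hu').E.Adj v w ↔
      G.E.Adj v w ∨ (SimpleGraph.edge u u').Adj v w := Iff.rfl
  have hE : ∏ e ∈ G.V.sym2, edF (G.expandInput u u' hu hu').E η e = ∏ e ∈ G.V.sym2, edF G.E η e := by
    refine Finset.prod_congr rfl fun e he => ?_
    rw [edF, edF]
    refine if_congr ?_ rfl rfl
    induction e using Sym2.ind with | _ v w =>
    rw [Finset.mk_mem_sym2_iff] at he
    rw [SimpleGraph.mem_edgeSet, SimpleGraph.mem_edgeSet, hadj, SimpleGraph.edge_adj]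
    refine ⟨fun h => h.resolve_right ?_, .inl⟩
    rintro ⟨⟨-, h⟩ | ⟨h, -⟩, -⟩
    · exact hu' (h ▸ he.2)
    · exact hu' (h ▸ he.1)
  have hT : G.V.filter ((G.expandInput u u' hu hu').E.Adj u') = {u} := by
    ext v
    rw [Finset.mem_filter, hadj, SimpleGraph.edge_adj, Finset.mem_singleton]
    constructor
    · rintro ⟨hv, h | ⟨⟨h, -⟩ | ⟨-, h⟩, -⟩⟩
      · exact absurd (G.mem_of_adj _ _ h) hu'
      · exact absurd h.symm huu
      · exact h
    · rintro rfl
      exact ⟨huV, .inr ⟨.inr ⟨rfl, rfl⟩, huu.symm⟩⟩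
  -- Here `s` is the wire between the old label and the Hadamard gate appended to it. Summing out
  -- `u'` gives equality of `s` with the variable of `u`, and the sum over `s` then restores the old
  -- input factor.
  have hA : E (η u') (E s (inF G ia u s * hf s (η u')) * hf (η u') (η u)) = inF G ia u (η u) := by
    rw [← (indep_hf (hs _) (hs _)).E_mul', E_comm]
    simp only [mul_assoc]
    rw [(indep_inF G u (h.ia_ne _ _) (hs u').symm).E_mul,
      E_hf_mul_hf (hs u').symm (hne u huV), mul_comm, E_dlt_mul (hs u).symm]
    rw [inF, inF]
    split_ifs
    rw [sub_ev, if_pos rfl, if_neg (hs' u)]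
  rw [hin1, hout1, mul_one, hT, Finset.prod_singleton, hA, hE, Finset.prod_congr rfl fun v hv =>
    hout v hv (η v), ← Finset.mul_prod_erase G.V _ huV, hin2, one_mul,
    ← Finset.mul_prod_erase G.V (fun v => inF G ia v (η v)) huV,
    Finset.prod_congr rfl fun v hv => hin v (Finset.mem_of_mem_erase hv)
      (Finset.ne_of_mem_erase hv) (η v)]
  congr 1
  ac_rfl

/-! ### Relabelling -/

/-- Carrying the three namings along with `ρ` leaves the set of summed variables and every factor as
they were. -/
theorem sem_relabel (G : MBQCLCGraph VS) (ρ : Equiv.Perm VS) (ia oa η : VS → Fin N) :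
    sem (G.relabel ρ) (ia ∘ ρ.symm) (oa ∘ ρ.symm) (η ∘ ρ.symm) = sem G ia oa η := by
  classical
  have hmem {l : List VS} {v : VS} : ρ v ∈ l.map ρ ↔ v ∈ l :=
    List.mem_map_of_injective ρ.injective
  have hV : (G.relabel ρ).V = G.V.map ρ.toEmbedding := rfl
  have hin (v : VS) (x : Fin N) :
      inF (G.relabel ρ) (ia ∘ ρ.symm) (ρ v) x = inF G ia v x := by
    rw [inF, inF]
    by_cases h : v ∈ G.I
    · have h' : ρ v ∈ (G.relabel ρ).I := hmem.2 h
      rw [dif_pos h, dif_pos h']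
      simp only [relabel, Function.comp, Equiv.symm_apply_apply]
    · have h' : ρ v ∉ (G.relabel ρ).I := fun h' => h (hmem.1 h')
      rw [dif_neg h, dif_neg h']
  have hout (v : VS) (x : Fin N) :
      outF (G.relabel ρ) (oa ∘ ρ.symm) (ρ v) x = outF G oa v x := by
    rw [outF, outF]
    by_cases h : v ∈ G.O
    · have h' : ρ v ∈ (G.relabel ρ).O := hmem.2 h
      rw [dif_pos h, dif_pos h']
      simp only [relabel, Function.comp, Equiv.symm_apply_apply]
    · have h' : ρ v ∉ (G.relabel ρ).O := fun h' => h (hmem.1 h')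
      rw [dif_neg h, dif_neg h']
      by_cases hv : v ∈ G.V
      · have hv' : ρ v ∈ (G.relabel ρ).V := Finset.mem_map_of_mem _ hv
        rw [dif_pos hv, dif_pos hv']
        simp only [relabel, Equiv.symm_apply_apply]
      · have hv' : ρ v ∉ (G.relabel ρ).V := fun h' => hv (by
          simpa only [Equiv.symm_apply_apply] using Finset.mem_map_equiv.1 h')
        rw [dif_neg hv, dif_neg hv']
  have hE (e : Sym2 VS) : edF (G.relabel ρ).E (η ∘ ρ.symm) (e.map ρ) = edF G.E η e := by
    induction e using Sym2.ind with | _ v w =>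
    have : (G.relabel ρ).E.Adj (ρ v) (ρ w) ↔ G.E.Adj (ρ.symm (ρ v)) (ρ.symm (ρ w)) := Iff.rfl
    rw [edF, edF, Sym2.map_mk, hs_mk, hs_mk]
    refine if_congr ?_ ?_ rfl
    · rw [Equiv.symm_apply_apply, Equiv.symm_apply_apply] at this
      exact this
    · rw [Function.comp, Function.comp, Equiv.symm_apply_apply, Equiv.symm_apply_apply]
  rw [sem, sem, hV, Finset.prod_map, Finset.prod_map, Finset.sym2_map, Finset.prod_map]
  have hi : (G.V.map ρ.toEmbedding).image (η ∘ ρ.symm) = G.V.image η := by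
    rw [Finset.map_eq_image, Finset.image_image]
    congr 1
    ext1 v
    exact congrArg η (ρ.symm_apply_apply v)
  rw [hi]
  congr 2
  · congr 1
    · refine Finset.prod_congr rfl fun v _ => ?_
      exact (hin v _).trans (by rw [Function.comp, Equiv.coe_toEmbedding, Equiv.symm_apply_apply])
    · refine Finset.prod_congr rfl fun v _ => ?_
      exact (hout v _).trans (by rw [Function.comp, Equiv.coe_toEmbedding, Equiv.symm_apply_apply])
  · exact Finset.prod_congr rfl fun e _ => hE e

end MBQCLCGraph

namespace MBQCLCGraph

open ZX Fn

variable {VS : Type u} {N : ℕ}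

/-! ### Soundness of the operations on graphs -/

theorem sameZX_localCompNonInput (G : MBQCLCGraph VS) {u : VS} (hu : u ∈ G.V) (hI : u ∉ G.I) :
    SameZX G (G.localCompNonInput u) := by
  obtain ⟨N, ia, oa, η, s, c, h, hi, ho, hio, hsc, hs, hc, -, hs'⟩ := exists_naming G.V
  exact sameZX_of_sem rfl rfl h h hi ho hio (fun _ => rfl) (fun _ => rfl)
    (sem_localComp G hu hI h hsc hs hc hs')

theorem sameZX_removeVertex (G : MBQCLCGraph VS) {u : VS} (hV : u ∈ G.V) (hI : u ∉ G.I)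
    (hO : u ∉ G.O) (a : Fin 2) (hm : G.meas ⟨u, hV, hO⟩ = (.YZ, (a : ℕ) • (π : Real.Angle)) ∨
      G.meas ⟨u, hV, hO⟩ = (.XZ, (a : ℕ) • (π : Real.Angle))) :
    SameZX G (G.removeVertex u hI hO a) := by
  obtain ⟨N, ia, oa, η, s, c, h, hi, ho, hio, -⟩ := exists_naming G.V
  classical
  refine sameZX_of_sem (G' := G.removeVertex u hI hO a) rfl rfl h
    ⟨h.injOn.mono ?_, h.ia_ne, h.oa_ne⟩ hi ho hio (fun _ => rfl) (fun _ => rfl)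
    (sem_removeVertex G hV hI hO a hm h)
  intro v hv
  exact Finset.mem_of_mem_erase (Finset.mem_coe.1 hv)

theorem get_map {α β : Type*} {f : α → β} {l : List α} {l' : List β} (h : l' = l.map f)
    (hl : l'.length = l.length) (k : Fin l'.length) : l'.get k = f (l.get (finCongr hl k)) := by
  subst h
  simp

theorem sameZX_expandInput (G : MBQCLCGraph VS) {u u' : VS} (hu : u ∈ G.I) (hu' : u' ∉ G.V) :
    SameZX G (G.expandInput u u' hu hu') := by
  classical
  obtain ⟨N, ia, oa, η, s, c, h, hi, ho, hio, -, hs, -, hs', -⟩ := exists_naming (insert u' G.V)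
  have hsub : (G.V : Set VS) ⊆ (insert u' G.V : Finset VS) := fun v hv =>
    Finset.mem_insert_of_mem hv
  have hia (v w : VS) : Function.update ia u' (ia u) v ≠ η w := by
    by_cases hv : v = u'
    · rw [hv, Function.update_self]; exact h.ia_ne _ _
    · rw [Function.update_of_ne hv]; exact h.ia_ne _ _
  have hV : (G.expandInput u u' hu hu').V = insert u' G.V := by
    simp only [expandInput]
  have hl : (G.expandInput u u' hu hu').I.length = G.I.length := List.length_map _
  refine sameZX_of_sem (G' := G.expandInput u u' hu hu') (ia' := Function.update ia u' (ia u))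
    hl rfl ⟨h.injOn.mono hsub, h.ia_ne, h.oa_ne⟩
    ⟨hV ▸ h.injOn, hia, h.oa_ne⟩ (hi.mono hsub) (ho.mono hsub) hio ?_ (fun _ => rfl) ?_
  · intro k
    rw [get_map (show (G.expandInput u u' hu hu').I = G.I.map _ from rfl) hl]
    have hm := G.I_sub _ (List.get_mem G.I (finCongr hl k))
    generalize G.I.get (finCongr hl k) = v at *
    split_ifs with hk
    · rw [Function.update_self, hk]
    · rw [Function.update_of_ne fun h : v = u' => hu' (h ▸ hm)]
  · convert sem_expandInput G hu hu' (by convert h) hs hs'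

theorem sameZX_relabel (G : MBQCLCGraph VS) (ρ : Equiv.Perm VS) : SameZX G (G.relabel ρ) := by
  obtain ⟨N, ia, oa, η, s, c, h, hi, ho, hio, -⟩ := exists_naming G.V
  have hI : (G.relabel ρ).I.length = G.I.length := List.length_map _
  have hO : (G.relabel ρ).O.length = G.O.length := List.length_map _
  refine sameZX_of_sem (G' := G.relabel ρ) hI hO h
    ⟨?_, fun v w => h.ia_ne _ _, fun v w => h.oa_ne _ _⟩ hi ho hio (ia' := ia ∘ ρ.symm)
    (oa' := oa ∘ ρ.symm) (η' := η ∘ ρ.symm) ?_ ?_ (sem_relabel G ρ ia oa η)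
  · intro v hv w hw hvw
    exact ρ.symm.injective (h.injOn (Finset.mem_map_equiv.1 hv) (Finset.mem_map_equiv.1 hw) hvw)
  · intro k
    rw [get_map (show (G.relabel ρ).I = G.I.map ρ from rfl) hI]
    exact congrArg ia (ρ.symm_apply_apply _)
  · intro k
    rw [get_map (show (G.relabel ρ).O = G.O.map ρ from rfl) hO]
    exact congrArg oa (ρ.symm_apply_apply _)

theorem IsLocalComp.sameZX {u : VS} {G G' : MBQCLCGraph VS} (h : IsLocalComp u G G') :
    SameZX G G' := by
  classical
  cases h with
  | nonInput hV hI => exact G.sameZX_localCompNonInput hV hI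
  | input hI u' hu' =>
    refine (G.sameZX_expandInput hI hu').trans (sameZX_localCompNonInput _ ?_ ?_)
    · exact Finset.mem_insert_of_mem (G.I_sub _ hI)
    · exact fun h => ((mem_replaceName_iff hI).1 h).elim (fun h => hu' (h ▸ G.I_sub _ hI))
        fun h => h.2 rfl

theorem IsPivot.sameZX {u v : VS} {G G' : MBQCLCGraph VS} (h : IsPivot u v G G') :
    SameZX G G' := by
  obtain ⟨-, G₁, G₂, h1, h2, h3⟩ := h
  exact (h1.sameZX.trans h2.sameZX).trans h3.sameZX

theorem IsVertexRemoval.sameZX {u : VS} {G G' : MBQCLCGraph VS} (h : IsVertexRemoval u G G') :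
    SameZX G G' := by
  obtain ⟨hV, hI, hO, a, hm, rfl⟩ := h
  exact G.sameZX_removeVertex hV hI hO a hm

theorem IsRenaming.sameZX {U W : List VS} {G G' : MBQCLCGraph VS} (h : IsRenaming U W G G') :
    SameZX G G' := by
  obtain ⟨-, -, -, -, -, rfl⟩ := h
  exact G.sameZX_relabel _

end MBQCLCGraph

/-! ### From graphs to terms and 2-cells -/

/-- `lift` keeps permutations, composition and tensor, so each prop axiom goes to the same axiom;
the source has no further equations. -/
theorem PropEq.lift {Sig : ℕ → ℕ → Type u} {Sig' : ℕ → ℕ → Type v}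
    {R' : ∀ ⦃n m : ℕ⦄, PropTerm Sig' n m → PropTerm Sig' n m → Prop}
    (φ : ∀ {n m : ℕ}, Sig n m → PropTerm Sig' n m) {n m : ℕ} {s t : PropTerm Sig n m}
    (h : PropEq (fun _ _ _ _ => False) s t) :
    PropEq R' (PropTerm.lift φ s) (PropTerm.lift φ t) := by
  induction h with
  | rule h => exact h.elim
  | refl t => exact .refl _
  | symm _ ih => exact .symm ih
  | trans _ _ ih ih' => exact .trans ih ih'
  | comp_congr _ _ ih ih' => exact .comp_congr ih ih'
  | tensor_congr _ _ ih ih' => exact .tensor_congr ih ih'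
  | comp_assoc s t r => exact .comp_assoc _ _ _
  | id_comp t => exact .id_comp _
  | comp_id t => exact .comp_id _
  | interchange s t s' t' => exact .interchange _ _ _ _
  | perm_comp σ τ => exact .perm_comp _ _
  | perm_tensor σ τ => exact .perm_tensor _ _
  | tensor_assoc s t r => exact .tensor_assoc _ _ _
  | unit_tensor t => exact .unit_tensor _
  | tensor_unit t => exact .tensor_unit _
  | swap_natural s t => exact .swap_natural _ _

theorem MBQCLCGen.mk_toZX_eq {VS : Type u} {n m : ℕ} {G G' : MBQCLCGen VS n m}
    (h : MBQCLCGraph.SameZX G.1 G'.1) : ZX.mk G.toZX = ZX.mk G'.toZX := by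
  obtain ⟨hI, hO, h⟩ := h
  have e (G : MBQCLCGen VS n m) : ZX.mk G.toZX = ZX.comp (ZX.comp (ZX.perm (finCongr G.2.1.symm))
    (ZX.mk G.1.toZX)) (ZX.perm (finCongr G.2.2)) := rfl
  rw [e, e, h, ZX.assoc, ZX.assoc, ZX.assoc, ZX.assoc, ZX.perm_comp, ← ZX.assoc (ZX.perm _) (ZX.perm _),
    ZX.perm_comp]
  rfl

theorem mainTheorem1 {VS : Type*} [Countable VS] {n m : ℕ} (G G' : MBQCLCTerm VS n m)
    (η : MBQCLCTwoCell G G') : translationD G = translationD G' := by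
  induction η with
  | localComp u G G' h => exact MBQCLCGen.mk_toZX_eq h.sameZX
  | pivot u v G G' h => exact MBQCLCGen.mk_toZX_eq h.sameZX
  | vertexRemoval u G G' h => exact MBQCLCGen.mk_toZX_eq h.sameZX
  | id h => exact Quotient.sound (h.lift _)
  | vcomp _ _ ih ih' => exact ih.trans ih'
  | hcomp _ _ ih ih' => exact congrArg₂ ZX.comp ih ih'
  | tensor _ _ ih ih' => exact congrArg₂ ZX.tens ih ih'
  -- The remaining generator is `renaming`.
  | _ =>
    rename_i h
    exact MBQCLCGen.mk_toZX_eq h.sameZX
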